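/- Everything is over $\mathbb{C}$, dg means cohomologically $\mathbb{Z}$-graded, and the Koszul sign rule is in force. A *dg vertex Poisson algebra* $P$ is a commutative dg algebra with an even derivation $T$ commuting with $d$ and products $a_{(n)}b$ ($n\ge 0$, zero for $n\gg0$), such that $(P,T,{}_{(n)})$ is a dg vertex Lie algebra ($(Ta)_{(n)}=-n\,a_{(n-1)}$, skew-symmetry, commutator formula, compatibility with $d$) and every $a_{(n)}$ is a graded derivation of the multiplication. * **Associated dg Poisson algebra.** $R^{\mathrm{co}}_P$ is the quotient of $P$ by the ideal generated by $\operatorname{Im}T$, with bracket $\{\bar a,\bar b\}=\overline{a_{(0)}b}$. * **Opposites and tensor products.** $R^{\mathrm{op}}$ has the bracket $-\{\,,\}$. $P^{\mathrm{op}}$ has the same multiplication, with $T$ replaced by $-T$ and $a_{(n)}$ by $(-1)^{n+1}a_{(n)}$. On tensor products, $$\{r\otimes s,r'\otimes s'\}=(-1)^{|s||r'|}\bigl(\{r,r'\}\otimes ss'+rr'\otimes\{s,s'\}\bigr),$$ $T=T\otimes1+1\otimes T$, and $$(a\otimes b)_{(n)}(a'\otimes b')=(-1)^{|b||a'|}\sum_{j\ge0}\tfrac1{j!}\bigl((T^ja)a'\otimes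 b_{(n+j)}b'+a_{(n+j)}a'\otimes(T^jb)b'\bigr).$$ * **Momentum maps.** For a Lie algebra $\mathfrak{g}$ (in degree $0$), $J_\infty(\mathfrak{g})=\mathfrak{g}[t]$ is the vertex Lie algebra with zero differential, $T$ the multiplication by $t$, $x_{(0)}y=[x,y]$ and $x_{(n)}y=0$ for $n>0$, $x,y\in\mathfrak{g}$. A *coisson momentum map* is a morphism $\mu:J_\infty(\mathfrak{g})\to P$ of dg vertex Lie algebras. A *Poisson algebra object* over $\mathfrak{g}$ is a dg vertex Poisson algebra $P$ with a coisson momentum map such that each element of $P$ lies in a finite-dimensional subspace stable under all operators $\mu(x)_{(n)}$, $x\in\mathfrak{g}$, $n\ge0$. * **BRST complexes.** Let $\mathfrak{g}$ be finite-dimensional with basis $(x_i)$. The dg Poisson algebra $\mathrm{cCl}(\mathfrak{g})=\Lambda(\mathfrak{g}\oplus\mathfrak{g}^*)$ has generators $\psi(x)$, $x\in\mathfrak{g}$, of degree $-1$ and $\psi^*(f)$, $f\in\mathfrak{g}^*$, of degree $1$, zero differential and $\{\psi(x),\psi^*(f)\}=f(x)$, $\{\psi,\psi\}=\{\psi^*,\psi^*\}=0$.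 The dg vertex Poisson algebra $\mathrm{coCl}(J_\infty(\mathfrak{g}))=\Lambda(\mathfrak{g}[t]\oplus\mathfrak{g}^*[t])$ is freely generated, as a differential algebra with derivation $T$, by $\psi(x),\psi^*(f)$ in the same degrees; it has zero differential, $\psi(x)_{(0)}\psi^*(f)=f(x)$, and all other products between $\psi$'s and $\psi^*$'s, apart from those given by skew-symmetry, vanish. Put $\psi^*_i=\psi^*(x^i)$ for the dual basis $(x^i)$ and $$Q_\mu=\sum_i\psi^*_i\otimes\mu(x_i)+\tfrac12\sum_{i,j}\psi^*_i\,\psi([x_i,x_j])\,\psi^*_j\otimes1 .$$ For $\mu:\mathfrak{g}\to R$, $\mathrm{cBRST}(\mathfrak{g},R,\mu)$ is $\mathrm{cCl}(\mathfrak{g})\otimes R$ with the differential $d+\{Q_\mu,-\}$. For $\mu:J_\infty(\mathfrak{g})\to P$, $\mathrm{BRST}_{\mathrm{co}}(J_\infty(\mathfrak{g}),P,\mu)$ is $\mathrm{coCl}(J_\infty(\mathfrak{g}))\otimes P$ with the differential $d+(Q_\mu)_{(0)}$. **Proposition.** Let $\mathfrak{g}_1,\mathfrak{g}_2,\mathfrak{g}_3$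 be finite-dimensional semisimple complex Lie algebras, let $(P,\mu_P)$ be a Poisson algebra object over $\mathfrak{g}_1\times\mathfrak{g}_2$ and $(P',\mu_{P'})$ one over $\mathfrak{g}_2\times\mathfrak{g}_3$. Let $\mu_{\mathrm{co}}:J_\infty(\mathfrak{g}_2)\to P^{\mathrm{op}}\otimes P'$ be the $T$-equivariant map with $\mu_{\mathrm{co}}(x)=-\mu_P(0,x)\otimes1+1\otimes\mu_{P'}(x,0)$ for $x\in\mathfrak{g}_2$, and let $$P'\mathbin{\widetilde\circ}P=\mathrm{BRST}_{\mathrm{co}}(J_\infty(\mathfrak{g}_2),P^{\mathrm{op}}\otimes P',\mu_{\mathrm{co}})$$ be the coisson gluing. Let $\mu:\mathfrak{g}_2\to(R^{\mathrm{co}}_P)^{\mathrm{op}}\otimes R^{\mathrm{co}}_{P'}$ be the induced map $x\mapsto-\overline{\mu_P(0,x)}\otimes1+1\otimes\overline{\mu_{P'}(x,0)}$. Then $R^{\mathrm{co}}_{P'\widetilde\circ P}$ and $\mathrm{cBRST}(\mathfrak{g}_2,(R^{\mathrm{co}}_P)^{\mathrm{op}}\otimes R^{\mathrm{co}}_{P'},\mu)$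 are dg Poisson algebras, and $$R^{\mathrm{co}}_{P'\widetilde\circ P}\;\simeq\;\mathrm{cBRST}\bigl(\mathfrak{g}_2,(R^{\mathrm{co}}_P)^{\mathrm{op}}\otimes R^{\mathrm{co}}_{P'},\mu\bigr)$$ as dg Poisson algebras: there is an algebra isomorphism preserving degrees, differentials and brackets. -/

import Mathlib

open scoped TensorProduct DirectSum

universe u v w u₁ u₂ u₃

noncomputable section

namespace CoissonGluing

/-! ### Gradings -/

/-- The linear operator acting on the homogeneous component of degree `i` by the scalar `c i`. -/
def degScale {A : Type u} [AddCommGroup A] [Module ℂ A] (𝒜 : ℤ → Submodule ℂ A)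
    [DirectSum.Decomposition 𝒜] (c : ℤ → ℂ) : A →ₗ[ℂ] A :=
  DirectSum.toModule ℂ ℤ A (fun i => c i • (𝒜 i).subtype) ∘ₗ
    (DirectSum.decomposeLinearEquiv 𝒜).toLinearMap

theorem degScale_of_mem {A : Type u} [AddCommGroup A] [Module ℂ A] (𝒜 : ℤ → Submodule ℂ A)
    [DirectSum.Decomposition 𝒜] (c : ℤ → ℂ) {i : ℤ} {x : A} (hx : x ∈ 𝒜 i) :
    degScale 𝒜 c x = c i • x := by
  simp only [degScale, LinearMap.comp_apply, LinearEquiv.coe_coe,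
    DirectSum.decomposeLinearEquiv_apply, DirectSum.decompose_of_mem 𝒜 hx]
  rw [← DirectSum.lof_eq_of ℂ, DirectSum.toModule_lof]
  simp

theorem isInternal_of_scale {M : Type u} [AddCommGroup M] [Module ℂ M] (ℳ : ℤ → Submodule ℂ M)
    (φ : M →ₗ[ℂ] M) (h : ∀ n, ∀ x ∈ ℳ n, φ x = (2 : ℂ) ^ n • x) (htop : ⨆ n, ℳ n = ⊤) :
    DirectSum.IsInternal ℳ := by
  rw [DirectSum.isInternal_submodule_iff_iSupIndep_and_iSup_eq_top]
  refine ⟨?_, htop⟩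
  have hind := Module.End.eigenspaces_iSupIndep φ
  have hinj : Function.Injective (fun n : ℤ => (2 : ℂ) ^ n) := by
    intro a b hab
    have h2 : ((2 : ℝ) : ℂ) ^ a = ((2 : ℝ) : ℂ) ^ b := by simpa using hab
    have h3 : (2 : ℝ) ^ a = (2 : ℝ) ^ b := by exact_mod_cast h2
    exact zpow_right_injective₀ (by norm_num) (by norm_num) h3
  exact (hind.comp hinj).mono fun n x hx => by
    simpa [Module.End.mem_eigenspace_iff] using h n x hx

/-- The parity involution `x ↦ (-1)^|x| x`. -/
def parity {A : Type u} [AddCommGroup A] [Module ℂ A] (𝒜 : ℤ → Submodule ℂ A)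
    [DirectSum.Decomposition 𝒜] : A →ₗ[ℂ] A :=
  degScale 𝒜 fun i => ((i.negOnePow : ℤ) : ℂ)

/-! ### Dg algebras, dg Poisson algebras, dg vertex Lie and vertex Poisson algebras

The structures `Pre...` collect the underlying data (a genuine `ℤ`-graded associative unital
algebra and bilinear operations); the axioms are the predicates `Is...`. -/

/-- A `ℤ`-graded algebra with a linear endomorphism `d`. -/
structure PreDGAlg where
  carrier : Type u
  [ring : Ring carrier]
  [algebra : Algebra ℂ carrier]
  deg : ℤ → Submodule ℂ carrier
  [graded : GradedAlgebra deg]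
  d : carrier →ₗ[ℂ] carrier

attribute [instance] PreDGAlg.ring PreDGAlg.algebra PreDGAlg.graded

/-- `A` is a commutative dg algebra (with cohomological grading). -/
structure PreDGAlg.IsCDGA (A : PreDGAlg.{u}) : Prop where
  mul_comm : ∀ i j, ∀ a ∈ A.deg i, ∀ b ∈ A.deg j, a * b = (i * j).negOnePow • (b * a)
  d_mem : ∀ i, ∀ a ∈ A.deg i, A.d a ∈ A.deg (i + 1)
  d_d : ∀ a, A.d (A.d a) = 0
  d_mul : ∀ i, ∀ a ∈ A.deg i, ∀ b, A.d (a * b) = A.d a * b + i.negOnePow • (a * A.d b)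

/-- The data of a dg Poisson algebra. -/
structure PrePoisson extends PreDGAlg.{u} where
  bracket : carrier →ₗ[ℂ] carrier →ₗ[ℂ] carrier

/-- `R` is a dg Poisson algebra. -/
structure PrePoisson.IsDGPoisson (R : PrePoisson.{u}) : Prop extends R.toPreDGAlg.IsCDGA where
  bracket_mem : ∀ i j, ∀ a ∈ R.deg i, ∀ b ∈ R.deg j, R.bracket a b ∈ R.deg (i + j)
  skew : ∀ i j, ∀ a ∈ R.deg i, ∀ b ∈ R.deg j,
    R.bracket a b = (1 + i * j).negOnePow • R.bracket b a
  jacobi : ∀ i j k, ∀ x ∈ R.deg i, ∀ y ∈ R.deg j, ∀ z ∈ R.deg k,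
    (k * i).negOnePow • R.bracket x (R.bracket y z)
      + (i * j).negOnePow • R.bracket y (R.bracket z x)
      + (j * k).negOnePow • R.bracket z (R.bracket x y) = 0
  d_bracket : ∀ i, ∀ a ∈ R.deg i, ∀ b,
    R.d (R.bracket a b) = R.bracket (R.d a) b + i.negOnePow • R.bracket a (R.d b)
  leibniz : ∀ i j k, ∀ f ∈ R.deg i, ∀ g ∈ R.deg j, ∀ h ∈ R.deg k,
    R.bracket f (g * h) = R.bracket f g * h + (j * k).negOnePow • (R.bracket f h * g)

/-- Isomorphisms of dg Poisson algebras: isomorphisms of algebras preserving the degree and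
intertwining the differentials and the Poisson brackets. -/
structure PrePoisson.Iso (R : PrePoisson.{u}) (S : PrePoisson.{v}) extends
    R.carrier ≃ₐ[ℂ] S.carrier where
  map_deg : ∀ i a, toAlgEquiv a ∈ S.deg i ↔ a ∈ R.deg i
  map_d : ∀ a, toAlgEquiv (R.d a) = S.d (toAlgEquiv a)
  map_bracket : ∀ a b, toAlgEquiv (R.bracket a b) = S.bracket (toAlgEquiv a) (toAlgEquiv b)

/-- The data of a dg vertex Lie algebra; `Y a b n` is the `n`-th product `a₍ₙ₎ b`, so that the
finitely supported sequence `Y a b` is `Y₋(a, z) b = ∑ n, (a₍ₙ₎ b) z ^ (-n-1)`. -/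
structure PreVertexLie where
  carrier : Type u
  [addCommGroup : AddCommGroup carrier]
  [module : Module ℂ carrier]
  deg : ℤ → Submodule ℂ carrier
  [decomposition : DirectSum.Decomposition deg]
  d : carrier →ₗ[ℂ] carrier
  T : carrier →ₗ[ℂ] carrier
  Y : carrier →ₗ[ℂ] carrier →ₗ[ℂ] (ℕ →₀ carrier)

attribute [instance] PreVertexLie.addCommGroup PreVertexLie.module PreVertexLie.decomposition

/-- `L` is a dg vertex Lie algebra. -/
structure PreVertexLie.IsDGVertexLie (L : PreVertexLie.{u}) : Prop where
  d_mem : ∀ i, ∀ a ∈ L.deg i, L.d a ∈ L.deg (i + 1)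
  d_d : ∀ a, L.d (L.d a) = 0
  T_mem : ∀ i, ∀ a ∈ L.deg i, L.T a ∈ L.deg i
  T_d : ∀ a, L.T (L.d a) = L.d (L.T a)
  Y_mem : ∀ i j, ∀ a ∈ L.deg i, ∀ b ∈ L.deg j, ∀ n, L.Y a b n ∈ L.deg (i + j)
  Y_T_zero : ∀ a b, L.Y (L.T a) b 0 = 0
  Y_T_succ : ∀ a b n, L.Y (L.T a) b (n + 1) = -((n : ℂ) + 1) • L.Y a b n
  skew : ∀ i j, ∀ a ∈ L.deg i, ∀ b ∈ L.deg j, ∀ n,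
    L.Y a b n = ∑ᶠ k : ℕ, (i * j + n + k + 1).negOnePow •
      ((k.factorial : ℂ)⁻¹ • (L.T ^ k) (L.Y b a (n + k)))
  commutator : ∀ i j, ∀ a ∈ L.deg i, ∀ b ∈ L.deg j, ∀ c m n,
    L.Y a (L.Y b c n) m - (i * j).negOnePow • L.Y b (L.Y a c m) n =
      ∑ k ∈ Finset.range (m + 1), (m.choose k : ℂ) • L.Y (L.Y a b k) c (m + n - k)
  d_Y : ∀ i, ∀ a ∈ L.deg i, ∀ b n,
    L.d (L.Y a b n) = L.Y (L.d a) b n + i.negOnePow • L.Y a (L.d b) n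

/-- Morphisms of dg vertex Lie algebras. -/
structure PreVertexLie.Hom (L : PreVertexLie.{u}) (M : PreVertexLie.{v}) extends
    L.carrier →ₗ[ℂ] M.carrier where
  map_deg : ∀ i, ∀ a ∈ L.deg i, toLinearMap a ∈ M.deg i
  map_d : ∀ a, toLinearMap (L.d a) = M.d (toLinearMap a)
  map_T : ∀ a, toLinearMap (L.T a) = M.T (toLinearMap a)
  map_Y : ∀ a b n, toLinearMap (L.Y a b n) = M.Y (toLinearMap a) (toLinearMap b) n

/-- The data of a dg vertex Poisson algebra: the vacuum is the unit, `T` is the translation and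
`Y a b n` is the `n`-th product `a₍ₙ₎ b` for `n ≥ 0`. -/
structure PreVertexPoisson extends PreDGAlg.{u} where
  T : carrier →ₗ[ℂ] carrier
  Y : carrier →ₗ[ℂ] carrier →ₗ[ℂ] (ℕ →₀ carrier)

/-- Forget the multiplication. -/
def PreVertexPoisson.toVertexLie (P : PreVertexPoisson.{u}) : PreVertexLie.{u} where
  carrier := P.carrier
  deg := P.deg
  d := P.d
  T := P.T
  Y := P.Y

/-- `P` is a dg vertex Poisson algebra. -/
structure PreVertexPoisson.IsDGVertexPoisson (P : PreVertexPoisson.{u}) : Prop extends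
    P.toPreDGAlg.IsCDGA where
  vertexLie : P.toVertexLie.IsDGVertexLie
  T_mul : ∀ a b, P.T (a * b) = P.T a * b + a * P.T b
  Y_mul : ∀ i j, ∀ a ∈ P.deg i, ∀ b ∈ P.deg j, ∀ c n,
    P.Y a (b * c) n = P.Y a b n * c + (i * j).negOnePow • (b * P.Y a c n)

/-! ### Opposites -/

/-- The opposite dg Poisson algebra: the bracket changes sign. -/
def PrePoisson.op (R : PrePoisson.{u}) : PrePoisson.{u} where
  toPreDGAlg := R.toPreDGAlg
  bracket := -R.bracket

/-- The opposite dg vertex Poisson algebra: `T` is replaced by `-T` and `Y₋(a, z)` by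
`Y₋(a, -z)`, that is, `a₍ₙ₎` by `(-1)^(n+1) a₍ₙ₎`; the multiplication does not change. -/
def PreVertexPoisson.op (P : PreVertexPoisson.{u}) : PreVertexPoisson.{u} where
  toPreDGAlg := P.toPreDGAlg
  T := -P.T
  Y := P.Y.compr₂ (Finsupp.lsum ℂ fun n : ℕ => (-1 : ℂ) ^ (n + 1) • Finsupp.lsingle n)

/-! ### Tensor products, with the Koszul sign rule -/

section Tensor

variable {A : Type u} {B : Type v} [Ring A] [Algebra ℂ A] [Ring B] [Algebra ℂ B]
variable (𝒜 : ℤ → Submodule ℂ A) (ℬ : ℤ → Submodule ℂ B) [GradedAlgebra 𝒜] [GradedAlgebra ℬ]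

/-- The component of degree `n` of the tensor product, spanned by the `a ⊗ b` with
`|a| + |b| = n`. -/
def tensorDeg (n : ℤ) : Submodule ℂ (𝒜 ᵍ⊗[ℂ] ℬ) :=
  Submodule.span ℂ {x | ∃ i j, i + j = n ∧ ∃ a ∈ 𝒜 i, ∃ b ∈ ℬ j,
    x = GradedTensorProduct.tmul ℂ a b}

theorem tmul_mem_tensorDeg {i j n : ℤ} (h : i + j = n) {a : A} {b : B} (ha : a ∈ 𝒜 i)
    (hb : b ∈ ℬ j) : (GradedTensorProduct.tmul ℂ a b : 𝒜 ᵍ⊗[ℂ] ℬ) ∈ tensorDeg 𝒜 ℬ n :=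
  Submodule.subset_span ⟨i, j, h, a, ha, b, hb, rfl⟩

/-- A linear map `A ⊗ B → A ⊗ B` obtained from linear maps of the factors, without signs. -/
def tensorMap (f : A →ₗ[ℂ] A) (g : B →ₗ[ℂ] B) : 𝒜 ᵍ⊗[ℂ] ℬ →ₗ[ℂ] 𝒜 ᵍ⊗[ℂ] ℬ :=
  (GradedTensorProduct.of ℂ 𝒜 ℬ).toLinearMap ∘ₗ TensorProduct.map f g ∘ₗ
    (GradedTensorProduct.of ℂ 𝒜 ℬ).symm.toLinearMap

theorem tensorMap_tmul (f : A →ₗ[ℂ] A) (g : B →ₗ[ℂ] B) (a : A) (b : B) :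
    tensorMap 𝒜 ℬ f g (GradedTensorProduct.tmul ℂ a b) =
      GradedTensorProduct.tmul ℂ (f a) (g b) := rfl

theorem tensorDeg_iSup : ⨆ n, tensorDeg 𝒜 ℬ n = ⊤ := by
  rw [eq_top_iff]
  rintro x -
  obtain ⟨y, rfl⟩ := (GradedTensorProduct.of ℂ 𝒜 ℬ).surjective x
  induction y with
  | zero => simp
  | add x y hx hy => simpa using add_mem hx hy
  | tmul a b =>
    induction a using DirectSum.Decomposition.inductionOn 𝒜 with
    | zero => simp
    | add x y hx hy => simpa [TensorProduct.add_tmul] using add_mem hx hy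
    | @homogeneous i a =>
      induction b using DirectSum.Decomposition.inductionOn ℬ with
      | zero => simp
      | add x y hx hy => simpa [TensorProduct.tmul_add] using add_mem hx hy
      | @homogeneous j b =>
        exact Submodule.mem_iSup_of_mem (i + j) (tmul_mem_tensorDeg 𝒜 ℬ rfl a.2 b.2)

theorem tensorDeg_isInternal : DirectSum.IsInternal (tensorDeg 𝒜 ℬ) := by
  refine isInternal_of_scale _
    (tensorMap 𝒜 ℬ (degScale 𝒜 fun i => (2 : ℂ) ^ i) (degScale ℬ fun i => (2 : ℂ) ^ i)) ?_
    (tensorDeg_iSup 𝒜 ℬ)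
  intro n x hx
  induction hx using Submodule.span_induction with
  | mem x hx =>
    obtain ⟨i, j, rfl, a, ha, b, hb, rfl⟩ := hx
    rw [tensorMap_tmul, degScale_of_mem _ _ ha, degScale_of_mem _ _ hb]
    rw [zpow_add₀ (by norm_num), mul_comm, ← smul_smul]
    simp only [GradedTensorProduct.tmul]
    rw [TensorProduct.tmul_smul, ← TensorProduct.smul_tmul', LinearEquiv.map_smul,
      LinearEquiv.map_smul]
  | zero => simp
  | add x y _ _ hx hy => rw [map_add, hx, hy, smul_add]
  | smul c x _ hx => rw [map_smul, hx, smul_comm]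

theorem tensorDeg_gradedMonoid : SetLike.GradedMonoid (tensorDeg 𝒜 ℬ) where
  one_mem := tmul_mem_tensorDeg 𝒜 ℬ (add_zero 0) SetLike.GradedOne.one_mem
    SetLike.GradedOne.one_mem
  mul_mem := by
    intro n m x y hx hy
    induction hx using Submodule.span_induction with
    | mem x hx =>
      obtain ⟨i, j, rfl, a, ha, b, hb, rfl⟩ := hx
      induction hy using Submodule.span_induction with
      | mem y hy =>
        obtain ⟨k, l, rfl, c, hc, e, he, rfl⟩ := hy
        have h := GradedTensorProduct.tmul_coe_mul_coe_tmul (R := ℂ) 𝒜 ℬ a ⟨b, hb⟩ ⟨c, hc⟩ e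
        simp only at h
        rw [h, Units.smul_def]
        exact zsmul_mem (tmul_mem_tensorDeg 𝒜 ℬ (by ring) (SetLike.GradedMul.mul_mem ha hc)
          (SetLike.GradedMul.mul_mem hb he)) _
      | zero => simp
      | add x y _ _ hx hy => rw [mul_add]; exact add_mem hx hy
      | smul c x _ hx =>
        rw [GradedTensorProduct.mul_def, map_smul, ← GradedTensorProduct.mul_def]
        exact Submodule.smul_mem _ _ hx
    | zero => simp
    | add x y _ _ hx hy => rw [add_mul]; exact add_mem hx hy
    | smul c x _ hx =>
      rw [GradedTensorProduct.mul_def, LinearMap.map_smul₂, ← GradedTensorProduct.mul_def]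
      exact Submodule.smul_mem _ _ hx

instance tensorGraded : GradedAlgebra (tensorDeg 𝒜 ℬ) where
  toGradedMonoid := tensorDeg_gradedMonoid 𝒜 ℬ
  toDecomposition := (tensorDeg_isInternal 𝒜 ℬ).chooseDecomposition

/-- The rearrangement `a ⊗ b ⊗ a' ⊗ b' ↦ (-1)^(|b||a'|) a ⊗ a' ⊗ b ⊗ b'`. -/
def shuffle : (𝒜 ᵍ⊗[ℂ] ℬ) ⊗[ℂ] (𝒜 ᵍ⊗[ℂ] ℬ) →ₗ[ℂ] (A ⊗[ℂ] A) ⊗[ℂ] (B ⊗[ℂ] B) :=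
  let σ : B ⊗[ℂ] A →ₗ[ℂ] A ⊗[ℂ] B := (GradedTensorProduct.of ℂ 𝒜 ℬ).symm.toLinearMap ∘ₗ
    (GradedTensorProduct.comm (R := ℂ) ℬ 𝒜).toLinearMap ∘ₗ
      (GradedTensorProduct.of ℂ ℬ 𝒜).toLinearMap
  (TensorProduct.assoc ℂ A A (B ⊗[ℂ] B)).symm.toLinearMap ∘ₗ
    (((TensorProduct.assoc ℂ A B B).toLinearMap ∘ₗ σ.rTensor B ∘ₗ
      (TensorProduct.assoc ℂ B A B).symm.toLinearMap).lTensor A) ∘ₗ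
    (TensorProduct.assoc ℂ A B (A ⊗[ℂ] B)).toLinearMap ∘ₗ
    TensorProduct.map (GradedTensorProduct.of ℂ 𝒜 ℬ).symm.toLinearMap
      (GradedTensorProduct.of ℂ 𝒜 ℬ).symm.toLinearMap

theorem shuffle_tmul {i j : ℤ} (a : A) {b : B} (hb : b ∈ ℬ i) {a' : A} (ha' : a' ∈ 𝒜 j)
    (b' : B) :
    shuffle 𝒜 ℬ (GradedTensorProduct.tmul ℂ a b ⊗ₜ[ℂ] GradedTensorProduct.tmul ℂ a' b') =
      (i * j).negOnePow • ((a ⊗ₜ[ℂ] a') ⊗ₜ[ℂ] (b ⊗ₜ[ℂ] b')) := by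
  have h := GradedTensorProduct.comm_coe_tmul_coe (R := ℂ) ℬ 𝒜 ⟨b, hb⟩ ⟨a', ha'⟩
  simp only at h
  simp only [shuffle, LinearMap.comp_apply, TensorProduct.map_tmul, LinearEquiv.coe_coe,
    GradedTensorProduct.of_symm_of, TensorProduct.assoc_tmul, LinearMap.lTensor_tmul,
    TensorProduct.assoc_symm_tmul, LinearMap.rTensor_tmul, AlgEquiv.toLinearMap_apply]
  rw [h]
  have e : (-1 : ℤˣ) ^ (j * i) = (i * j).negOnePow := by rw [mul_comm]; rfl
  rw [e]
  rcases Int.even_or_odd (i * j) with h | h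
  · simp [Int.negOnePow_even _ h]
  · simp [Int.negOnePow_odd _ h, TensorProduct.neg_tmul, TensorProduct.tmul_neg]

end Tensor

/-- The tensor product of dg algebras. -/
def PreDGAlg.tensor (A : PreDGAlg.{u}) (B : PreDGAlg.{v}) : PreDGAlg.{max u v} where
  carrier := A.deg ᵍ⊗[ℂ] B.deg
  deg := tensorDeg A.deg B.deg
  d := tensorMap A.deg B.deg A.d LinearMap.id + tensorMap A.deg B.deg (parity A.deg) B.d

/-- The tensor product of dg Poisson algebras, with the bracket
`{a ⊗ b, a' ⊗ b'} = (-1)^(|b||a'|) ({a, a'} ⊗ b b' + a a' ⊗ {b, b'})`. -/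
def PrePoisson.tensor (R : PrePoisson.{u}) (S : PrePoisson.{v}) : PrePoisson.{max u v} where
  toPreDGAlg := R.toPreDGAlg.tensor S.toPreDGAlg
  bracket := TensorProduct.curry ((GradedTensorProduct.of ℂ R.deg S.deg).toLinearMap ∘ₗ
    (TensorProduct.map (TensorProduct.lift R.bracket) (LinearMap.mul' ℂ S.carrier) +
      TensorProduct.map (LinearMap.mul' ℂ R.carrier) (TensorProduct.lift S.bracket)) ∘ₗ
    shuffle R.deg S.deg)

/-- The data of the tensor product of dg vertex Poisson algebras, with `T = T ⊗ 1 + 1 ⊗ T` and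
`(a ⊗ b)₍ₙ₎ (a' ⊗ b') = (-1)^(|b||a'|) ∑ j, (1 / j!) ((T ^ j a) a' ⊗ b₍ₙ₊ⱼ₎ b' +
a₍ₙ₊ⱼ₎ a' ⊗ (T ^ j b) b')`. -/
def PreVertexPoisson.tensor (P : PreVertexPoisson.{u}) (Q : PreVertexPoisson.{v}) :
    PreVertexPoisson.{max u v} where
  toPreDGAlg := P.toPreDGAlg.tensor Q.toPreDGAlg
  T := tensorMap P.deg Q.deg P.T LinearMap.id + tensorMap P.deg Q.deg LinearMap.id Q.T
  Y := TensorProduct.curry (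
    (Finsupp.lsum ℂ (fun m : ℕ => ∑ j ∈ Finset.range (m + 1),
        Finsupp.lsingle (m - j) ∘ₗ ((j.factorial : ℂ)⁻¹ •
          ((GradedTensorProduct.of ℂ P.deg Q.deg).toLinearMap ∘ₗ
            (LinearMap.mul' ℂ P.carrier ∘ₗ (P.T ^ j).rTensor P.carrier).rTensor Q.carrier))) ∘ₗ
      (TensorProduct.finsuppRight ℂ ℂ (P.carrier ⊗[ℂ] P.carrier) Q.carrier ℕ).toLinearMap ∘ₗ
      (TensorProduct.lift Q.Y).lTensor (P.carrier ⊗[ℂ] P.carrier) +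
    Finsupp.lsum ℂ (fun m : ℕ => ∑ j ∈ Finset.range (m + 1),
        Finsupp.lsingle (m - j) ∘ₗ ((j.factorial : ℂ)⁻¹ •
          ((GradedTensorProduct.of ℂ P.deg Q.deg).toLinearMap ∘ₗ
            (LinearMap.mul' ℂ Q.carrier ∘ₗ (Q.T ^ j).rTensor Q.carrier).lTensor P.carrier))) ∘ₗ
      (TensorProduct.finsuppLeft ℂ ℂ P.carrier (Q.carrier ⊗[ℂ] Q.carrier) ℕ).toLinearMap ∘ₗ
      (TensorProduct.lift P.Y).rTensor (Q.carrier ⊗[ℂ] Q.carrier)) ∘ₗ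
    shuffle P.deg Q.deg)

/-! ### Exterior algebras -/

section Exterior

variable (M : Type u) (N : Type v) [AddCommGroup M] [Module ℂ M] [AddCommGroup N] [Module ℂ N]

/-- The image of `M` in the exterior algebra of `M × N`. -/
def extLeft : Submodule ℂ (ExteriorAlgebra ℂ (M × N)) :=
  LinearMap.range (ExteriorAlgebra.ι ℂ ∘ₗ LinearMap.inl ℂ M N)

/-- The image of `N` in the exterior algebra of `M × N`. -/
def extRight : Submodule ℂ (ExteriorAlgebra ℂ (M × N)) :=
  LinearMap.range (ExteriorAlgebra.ι ℂ ∘ₗ LinearMap.inr ℂ M N)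

/-- The grading on the exterior algebra of `M × N` with `M` in degree `-1` and `N` in
degree `1`. -/
def extDeg (n : ℤ) : Submodule ℂ (ExteriorAlgebra ℂ (M × N)) :=
  ⨆ (p : ℕ) (q : ℕ) (_ : (q : ℤ) - p = n), extLeft M N ^ p * extRight M N ^ q

theorem extDeg_le (p q : ℕ) :
    extLeft M N ^ p * extRight M N ^ q ≤ extDeg M N ((q : ℤ) - p) :=
  le_iSup_of_le p (le_iSup_of_le q (le_iSup_of_le rfl le_rfl))

theorem ext_commute : Commute (extLeft M N) (extRight M N) := by
  have key : ∀ (m : M) (n : N), ExteriorAlgebra.ι ℂ ((m, 0) : M × N) *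
      ExteriorAlgebra.ι ℂ ((0, n) : M × N) =
      -(ExteriorAlgebra.ι ℂ ((0, n) : M × N) * ExteriorAlgebra.ι ℂ ((m, 0) : M × N)) :=
    fun m n => eq_neg_of_add_eq_zero_left (ExteriorAlgebra.ι_add_mul_swap _ _)
  apply le_antisymm
  · rw [Submodule.mul_le]
    rintro _ ⟨m, rfl⟩ _ ⟨n, rfl⟩
    simp only [LinearMap.comp_apply, LinearMap.inl_apply, LinearMap.inr_apply]
    rw [key]
    exact neg_mem (Submodule.mul_mem_mul ⟨n, rfl⟩ ⟨m, rfl⟩)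
  · rw [Submodule.mul_le]
    rintro _ ⟨n, rfl⟩ _ ⟨m, rfl⟩
    simp only [LinearMap.comp_apply, LinearMap.inl_apply, LinearMap.inr_apply]
    rw [← neg_neg (ExteriorAlgebra.ι ℂ ((0, n) : M × N) * ExteriorAlgebra.ι ℂ ((m, 0) : M × N)),
      ← key]
    exact neg_mem (Submodule.mul_mem_mul ⟨m, rfl⟩ ⟨n, rfl⟩)

theorem extDeg_gradedMonoid : SetLike.GradedMonoid (extDeg M N) where
  one_mem := by
    have h := extDeg_le M N 0 0
    simp only [pow_zero, mul_one, Nat.cast_zero, sub_zero] at h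
    exact h (Submodule.one_le.mp le_rfl)
  mul_mem := by
    intro a b x y hx hy
    have : extDeg M N a * extDeg M N b ≤ extDeg M N (a + b) := by
      simp only [extDeg, Submodule.iSup_mul, Submodule.mul_iSup, iSup_le_iff]
      rintro p' q' rfl p q rfl
      have e : extLeft M N ^ p * extRight M N ^ q * (extLeft M N ^ p' * extRight M N ^ q') =
          extLeft M N ^ (p + p') * extRight M N ^ (q + q') := by
        rw [pow_add, pow_add, mul_assoc, mul_assoc, ← mul_assoc (extRight M N ^ q),
          ← ((ext_commute M N).pow_pow p' q).eq, mul_assoc]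
      rw [e]
      refine le_iSup_of_le (p + p') (le_iSup_of_le (q + q') (le_iSup_of_le ?_ le_rfl))
      push_cast
      ring
    exact this (Submodule.mul_mem_mul hx hy)

theorem extDeg_iSup : ⨆ n, extDeg M N n = ⊤ := by
  rw [eq_top_iff]
  rintro x -
  induction x using ExteriorAlgebra.induction with
  | algebraMap r =>
    refine Submodule.mem_iSup_of_mem 0 ?_
    rw [Algebra.algebraMap_eq_smul_one]
    exact Submodule.smul_mem _ _ (extDeg_gradedMonoid M N).one_mem
  | ι x =>
    have : ExteriorAlgebra.ι ℂ x = ExteriorAlgebra.ι ℂ ((x.1, 0) : M × N) +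
        ExteriorAlgebra.ι ℂ ((0, x.2) : M × N) := by
      rw [← map_add]; simp
    rw [this]
    refine add_mem (Submodule.mem_iSup_of_mem (-1) ?_) (Submodule.mem_iSup_of_mem 1 ?_)
    · have h := extDeg_le M N 1 0
      simp only [pow_zero, mul_one, pow_one] at h
      exact h ⟨x.1, rfl⟩
    · have h := extDeg_le M N 0 1
      simp only [pow_zero, one_mul, pow_one] at h
      exact h ⟨x.2, rfl⟩
  | mul a b ha hb =>
    have : (⨆ n, extDeg M N n) * (⨆ n, extDeg M N n) ≤ ⨆ n, extDeg M N n := by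
      simp only [Submodule.iSup_mul, Submodule.mul_iSup, iSup_le_iff]
      intro i j
      refine le_trans ?_ (le_iSup _ (j + i))
      rw [Submodule.mul_le]
      exact fun x hx y hy => (extDeg_gradedMonoid M N).mul_mem hx hy
    exact this (Submodule.mul_mem_mul ha hb)
  | add a b ha hb => exact add_mem ha hb

theorem extDeg_isInternal : DirectSum.IsInternal (extDeg M N) := by
  let f : M × N →ₗ[ℂ] M × N :=
    LinearMap.prodMap ((2 : ℂ)⁻¹ • LinearMap.id) ((2 : ℂ) • LinearMap.id)
  let F := ExteriorAlgebra.map f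
  have hpow : ∀ (S : Submodule ℂ (ExteriorAlgebra ℂ (M × N))) (c : ℂ),
      (∀ x ∈ S, F x = c • x) → ∀ p : ℕ, ∀ x ∈ S ^ p, F x = c ^ p • x := by
    intro S c h p
    induction p with
    | zero =>
      intro x hx
      rw [pow_zero, Submodule.mem_one] at hx
      obtain ⟨r, rfl⟩ := hx
      rw [AlgHom.commutes, pow_zero, one_smul]
    | succ p ih =>
      intro x hx
      rw [pow_succ] at hx
      refine Submodule.mul_induction_on hx (fun a ha b hb => ?_) (fun x y hx hy => ?_)
      · rw [map_mul, ih a ha, h b hb, smul_mul_smul_comm, pow_succ]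
      · rw [map_add, hx, hy, smul_add]
  have hL : ∀ x ∈ extLeft M N, F x = (2 : ℂ)⁻¹ • x := by
    rintro _ ⟨m, rfl⟩
    rw [← map_smul]
    simp only [LinearMap.comp_apply, LinearMap.inl_apply, F,
      ExteriorAlgebra.map_apply_ι]
    simp [f]
  have hR : ∀ x ∈ extRight M N, F x = (2 : ℂ) • x := by
    rintro _ ⟨m, rfl⟩
    rw [← map_smul]
    simp only [LinearMap.comp_apply, LinearMap.inr_apply, F,
      ExteriorAlgebra.map_apply_ι]
    simp [f]
  refine isInternal_of_scale _ F.toLinearMap ?_ (extDeg_iSup M N)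
  intro n
  change extDeg M N n ≤ LinearMap.eqLocus F.toLinearMap ((2 : ℂ) ^ n • LinearMap.id)
  simp only [extDeg, iSup_le_iff]
  rintro p q rfl
  rw [Submodule.mul_le]
  intro x hx y hy
  simp only [LinearMap.mem_eqLocus, AlgHom.toLinearMap_apply, LinearMap.smul_apply,
    LinearMap.id_apply]
  rw [map_mul, hpow _ _ hL p x hx, hpow _ _ hR q y hy, smul_mul_smul_comm]
  congr 1
  rw [zpow_sub₀ (by norm_num), inv_pow, zpow_natCast, zpow_natCast]
  field_simp

instance extGraded : GradedAlgebra (extDeg M N) where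
  toGradedMonoid := extDeg_gradedMonoid M N
  toDecomposition := (extDeg_isInternal M N).chooseDecomposition

end Exterior
section Contraction

variable {V : Type u} [AddCommGroup V] [Module ℂ V]

/-- The derivation of the exterior algebra of `V` extending `f : V → V`. -/
def extDerivation (f : V →ₗ[ℂ] V) : ExteriorAlgebra ℂ V →ₗ[ℂ] ExteriorAlgebra ℂ V :=
  ((TrivSqZeroExt.sndHom (ExteriorAlgebra ℂ V) (ExteriorAlgebra ℂ V)).restrictScalars ℂ) ∘ₗ
    (ExteriorAlgebra.lift ℂ (A := TrivSqZeroExt (ExteriorAlgebra ℂ V) (ExteriorAlgebra ℂ V))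
      ⟨((TrivSqZeroExt.inlAlgHom ℂ (ExteriorAlgebra ℂ V) (ExteriorAlgebra ℂ V)).toLinearMap ∘ₗ
          ExteriorAlgebra.ι ℂ) +
        ((TrivSqZeroExt.inrHom (ExteriorAlgebra ℂ V) (ExteriorAlgebra ℂ V)).restrictScalars ℂ ∘ₗ
          ExteriorAlgebra.ι ℂ ∘ₗ f), fun v => by
        ext
        · simp
        · simp⟩).toLinearMap

theorem finite_contractLeft (φ : V →ₗ[ℂ] (ℕ →₀ ℂ)) (x : ExteriorAlgebra ℂ V) :
    (Function.support fun k => CliffordAlgebra.contractLeft (Q := (0 : QuadraticForm ℂ V))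
      (Finsupp.lapply k ∘ₗ φ) x).Finite := by
  induction x using CliffordAlgebra.left_induction with
  | algebraMap r => simp [CliffordAlgebra.contractLeft_algebraMap]
  | add x y hx hy =>
    refine (hx.union hy).subset ?_
    simp only [map_add]
    exact Function.support_add _ _
  | ι_mul x v hx =>
    refine ((φ v).support.finite_toSet.union hx).subset ?_
    intro k hk
    by_contra h
    simp only [Set.mem_union, Finset.mem_coe, Finsupp.mem_support_iff, Function.mem_support,
      not_or, not_not] at h
    apply hk
    simp only
    rw [CliffordAlgebra.contractLeft_ι_mul, h.2]
    simp [h.1]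

/-- For a sequence of linear forms `φ₀, φ₁, …` on `V`, finitely many of which do not vanish on any
given vector, the sequence `φₖ ⌋ x` of left contractions (left derivatives). -/
def contractLeftSeq (φ : V →ₗ[ℂ] (ℕ →₀ ℂ)) :
    ExteriorAlgebra ℂ V →ₗ[ℂ] (ℕ →₀ ExteriorAlgebra ℂ V) where
  toFun x := Finsupp.ofSupportFinite _ (finite_contractLeft φ x)
  map_add' x y := by
    ext k
    exact (CliffordAlgebra.contractLeft (Q := (0 : QuadraticForm ℂ V))
      (Finsupp.lapply k ∘ₗ φ)).map_add x y
  map_smul' c x := by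
    ext k
    exact (CliffordAlgebra.contractLeft (Q := (0 : QuadraticForm ℂ V))
      (Finsupp.lapply k ∘ₗ φ)).map_smul c x

/-- For a sequence of linear forms `φ₀, φ₁, …` on `V`, finitely many of which do not vanish on any
given vector, the sequence `x ⌊ φₖ` of right contractions (right derivatives). -/
def contractRightSeq (φ : V →ₗ[ℂ] (ℕ →₀ ℂ)) :
    ExteriorAlgebra ℂ V →ₗ[ℂ] (ℕ →₀ ExteriorAlgebra ℂ V) :=
  Finsupp.mapRange.linearMap CliffordAlgebra.reverse ∘ₗ contractLeftSeq φ ∘ₗ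
    CliffordAlgebra.reverse

end Contraction

/-! ### The classical Clifford algebra and its coisson version -/

section Clifford

variable (g : Type u) [AddCommGroup g] [Module ℂ g] [FiniteDimensional ℂ g]

/-- The dg Poisson algebra `cCl(g)`: the exterior algebra of `g ⊕ g*`, with `g` in degree `-1` and
`g*` in degree `1`, zero differential, and the Poisson bracket determined on generators by
`{x, f} = {f, x} = f x`, `{x, y} = 0` and `{f, h} = 0`. In general `{a, b}` is the sum over a
basis of `g` of (right derivative of `a`) times (left derivative of `b`) in the dual variables. -/
def cCl : PrePoisson.{u} where
  carrier := ExteriorAlgebra ℂ (g × Module.Dual ℂ g)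
  deg := extDeg g (Module.Dual ℂ g)
  d := 0
  bracket :=
    let b := Module.finBasis ℂ g
    let φ : Fin (Module.finrank ℂ g) → Module.Dual ℂ (g × Module.Dual ℂ g) :=
      fun i => b.coord i ∘ₗ LinearMap.fst ℂ _ _
    let φs : Fin (Module.finrank ℂ g) → Module.Dual ℂ (g × Module.Dual ℂ g) :=
      fun i => Module.Dual.eval ℂ g (b i) ∘ₗ LinearMap.snd ℂ _ _
    ∑ i, ((LinearMap.mul ℂ (ExteriorAlgebra ℂ (g × Module.Dual ℂ g))).compl₁₂
        (CliffordAlgebra.contractRight.flip (φ i)) (CliffordAlgebra.contractLeft (φs i)) +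
      (LinearMap.mul ℂ (ExteriorAlgebra ℂ (g × Module.Dual ℂ g))).compl₁₂
        (CliffordAlgebra.contractRight.flip (φs i)) (CliffordAlgebra.contractLeft (φ i)))

/-- The shift `x t ^ k ↦ x t ^ (k + 1)` on `W[t]`, where `W[t]` is realised as `ℕ →₀ W`. -/
def shift (W : Type v) [AddCommGroup W] [Module ℂ W] : (ℕ →₀ W) →ₗ[ℂ] (ℕ →₀ W) :=
  Finsupp.lmapDomain W ℂ Nat.succ

/-- The bilinear map on sequences with values in an algebra with a linear operator `T`
sending `(A, B)` to the sequence with `n`-th term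
`∑ k l, (-1) ^ k (k + l) (k + l - 1) ⋯ (k + l - n + 1) (T ^ (k + l - n) Aₖ) Bₗ`,
i.e. to the coefficient of `λ ^ n / n!` in `∑ k l, (((-λ - T) ^ k (λ + T) ^ l) Aₖ) Bₗ`. -/
def masterSeq {Λ : Type v} [Ring Λ] [Algebra ℂ Λ] (T : Λ →ₗ[ℂ] Λ) :
    (ℕ →₀ Λ) →ₗ[ℂ] (ℕ →₀ Λ) →ₗ[ℂ] (ℕ →₀ Λ) :=
  Finsupp.lsum ℂ fun k => LinearMap.flip (Finsupp.lsum ℂ fun l => LinearMap.flip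
    (∑ n ∈ Finset.range (k + l + 1), ((-1 : ℂ) ^ k * ((k + l).descFactorial n : ℂ)) •
      (((LinearMap.mul ℂ Λ) ∘ₗ T ^ (k + l - n)).compr₂ (Finsupp.lsingle n))))

/-- The dg vertex Poisson algebra `coCl(g[t])`: the exterior algebra on the generators
`T ^ k ψ(x) = (x t ^ k, 0)` of degree `-1` and `T ^ k ψ*(f) = (0, f t ^ k)` of degree `1`, with zero
differential and the products determined by `ψ(x)₍₀₎ ψ*(f) = ψ*(f)₍₀₎ ψ(x) = f x`, all other `n`-th
products of the `ψ(x)` and `ψ*(f)` being zero. In general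
`∑ n, (λ ^ n / n!) a₍ₙ₎ b` is the sum over a basis of `g` of the terms
`(((-λ - T) ^ k (λ + T) ^ l) (right derivative of a)) (left derivative of b)`. -/
def coCl : PreVertexPoisson.{u} where
  carrier := ExteriorAlgebra ℂ ((ℕ →₀ g) × (ℕ →₀ Module.Dual ℂ g))
  deg := extDeg (ℕ →₀ g) (ℕ →₀ Module.Dual ℂ g)
  d := 0
  T := extDerivation (LinearMap.prodMap (shift g) (shift (Module.Dual ℂ g)))
  Y :=
    let b := Module.finBasis ℂ g
    let φ : Fin (Module.finrank ℂ g) → ((ℕ →₀ g) × (ℕ →₀ Module.Dual ℂ g)) →ₗ[ℂ] (ℕ →₀ ℂ) :=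
      fun i => Finsupp.mapRange.linearMap (b.coord i) ∘ₗ LinearMap.fst ℂ _ _
    let φs : Fin (Module.finrank ℂ g) → ((ℕ →₀ g) × (ℕ →₀ Module.Dual ℂ g)) →ₗ[ℂ] (ℕ →₀ ℂ) :=
      fun i => Finsupp.mapRange.linearMap (Module.Dual.eval ℂ g (b i)) ∘ₗ LinearMap.snd ℂ _ _
    let m := masterSeq (extDerivation (LinearMap.prodMap (shift g) (shift (Module.Dual ℂ g))))
    ∑ i, (m.compl₁₂ (contractRightSeq (φ i)) (contractLeftSeq (φs i)) +
      m.compl₁₂ (contractRightSeq (φs i)) (contractLeftSeq (φ i)))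

end Clifford
/-! ### The level zero vertex Lie algebra `g[t]` -/

/-- The grading of a module that is concentrated in degree `0`. -/
def degZero (W : Type u) [AddCommGroup W] [Module ℂ W] (n : ℤ) : Submodule ℂ W :=
  if n = 0 then ⊤ else ⊥

theorem degZero_isInternal (W : Type u) [AddCommGroup W] [Module ℂ W] :
    DirectSum.IsInternal (degZero W) := by
  refine isInternal_of_scale _ LinearMap.id ?_ ?_
  · intro n x hx
    by_cases h : n = 0
    · simp [h]
    · simp only [degZero, h, if_false, Submodule.mem_bot] at hx
      simp [hx]
  · refine eq_top_iff.2 (le_iSup_of_le 0 ?_)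
    simp [degZero]

instance degZeroDecomposition (W : Type u) [AddCommGroup W] [Module ℂ W] :
    DirectSum.Decomposition (degZero W) :=
  (degZero_isInternal W).chooseDecomposition

/-- The vertex Lie algebra `J_∞(g) = g[t]` of a Lie algebra `g` (in cohomological degree `0`, with
zero differential): `T` is the multiplication by `t`, and the products are determined by
`x₍₀₎ y = [x, y]` and `x₍ₙ₎ y = 0` for `x y : g` and `n > 0`; explicitly, `(x t ^ i)₍ₙ₎ (y t ^ j)` is
`(-1) ^ i n (n - 1) ⋯ (n - i + 1) j (j - 1) ⋯ (j - n + i + 1) [x, y] t ^ (i + j - n)` for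
`i ≤ n ≤ i + j`, and `0` for other `n`. -/
def jets (g : Type u) [LieRing g] [LieAlgebra ℂ g] : PreVertexLie.{u} where
  carrier := ℕ →₀ g
  deg := degZero (ℕ →₀ g)
  d := 0
  T := shift g
  Y := Finsupp.lsum ℂ fun i => LinearMap.flip (Finsupp.lsum ℂ fun j => LinearMap.flip
    (∑ n ∈ Finset.range (i + j + 1),
      ((-1 : ℂ) ^ i * (n.descFactorial i : ℂ) * (j.descFactorial (n - i) : ℂ)) •
        ((LinearMap.mk₂ ℂ (fun x y : g => ⁅x, y⁆) add_lie smul_lie lie_add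
          (fun c x y => lie_smul c x y)).compr₂ (Finsupp.lsingle n ∘ₗ Finsupp.lsingle (i + j - n)))))

/-! ### The BRST complexes -/

section BRST

variable (g : Type u) [LieRing g] [LieAlgebra ℂ g] [FiniteDimensional ℂ g]

/-- The classical BRST complex `cCl(g) ⊗ R` of `μ : g → R`, with the differential
`d + {Q, -}`, where `Q = ∑ i, ψ*ᵢ ⊗ μ(xᵢ) + (1/2) ∑ i j, ψ*ᵢ ψ([xᵢ, xⱼ]) ψ*ⱼ ⊗ 1` for a basis
`(xᵢ)` of `g`, `ψ : g → cCl(g)` being the inclusion and `(ψ*ᵢ)` the dual basis of `g*`. -/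
def cBRST (R : PrePoisson.{v}) (μ : g →ₗ[ℂ] R.carrier) : PrePoisson.{max u v} :=
  let X := (cCl g).tensor R
  let b := Module.finBasis ℂ g
  let ψ : g → (cCl g).carrier :=
    fun x => ExteriorAlgebra.ι ℂ ((x, 0) : g × Module.Dual ℂ g)
  let ψs : Fin (Module.finrank ℂ g) → (cCl g).carrier :=
    fun i => ExteriorAlgebra.ι ℂ ((0, b.coord i) : g × Module.Dual ℂ g)
  let Q : X.carrier := ∑ i, (GradedTensorProduct.tmul ℂ (ψs i) (μ (b i)) :
      (cCl g).deg ᵍ⊗[ℂ] R.deg) +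
    (2⁻¹ : ℂ) • ∑ i, ∑ j, (GradedTensorProduct.tmul ℂ (ψs i * (ψ ⁅b i, b j⁆ * ψs j)) 1 :
      (cCl g).deg ᵍ⊗[ℂ] R.deg)
  { X with d := X.d + X.bracket Q }

/-- The coisson BRST complex `coCl(g[t]) ⊗ P` of `μ : g[t] → P`, with the differential
`d + Q₍₀₎`, where `Q = ∑ i, ψ*ᵢ ⊗ μ(xᵢ) + (1/2) ∑ i j, ψ*ᵢ ψ([xᵢ, xⱼ]) ψ*ⱼ ⊗ 1` for a basis
`(xᵢ)` of `g`. -/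
def coBRST (P : PreVertexPoisson.{v}) (μ : (jets g).carrier →ₗ[ℂ] P.carrier) :
    PreVertexPoisson.{max u v} :=
  let X := (coCl g).tensor P
  let b := Module.finBasis ℂ g
  let ψ : g → (coCl g).carrier := fun x => ExteriorAlgebra.ι ℂ
    ((Finsupp.single 0 x, 0) : (ℕ →₀ g) × (ℕ →₀ Module.Dual ℂ g))
  let ψs : Fin (Module.finrank ℂ g) → (coCl g).carrier := fun i => ExteriorAlgebra.ι ℂ
    ((0, Finsupp.single 0 (b.coord i)) : (ℕ →₀ g) × (ℕ →₀ Module.Dual ℂ g))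
  let Q : X.carrier := ∑ i, (GradedTensorProduct.tmul ℂ (ψs i) (μ (Finsupp.single 0 (b i))) :
      (coCl g).deg ᵍ⊗[ℂ] P.deg) +
    (2⁻¹ : ℂ) • ∑ i, ∑ j, (GradedTensorProduct.tmul ℂ (ψs i * (ψ ⁅b i, b j⁆ * ψs j)) 1 :
      (coCl g).deg ᵍ⊗[ℂ] P.deg)
  { X with d := X.d + Finsupp.lapply 0 ∘ₗ X.Y Q }

end BRST

/-! ### The associated dg Poisson algebra -/

section Associated

variable (P : PreVertexPoisson.{u})

/-- The ideals by which the quotient of `P` inherits a dg Poisson structure with bracket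
`{a, b} = a₍₀₎ b`, and that contain the image of `T`. -/
structure IsAssocIdeal (I : Ideal P.carrier) : Prop where
  T_mem : ∀ a, P.T a ∈ I
  mul_mem_right : ∀ a ∈ I, ∀ b, a * b ∈ I
  d_mem : ∀ a ∈ I, P.d a ∈ I
  proj_mem : ∀ a ∈ I, ∀ i, (DirectSum.decompose P.deg a i : P.carrier) ∈ I
  Y_left_mem : ∀ a ∈ I, ∀ b, P.Y a b 0 ∈ I
  Y_right_mem : ∀ a ∈ I, ∀ b, P.Y b a 0 ∈ I

/-- The dg Poisson ideal generated by the image of `T`. In a dg vertex Poisson algebra this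
is the ideal generated by the image of `T`, see `assocIdeal_eq_span`. -/
def assocIdeal : Ideal P.carrier := sInf {I | IsAssocIdeal P I}

theorem assocIdeal_spec : IsAssocIdeal P (assocIdeal P) where
  T_mem a := Submodule.mem_sInf.2 fun _ hI => hI.T_mem a
  mul_mem_right a ha b := Submodule.mem_sInf.2 fun I hI =>
    hI.mul_mem_right a (Submodule.mem_sInf.1 ha I hI) b
  d_mem a ha := Submodule.mem_sInf.2 fun I hI => hI.d_mem a (Submodule.mem_sInf.1 ha I hI)
  proj_mem a ha i := Submodule.mem_sInf.2 fun I hI =>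
    hI.proj_mem a (Submodule.mem_sInf.1 ha I hI) i
  Y_left_mem a ha b := Submodule.mem_sInf.2 fun I hI =>
    hI.Y_left_mem a (Submodule.mem_sInf.1 ha I hI) b
  Y_right_mem a ha b := Submodule.mem_sInf.2 fun I hI =>
    hI.Y_right_mem a (Submodule.mem_sInf.1 ha I hI) b

instance assocIdeal_isTwoSided : (assocIdeal P).IsTwoSided :=
  ⟨fun b ha => (assocIdeal_spec P).mul_mem_right _ ha b⟩

/-- The projection of `P` onto its quotient. -/
def assocMk : P.carrier →ₐ[ℂ] P.carrier ⧸ assocIdeal P :=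
  Ideal.Quotient.mkₐ ℂ (assocIdeal P)

theorem assocMk_eq_zero {a : P.carrier} : assocMk P a = 0 ↔ a ∈ assocIdeal P :=
  Ideal.Quotient.eq_zero_iff_mem

theorem assocMk_surjective : Function.Surjective (assocMk P) :=
  Ideal.Quotient.mkₐ_surjective ℂ (assocIdeal P)

/-- A linear map that vanishes on the ideal descends to the quotient. -/
def assocLift {W : Type v} [AddCommGroup W] [Module ℂ W] (f : P.carrier →ₗ[ℂ] W)
    (hf : ∀ a ∈ assocIdeal P, f a = 0) : P.carrier ⧸ assocIdeal P →ₗ[ℂ] W where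
  toFun := Quotient.lift f fun a b h => by
    rw [← sub_eq_zero, ← map_sub]
    exact hf _ ((Submodule.quotientRel_def _).1 h)
  map_add' x y := by
    obtain ⟨x, rfl⟩ := assocMk_surjective P x
    obtain ⟨y, rfl⟩ := assocMk_surjective P y
    exact f.map_add x y
  map_smul' c x := by
    obtain ⟨x, rfl⟩ := assocMk_surjective P x
    rw [← map_smul]
    exact f.map_smul c x

theorem assocLift_mk {W : Type v} [AddCommGroup W] [Module ℂ W] (f : P.carrier →ₗ[ℂ] W)
    (hf : ∀ a ∈ assocIdeal P, f a = 0) (a : P.carrier) :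
    assocLift P f hf (assocMk P a) = f a := rfl

/-- The induced grading. -/
def assocDeg (n : ℤ) : Submodule ℂ (P.carrier ⧸ assocIdeal P) :=
  (P.deg n).map (assocMk P).toLinearMap

theorem degScale_mem_assocIdeal (c : ℤ → ℂ) {a : P.carrier} (ha : a ∈ assocIdeal P) :
    degScale P.deg c a ∈ assocIdeal P := by
  classical
  rw [← DirectSum.sum_support_decompose P.deg a, map_sum]
  refine Submodule.sum_mem _ fun i _ => ?_
  rw [degScale_of_mem P.deg c (SetLike.coe_mem _), Algebra.smul_def]
  exact Ideal.mul_mem_left _ _ ((assocIdeal_spec P).proj_mem a ha i)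

theorem assocDeg_isInternal : DirectSum.IsInternal (assocDeg P) := by
  refine isInternal_of_scale _ (assocLift P
    ((assocMk P).toLinearMap ∘ₗ degScale P.deg fun i => (2 : ℂ) ^ i) fun a ha =>
      (assocMk_eq_zero P).2 (degScale_mem_assocIdeal P _ ha)) ?_ ?_
  · rintro n _ ⟨a, ha, rfl⟩
    have h : degScale P.deg (fun i => (2 : ℂ) ^ i) a = (2 : ℂ) ^ n • a :=
      degScale_of_mem P.deg _ ha
    refine (assocLift_mk P _ _ a).trans ?_
    rw [LinearMap.comp_apply, h, map_smul]
  · simp only [assocDeg]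
    rw [← Submodule.map_iSup, (DirectSum.Decomposition.isInternal P.deg).submodule_iSup_eq_top,
      Submodule.map_top, LinearMap.range_eq_top]
    exact assocMk_surjective P

instance assocGraded : GradedAlgebra (assocDeg P) where
  one_mem := ⟨1, SetLike.GradedOne.one_mem, map_one (assocMk P)⟩
  mul_mem := by
    rintro i j _ _ ⟨a, ha, rfl⟩ ⟨b, hb, rfl⟩
    exact ⟨a * b, SetLike.GradedMul.mul_mem ha hb, map_mul (assocMk P) a b⟩
  toDecomposition := (assocDeg_isInternal P).chooseDecomposition

/-- The dg Poisson algebra associated to a dg vertex Poisson algebra `P`: the quotient of `P` by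
the ideal generated by the image of `T`, with the bracket induced by `{a, b} = a₍₀₎ b`. -/
def assocPoisson : PrePoisson.{u} where
  carrier := P.carrier ⧸ assocIdeal P
  deg := assocDeg P
  d := assocLift P ((assocMk P).toLinearMap ∘ₗ P.d) fun a ha =>
    (assocMk_eq_zero P).2 ((assocIdeal_spec P).d_mem a ha)
  bracket := assocLift P
    { toFun := fun a => assocLift P ((assocMk P).toLinearMap ∘ₗ Finsupp.lapply 0 ∘ₗ P.Y a)
        fun b hb => (assocMk_eq_zero P).2 ((assocIdeal_spec P).Y_right_mem b hb a)
      map_add' := fun a a' => by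
        refine LinearMap.ext fun x => ?_
        obtain ⟨x, rfl⟩ := assocMk_surjective P x
        simp only [assocLift_mk, LinearMap.comp_apply, map_add, LinearMap.add_apply]
        rfl
      map_smul' := fun c a => by
        refine LinearMap.ext fun x => ?_
        obtain ⟨x, rfl⟩ := assocMk_surjective P x
        simp only [assocLift_mk, LinearMap.comp_apply, map_smul, LinearMap.smul_apply,
          RingHom.id_apply]
        rfl }
    fun a ha => by
      refine LinearMap.ext fun x => ?_
      obtain ⟨x, rfl⟩ := assocMk_surjective P x
      exact (assocMk_eq_zero P).2 ((assocIdeal_spec P).Y_left_mem a ha x)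

theorem assoc_homogeneous_induction {p : P.carrier → Prop} (h0 : p 0)
    (hadd : ∀ a b, p a → p b → p (a + b)) (h : ∀ i, ∀ a ∈ P.deg i, p a) (a : P.carrier) : p a := by
  induction a using DirectSum.Decomposition.inductionOn P.deg with
  | zero => exact h0
  | homogeneous a => exact h _ _ a.2
  | add a b ha hb => exact hadd a b ha hb

/-- For a dg vertex Poisson algebra, the ideal used above is the ideal generated by the image
of `T`. -/
theorem assocIdeal_eq_span (hP : P.IsDGVertexPoisson) :
    assocIdeal P = Ideal.span (Set.range P.T) := by
  have hT : ∀ a, P.T a ∈ Ideal.span (Set.range P.T) := fun a => Ideal.subset_span ⟨a, rfl⟩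
  have hC : ∀ (c : ℂ), ∀ a ∈ Ideal.span (Set.range P.T), c • a ∈ Ideal.span (Set.range P.T) := by
    intro c a ha
    rw [Algebra.smul_def]
    exact Ideal.mul_mem_left _ _ ha
  have hU : ∀ (c : ℤˣ), ∀ a ∈ Ideal.span (Set.range P.T),
      c • a ∈ Ideal.span (Set.range P.T) := by
    intro c a ha
    rw [Units.smul_def]
    exact zsmul_mem ha _
  have hTk : ∀ (k : ℕ) a, k ≠ 0 → (P.T ^ k) a ∈ Ideal.span (Set.range P.T) := by
    intro k a hk
    obtain ⟨k, rfl⟩ := Nat.exists_eq_succ_of_ne_zero hk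
    rw [pow_succ', Module.End.mul_apply]
    exact hT _
  have hskew : ∀ i j, ∀ a ∈ P.deg i, ∀ b ∈ P.deg j, P.Y b a 0 ∈ Ideal.span (Set.range P.T) →
      P.Y a b 0 ∈ Ideal.span (Set.range P.T) := by
    intro i j a ha b hb h
    have e : P.Y a b 0 = ∑ᶠ k : ℕ, (i * j + (0 : ℕ) + k + 1).negOnePow •
      ((k.factorial : ℂ)⁻¹ • (P.T ^ k) (P.Y b a (0 + k))) := hP.vertexLie.skew i j a ha b hb 0
    rw [e]
    refine finsum_induction (· ∈ Ideal.span (Set.range P.T)) (zero_mem _)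
      (fun _ _ => add_mem) fun k => hU _ _ (hC _ _ ?_)
    rcases eq_or_ne k 0 with rfl | hk
    · simpa using h
    · exact hTk k _ hk
  have hYT : ∀ b x, P.Y b (P.T x) 0 ∈ Ideal.span (Set.range P.T) := by
    intro b x
    induction b using assoc_homogeneous_induction P with
    | h0 => simp
    | hadd a b ha hb => simpa using add_mem ha hb
    | h i b hb =>
      induction x using assoc_homogeneous_induction P with
      | h0 => simp
      | hadd a b ha hb => simpa using add_mem ha hb
      | h j x hx =>
        refine hskew i j b hb (P.T x) (hP.vertexLie.T_mem j x hx) ?_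
        have e : P.Y (P.T x) b 0 = 0 := hP.vertexLie.Y_T_zero x b
        rw [e]
        exact zero_mem _
  have hind : ∀ p : P.carrier → Prop, p 0 → (∀ a b, p a → p b → p (a + b)) →
      (∀ i j, ∀ c ∈ P.deg i, ∀ x ∈ P.deg j, p (c * P.T x)) →
      ∀ a ∈ Ideal.span (Set.range P.T), p a := by
    intro p h0 hadd h a ha
    suffices hc : ∀ c, p (c * a) by simpa using hc 1
    induction ha using Submodule.span_induction with
    | mem a ha =>
      obtain ⟨x, rfl⟩ := ha
      intro c
      induction c using assoc_homogeneous_induction P with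
      | h0 => simpa using h0
      | hadd a b ha hb => simpa [add_mul] using hadd _ _ ha hb
      | h i c hc =>
        induction x using assoc_homogeneous_induction P with
        | h0 => simpa using h0
        | hadd a b ha hb => simpa [mul_add] using hadd _ _ ha hb
        | h j x hx => exact h i j c hc x hx
    | zero => simpa using h0
    | add x y _ _ hx hy => exact fun c => by simpa [mul_add] using hadd _ _ (hx c) (hy c)
    | smul c' x _ hx => exact fun c => by simpa [mul_assoc] using hx (c * c')
  have hYr : ∀ a ∈ Ideal.span (Set.range P.T), ∀ b,
      P.Y b a 0 ∈ Ideal.span (Set.range P.T) := by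
    intro a ha b
    induction b using assoc_homogeneous_induction P with
    | h0 => simp
    | hadd b b' hb hb' => simpa using add_mem hb hb'
    | h k b hb =>
      refine hind (fun a => P.Y b a 0 ∈ Ideal.span (Set.range P.T)) (by simp)
        (fun a a' h h' => by simpa using add_mem h h') (fun i j c hc x hx => ?_) a ha
      simp only [hP.Y_mul k i b hb c hc]
      refine add_mem (Ideal.mul_mem_left _ _ (hT x)) (hU _ _ (Ideal.mul_mem_left _ _ (hYT b x)))
  have hproj : ∀ a ∈ Ideal.span (Set.range P.T), ∀ i,
      (DirectSum.decompose P.deg a i : P.carrier) ∈ Ideal.span (Set.range P.T) := by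
    intro a ha n
    refine hind (fun a => (DirectSum.decompose P.deg a n : P.carrier) ∈
      Ideal.span (Set.range P.T)) (by simp) (fun a a' h h' => by simpa using add_mem h h')
      (fun i j c hc x hx => ?_) a ha
    have hm : c * P.T x ∈ P.deg (i + j) :=
      SetLike.GradedMul.mul_mem hc (hP.vertexLie.T_mem j x hx)
    by_cases hn : i + j = n
    · subst hn
      simp only [DirectSum.decompose_of_mem_same P.deg hm]
      exact Ideal.mul_mem_left _ _ (hT x)
    · simp only [DirectSum.decompose_of_mem_ne P.deg hm hn]
      exact zero_mem _
  have hI : IsAssocIdeal P (Ideal.span (Set.range P.T)) := {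
    T_mem := hT
    mul_mem_right := fun a ha b => by
      induction b using assoc_homogeneous_induction P with
      | h0 => simp
      | hadd b b' hb hb' => simpa [mul_add] using add_mem hb hb'
      | h k b hb =>
        refine hind (fun a => a * b ∈ Ideal.span (Set.range P.T)) (by simp)
          (fun a a' h h' => by simpa [add_mul] using add_mem h h')
          (fun i j c hc x hx => ?_) a ha
        have hm : c * P.T x ∈ P.deg (i + j) :=
          SetLike.GradedMul.mul_mem hc (hP.vertexLie.T_mem j x hx)
        have e := hP.mul_comm (i + j) k _ hm b hb
        simp only [e]
        exact hU _ _ (Ideal.mul_mem_left _ _ (Ideal.mul_mem_left _ _ (hT x)))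
    d_mem := fun a ha => by
      refine hind (fun a => P.d a ∈ Ideal.span (Set.range P.T)) (by simp)
        (fun a a' h h' => by simpa using add_mem h h') (fun i j c hc x hx => ?_) a ha
      have e : P.T (P.d x) = P.d (P.T x) := hP.vertexLie.T_d x
      simp only [hP.d_mul i c hc, ← e]
      exact add_mem (Ideal.mul_mem_left _ _ (hT x)) (hU _ _ (Ideal.mul_mem_left _ _ (hT _)))
    proj_mem := hproj
    Y_left_mem := fun a ha b => by
      induction b using assoc_homogeneous_induction P with
      | h0 => simp
      | hadd b b' hb hb' => simpa using add_mem hb hb'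
      | h k b hb =>
        refine hind (fun a => P.Y a b 0 ∈ Ideal.span (Set.range P.T)) (by simp)
          (fun a a' h h' => by simpa using add_mem h h') (fun i j c hc x hx => ?_) a ha
        exact hskew (i + j) k _ (SetLike.GradedMul.mul_mem hc (hP.vertexLie.T_mem j x hx)) b hb
          (hYr _ (Ideal.mul_mem_left _ _ (hT x)) b)
    Y_right_mem := hYr }
  exact le_antisymm (sInf_le hI) (Ideal.span_le.2 (by
    rintro _ ⟨x, rfl⟩
    exact (assocIdeal_spec P).T_mem x))

end Associated

/-! ### Poisson algebra objects with coisson momentum maps and their gluing -/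

/-- A dg vertex Poisson algebra `P` with a coisson momentum map, i.e. a morphism
`μ : g[t] → P` of dg vertex Lie algebras, for which the action of the Lie algebra `g[t]` by the
operators `μ(x)₍ₙ₎` is locally finite. -/
structure CoissonObject (g : Type u) [LieRing g] [LieAlgebra ℂ g] where
  alg : PreVertexPoisson.{v}
  isDGVertexPoisson : alg.IsDGVertexPoisson
  μ : (jets g).Hom alg.toVertexLie
  locallyFinite : ∀ p : alg.carrier, ∃ N : Submodule ℂ alg.carrier, p ∈ N ∧
    FiniteDimensional ℂ N ∧
    ∀ (x : g) (n : ℕ), ∀ q ∈ N, alg.Y (μ.toLinearMap (Finsupp.single 0 x)) q n ∈ N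

section Gluing

variable {g₁ : Type u₁} {g₂ : Type u₂} {g₃ : Type u₃}
  [LieRing g₁] [LieAlgebra ℂ g₁] [LieRing g₂] [LieAlgebra ℂ g₂] [LieRing g₃] [LieAlgebra ℂ g₃]
  (P : CoissonObject.{max u₁ u₂, v} (g₁ × g₂)) (P' : CoissonObject.{max u₂ u₃, w} (g₂ × g₃))

/-- The momentum map `g₂[t] → P.op ⊗ P'`: the extension to `g₂[t]`, compatible with the
translations, of `x ↦ -μ_P(0, x) ⊗ 1 + 1 ⊗ μ_P'(x, 0)` for `x : g₂`. -/
def glueMomentum :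
    (jets g₂).carrier →ₗ[ℂ] (P.alg.op.tensor P'.alg).carrier :=
  Finsupp.lsum ℂ fun k : ℕ =>
    ((P.alg.op.tensor P'.alg).T ^ k : Module.End ℂ (P.alg.op.tensor P'.alg).carrier) ∘ₗ ((GradedTensorProduct.includeRight P.alg.op.deg P'.alg.deg).toLinearMap ∘ₗ
        P'.μ.toLinearMap ∘ₗ Finsupp.lsingle 0 ∘ₗ LinearMap.inl ℂ g₂ g₃ -
      (GradedTensorProduct.includeLeft P.alg.op.deg P'.alg.deg).toLinearMap ∘ₗ
        P.μ.toLinearMap ∘ₗ Finsupp.lsingle 0 ∘ₗ LinearMap.inr ℂ g₁ g₂)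

/-- The coisson gluing of `P` and `P'`. -/
def gluing [FiniteDimensional ℂ g₂] : PreVertexPoisson.{max u₂ v w} :=
  coBRST g₂ (P.alg.op.tensor P'.alg) (glueMomentum P P')

/-- The induced momentum map `x ↦ -μ_P(0, x) ⊗ 1 + 1 ⊗ μ_P'(x, 0)` of `g₂` on the tensor product
of the associated dg Poisson algebras. -/
def assocMomentum :
    g₂ →ₗ[ℂ] ((assocPoisson P.alg).op.tensor (assocPoisson P'.alg)).carrier :=
  (GradedTensorProduct.includeRight (assocPoisson P.alg).op.deg
      (assocPoisson P'.alg).deg).toLinearMap ∘ₗ (assocMk P'.alg).toLinearMap ∘ₗ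
      P'.μ.toLinearMap ∘ₗ Finsupp.lsingle 0 ∘ₗ LinearMap.inl ℂ g₂ g₃ -
    (GradedTensorProduct.includeLeft (assocPoisson P.alg).op.deg
      (assocPoisson P'.alg).deg).toLinearMap ∘ₗ (assocMk P.alg).toLinearMap ∘ₗ
      P.μ.toLinearMap ∘ₗ Finsupp.lsingle 0 ∘ₗ LinearMap.inr ℂ g₁ g₂

end Gluing

end CoissonGluing
end

noncomputable section

namespace CoissonGluing

/-! ### Graded commutative algebras with a skew biderivation -/

/-! Forming the associated Poisson algebra commutes with every construction that enters the gluing,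
because modulo the image of `T` all correction terms (higher products, powers of `T`) disappear.
This is organised by the relation `IsAssocQuotient P R π`: `π` is a surjection of graded algebras
that kills `T`, commutes with the differentials, sends the zeroth product to the bracket of `R`, and
has its kernel inside the ideal generated by the image of `T`. It asks for no vertex Poisson axiom
on `P`, so neither `coCl`, nor the tensor products, nor the coisson BRST complex has to be shown to
be a vertex Poisson algebra. Such a `π` forces `assocIdeal P` to equal its kernel
(`IsAssocQuotient.mem_assocIdeal_iff`), whence `assocPoisson P` is isomorphic to `R`
(`IsAssocQuotient.nonempty_iso`). The relation holds for `assocMk` when `P` is a dg vertex Poisson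
algebra, and for the evaluation `coCl g → cCl g` at `t = 0` (`cliffordProj_isAssocQuotient`). It is
stable under opposites, tensor products and the addition of `Q₍₀₎` to the differential
(`IsAssocQuotient.op`, `.tensor`, `.twist`). Since the coisson BRST charge is sent to the classical
one, these combine to `IsAssocQuotient.coBRST` and give the isomorphism.

The Poisson axioms are proved on the classical side only and then transported along the isomorphism.
Tensor products of dg Poisson algebras are dg Poisson because the Jacobi identity and the
compatibility with `d` can be tested on generators. The BRST differential is the twist of such a
tensor product by the charge `Q`, which is a dg Poisson structure once `d Q = 0` and `{Q, Q} = 0`.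
The master equation `{Q, Q} = 0` (`bracket_brstCharge_self`) combines the Jacobi identity of the Lie
algebra, which kills the bracket of the cubic term with itself, and the fact that `μ` is a Lie
morphism, which makes the remaining terms cancel. -/

theorem PreDGAlg.homogeneous_induction (A : PreDGAlg.{u}) {p : A.carrier → Prop}
    (hadd : ∀ a b, p a → p b → p (a + b)) (h : ∀ i, ∀ a ∈ A.deg i, p a) (a : A.carrier) : p a := by
  induction a using DirectSum.Decomposition.inductionOn A.deg with
  | zero => exact h 0 0 (zero_mem _)
  | homogeneous a => exact h _ _ a.2
  | add a b ha hb => exact hadd a b ha hb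

/-- Most comparisons of Koszul signs below are settled by splitting each elementary sign into its
two values. -/
theorem negOnePow_cases (i : ℤ) : i.negOnePow = 1 ∨ i.negOnePow = -1 :=
  Int.units_eq_one_or _

/-- The bracket of `R` is a graded skew-symmetric biderivation of degree `0` of a graded
commutative algebra. -/
structure PrePoisson.IsSkewBiderivation (R : PrePoisson.{u}) : Prop where
  mul_comm : ∀ i j, ∀ a ∈ R.deg i, ∀ b ∈ R.deg j, a * b = (i * j).negOnePow • (b * a)
  bracket_mem : ∀ i j, ∀ a ∈ R.deg i, ∀ b ∈ R.deg j, R.bracket a b ∈ R.deg (i + j)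
  skew : ∀ i j, ∀ a ∈ R.deg i, ∀ b ∈ R.deg j,
    R.bracket a b = (1 + i * j).negOnePow • R.bracket b a
  bracket_mul : ∀ i j, ∀ a ∈ R.deg i, ∀ b ∈ R.deg j, ∀ c,
    R.bracket a (b * c) = R.bracket a b * c + (i * j).negOnePow • (b * R.bracket a c)

section

variable {R : PrePoisson.{u}}

/-- Moving `{a, c}` past `b` costs `(-1)^((i + k) j)`, so the sign of the Leibniz rule becomes
`(-1)^(i j)`. The degree of `c` has dropped out, which lets `c` be inhomogeneous. -/
theorem PrePoisson.IsDGPoisson.isSkewBiderivation (h : R.IsDGPoisson) :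
    R.IsSkewBiderivation where
  mul_comm := h.mul_comm
  bracket_mem := h.bracket_mem
  skew := h.skew
  bracket_mul i j a ha b hb c := by
    induction c using R.homogeneous_induction with
    | hadd x y hx hy => simp only [mul_add, map_add, hx, hy, smul_add]; abel
    | h k c hc =>
      rw [h.leibniz i j k a ha b hb c hc,
        h.mul_comm _ _ _ (h.bracket_mem _ _ _ ha _ hc) _ hb, smul_smul, add_mul, Int.negOnePow_add,
        _root_.mul_comm j k, mul_left_comm, Int.units_mul_self, mul_one]

theorem PrePoisson.IsSkewBiderivation.leibniz (h : R.IsSkewBiderivation) {i j k : ℤ}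
    {a b c : R.carrier} (ha : a ∈ R.deg i) (hb : b ∈ R.deg j) (hc : c ∈ R.deg k) :
    R.bracket a (b * c) = R.bracket a b * c + (j * k).negOnePow • (R.bracket a c * b) := by
  rw [h.bracket_mul i j a ha b hb c, h.mul_comm _ _ _ (h.bracket_mem _ _ _ ha _ hc) _ hb,
    smul_smul, add_mul, Int.negOnePow_add, _root_.mul_comm j k, mul_left_comm, Int.units_mul_self,
    mul_one]

/-- Skew-symmetry applied to `{z, x}` and to `{z, {x, y}}` accounts for the whole difference. The
derivation form propagates along products in `z`, while the cyclic form can be rotated; both are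
needed. -/
theorem PrePoisson.IsSkewBiderivation.cyclic_eq (h : R.IsSkewBiderivation) {i j k : ℤ}
    {x y z : R.carrier} (hx : x ∈ R.deg i) (hy : y ∈ R.deg j) (hz : z ∈ R.deg k) :
    (k * i).negOnePow • R.bracket x (R.bracket y z)
      + (i * j).negOnePow • R.bracket y (R.bracket z x)
      + (j * k).negOnePow • R.bracket z (R.bracket x y) =
    (k * i).negOnePow • (R.bracket x (R.bracket y z) - R.bracket (R.bracket x y) z -
      (i * j).negOnePow • R.bracket y (R.bracket x z)) := by
  rw [h.skew k i z hz x hx, h.skew k (i + j) z hz _ (h.bracket_mem _ _ _ hx _ hy), mul_add,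
    Int.negOnePow_add, Int.negOnePow_add, Int.negOnePow_add, _root_.mul_comm j k]
  rcases negOnePow_cases (k * i) with h1 | h1 <;> rcases negOnePow_cases (i * j) with h2 | h2 <;>
    rcases negOnePow_cases (k * j) with h3 | h3 <;>
    simp [h1, h2, h3, Units.smul_def] <;> abel

theorem PrePoisson.IsSkewBiderivation.cyclic_eq_zero_iff (h : R.IsSkewBiderivation) {i j k : ℤ}
    {x y z : R.carrier} (hx : x ∈ R.deg i) (hy : y ∈ R.deg j) (hz : z ∈ R.deg k) :
    (k * i).negOnePow • R.bracket x (R.bracket y z)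
      + (i * j).negOnePow • R.bracket y (R.bracket z x)
      + (j * k).negOnePow • R.bracket z (R.bracket x y) = 0 ↔
    R.bracket x (R.bracket y z) = R.bracket (R.bracket x y) z +
      (i * j).negOnePow • R.bracket y (R.bracket x z) := by
  rw [h.cyclic_eq hx hy hz, smul_eq_zero_iff_eq, sub_sub, sub_eq_zero]

theorem PrePoisson.IsDGPoisson.bracket_bracket (h : R.IsDGPoisson) {i j : ℤ}
    {x y : R.carrier} (hx : x ∈ R.deg i) (hy : y ∈ R.deg j) (z : R.carrier) :
    R.bracket x (R.bracket y z) = R.bracket (R.bracket x y) z +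
      (i * j).negOnePow • R.bracket y (R.bracket x z) := by
  induction z using R.homogeneous_induction with
  | hadd z w hz hw => simp only [map_add, hz, hw, smul_add]; abel
  | h k z hz =>
    exact (h.isSkewBiderivation.cyclic_eq_zero_iff hx hy hz).1
      (h.jacobi i j k x hx y hy z hz)

theorem PrePoisson.IsSkewBiderivation.bracket_one (h : R.IsSkewBiderivation) (a : R.carrier) :
    R.bracket a 1 = 0 := by
  induction a using R.homogeneous_induction with
  | hadd a b ha hb => simp [ha, hb]
  | h i a ha =>
    have := h.bracket_mul i 0 a ha 1 SetLike.GradedOne.one_mem 1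
    simpa using this

theorem PrePoisson.IsSkewBiderivation.one_bracket (h : R.IsSkewBiderivation) (a : R.carrier) :
    R.bracket 1 a = 0 := by
  induction a using R.homogeneous_induction with
  | hadd a b ha hb => simp [ha, hb]
  | h i a ha =>
    rw [h.skew 0 i 1 SetLike.GradedOne.one_mem a ha, h.bracket_one, smul_zero]

theorem PreDGAlg.IsCDGA.d_one {A : PreDGAlg.{u}} (h : A.IsCDGA) : A.d 1 = 0 := by
  have := h.d_mul 0 1 SetLike.GradedOne.one_mem 1
  simpa using this

/-- The defect of the Jacobi identity is a derivation in `z`. The `z` for which it vanishes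
therefore form a subspace that contains `1` and is stable under multiplication by the generators. -/
theorem PrePoisson.IsSkewBiderivation.jacobi_extend (h : R.IsSkewBiderivation)
    {S : ℤ → Set R.carrier}
    (hS : ∀ i, ∀ s ∈ S i, s ∈ R.deg i)
    (hgen : ∀ N : Submodule ℂ R.carrier, 1 ∈ N → (∀ i, ∀ s ∈ S i, ∀ n ∈ N, s * n ∈ N) → N = ⊤)
    {i j : ℤ} {x y : R.carrier} (hx : x ∈ R.deg i) (hy : y ∈ R.deg j)
    (hz : ∀ k, ∀ z ∈ S k, R.bracket x (R.bracket y z) = R.bracket (R.bracket x y) z +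
      (i * j).negOnePow • R.bracket y (R.bracket x z)) (z : R.carrier) :
    R.bracket x (R.bracket y z) = R.bracket (R.bracket x y) z +
      (i * j).negOnePow • R.bracket y (R.bracket x z) := by
  let N : Submodule ℂ R.carrier := LinearMap.eqLocus (R.bracket x ∘ₗ R.bracket y)
    (R.bracket (R.bracket x y) + (i * j).negOnePow • (R.bracket y ∘ₗ R.bracket x))
  have hN : N = ⊤ := by
    refine hgen N ?_ fun k s hs n hn => ?_
    · simp [N, h.bracket_one]
    · have hk := hS k s hs
      have h1 := hz k s hs
      have h2 : R.bracket x (R.bracket y n) = R.bracket (R.bracket x y) n +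
        (i * j).negOnePow • R.bracket y (R.bracket x n) := hn
      change R.bracket x (R.bracket y (s * n)) = R.bracket (R.bracket x y) (s * n) +
        (i * j).negOnePow • R.bracket y (R.bracket x (s * n))
      rw [h.bracket_mul _ _ _ hy _ hk, h.bracket_mul _ _ _ hx _ hk,
        h.bracket_mul _ _ _ (h.bracket_mem _ _ _ hx _ hy) _ hk, map_add, map_add,
        LinearMap.map_smul_of_tower, LinearMap.map_smul_of_tower,
        h.bracket_mul _ _ _ hx _ (h.bracket_mem _ _ _ hy _ hk), h.bracket_mul _ _ _ hx _ hk,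
        h.bracket_mul _ _ _ hy _ (h.bracket_mem _ _ _ hx _ hk), h.bracket_mul _ _ _ hy _ hk,
        h1, h2]
      simp only [mul_add, add_mul, Int.negOnePow_add, _root_.mul_comm j i]
      rcases negOnePow_cases (i * j) with e1 | e1 <;> rcases negOnePow_cases (i * k) with e2 | e2 <;>
        rcases negOnePow_cases (j * k) with e3 | e3 <;>
        simp [e1, e2, e3] <;> abel
  have : z ∈ N := hN ▸ Submodule.mem_top
  exact this

/-- The Jacobi identity for a skew biderivation may be checked on homogeneous generators. -/
theorem PrePoisson.IsSkewBiderivation.jacobi_of_generators (h : R.IsSkewBiderivation)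
    {S : ℤ → Set R.carrier} (hS : ∀ i, ∀ s ∈ S i, s ∈ R.deg i)
    (hgen : ∀ N : Submodule ℂ R.carrier, 1 ∈ N → (∀ i, ∀ s ∈ S i, ∀ n ∈ N, s * n ∈ N) → N = ⊤)
    (hjac : ∀ i j k, ∀ x ∈ S i, ∀ y ∈ S j, ∀ z ∈ S k,
      R.bracket x (R.bracket y z) = R.bracket (R.bracket x y) z +
        (i * j).negOnePow • R.bracket y (R.bracket x z))
    {i j k : ℤ} {x y z : R.carrier} (hx : x ∈ R.deg i) (hy : y ∈ R.deg j) (hz : z ∈ R.deg k) :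
    (k * i).negOnePow • R.bracket x (R.bracket y z)
      + (i * j).negOnePow • R.bracket y (R.bracket z x)
      + (j * k).negOnePow • R.bracket z (R.bracket x y) = 0 := by
  -- The extension lemma only frees the last argument. Rotating the identity brings each argument
  -- into that place in turn, so three extensions free all of them.
  have cyc : ∀ {i j k : ℤ} {x y z : R.carrier}, x ∈ R.deg i → y ∈ R.deg j → z ∈ R.deg k →
      R.bracket x (R.bracket y z) = R.bracket (R.bracket x y) z +
        (i * j).negOnePow • R.bracket y (R.bracket x z) →
      R.bracket y (R.bracket z x) = R.bracket (R.bracket y z) x +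
        (j * k).negOnePow • R.bracket z (R.bracket y x) := by
    intro i j k x y z hx hy hz e
    rw [← h.cyclic_eq_zero_iff hx hy hz] at e
    rw [← h.cyclic_eq_zero_iff hy hz hx, ← e]
    abel
  have s1 : ∀ {i j : ℤ} {x y : R.carrier}, x ∈ S i → y ∈ S j → ∀ z,
      R.bracket x (R.bracket y z) = R.bracket (R.bracket x y) z +
        (i * j).negOnePow • R.bracket y (R.bracket x z) :=
    fun hx hy z => h.jacobi_extend hS hgen (hS _ _ hx) (hS _ _ hy)
      (fun k z hz => hjac _ _ k _ hx _ hy z hz) z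
  have s2 : ∀ {i j : ℤ} {x y : R.carrier}, x ∈ S i → y ∈ R.deg j → ∀ z,
      R.bracket x (R.bracket y z) = R.bracket (R.bracket x y) z +
        (i * j).negOnePow • R.bracket y (R.bracket x z) :=
    fun hx hy z => h.jacobi_extend hS hgen (hS _ _ hx) hy (fun k s hs =>
      cyc (hS k s hs) (hS _ _ hx) hy (s1 hs hx _)) z
  rw [h.cyclic_eq_zero_iff hx hy hz]
  exact h.jacobi_extend hS hgen hx hy (fun k s hs => cyc (hS k s hs) hx hy (s2 hs hx _)) z

/-- The extension from generators acts on the second argument only; exchanging the arguments lets it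
be applied to both. -/
theorem PrePoisson.IsSkewBiderivation.d_bracket_swap (h : R.IsSkewBiderivation)
    (hd : ∀ i, ∀ a ∈ R.deg i, R.d a ∈ R.deg (i + 1)) {i j : ℤ} {x y : R.carrier}
    (hx : x ∈ R.deg i) (hy : y ∈ R.deg j)
    (e : R.d (R.bracket x y) = R.bracket (R.d x) y + i.negOnePow • R.bracket x (R.d y)) :
    R.d (R.bracket y x) = R.bracket (R.d y) x + j.negOnePow • R.bracket y (R.d x) := by
  rw [h.skew _ _ _ hy _ hx, LinearMap.map_smul_of_tower, e, h.skew _ _ _ (hd _ _ hy) _ hx,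
    h.skew _ _ _ hy _ (hd _ _ hx), add_mul, mul_add, one_mul, mul_one]
  simp only [Int.negOnePow_add, _root_.mul_comm j i]
  rcases negOnePow_cases (i * j) with e1 | e1 <;> rcases negOnePow_cases i with e2 | e2 <;>
    rcases negOnePow_cases j with e3 | e3 <;> simp [e1, e2, e3] <;> abel

theorem PrePoisson.IsSkewBiderivation.d_bracket_extend (h : R.IsSkewBiderivation) (hR : R.IsCDGA)
    {S : ℤ → Set R.carrier} (hS : ∀ i, ∀ s ∈ S i, s ∈ R.deg i)
    (hgen : ∀ N : Submodule ℂ R.carrier, 1 ∈ N → (∀ i, ∀ s ∈ S i, ∀ n ∈ N, s * n ∈ N) → N = ⊤)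
    {i : ℤ} {x : R.carrier} (hx : x ∈ R.deg i)
    (hy : ∀ k, ∀ y ∈ S k, R.d (R.bracket x y) = R.bracket (R.d x) y + i.negOnePow • R.bracket x (R.d y))
    (y : R.carrier) :
    R.d (R.bracket x y) = R.bracket (R.d x) y + i.negOnePow • R.bracket x (R.d y) := by
  let N : Submodule ℂ R.carrier := LinearMap.eqLocus (R.d ∘ₗ R.bracket x)
    (R.bracket (R.d x) + i.negOnePow • (R.bracket x ∘ₗ R.d))
  have hN : N = ⊤ := by
    refine hgen N ?_ fun k s hs n hn => ?_
    · simp [N, h.bracket_one, hR.d_one]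
    · have hk := hS k s hs
      have h1 := hy k s hs
      have h2 : R.d (R.bracket x n) = R.bracket (R.d x) n +
        i.negOnePow • R.bracket x (R.d n) := hn
      change R.d (R.bracket x (s * n)) = R.bracket (R.d x) (s * n) +
        i.negOnePow • R.bracket x (R.d (s * n))
      rw [h.bracket_mul _ _ _ hx _ hk, hR.d_mul _ _ hk,
        h.bracket_mul _ _ _ (hR.d_mem _ _ hx) _ hk, map_add, map_add,
        LinearMap.map_smul_of_tower, LinearMap.map_smul_of_tower,
        hR.d_mul _ _ (h.bracket_mem _ _ _ hx _ hk), hR.d_mul _ _ hk,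
        h.bracket_mul _ _ _ hx _ (hR.d_mem _ _ hk), h.bracket_mul _ _ _ hx _ hk,
        h1, h2]
      simp only [mul_add, add_mul, one_mul, mul_one, Int.negOnePow_add]
      rcases negOnePow_cases i with e1 | e1 <;> rcases negOnePow_cases k with e2 | e2 <;>
        rcases negOnePow_cases (i * k) with e3 | e3 <;>
        simp [e1, e2, e3] <;> abel
  have : y ∈ N := hN ▸ Submodule.mem_top
  exact this

/-- The compatibility of the differential with a skew biderivation may be checked on homogeneous
generators. -/
theorem PrePoisson.IsSkewBiderivation.d_bracket_of_generators (h : R.IsSkewBiderivation)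
    (hR : R.IsCDGA) {S : ℤ → Set R.carrier} (hS : ∀ i, ∀ s ∈ S i, s ∈ R.deg i)
    (hgen : ∀ N : Submodule ℂ R.carrier, 1 ∈ N → (∀ i, ∀ s ∈ S i, ∀ n ∈ N, s * n ∈ N) → N = ⊤)
    (hd : ∀ i j, ∀ x ∈ S i, ∀ y ∈ S j,
      R.d (R.bracket x y) = R.bracket (R.d x) y + i.negOnePow • R.bracket x (R.d y))
    {i : ℤ} {x : R.carrier} (hx : x ∈ R.deg i) (y : R.carrier) :
    R.d (R.bracket x y) = R.bracket (R.d x) y + i.negOnePow • R.bracket x (R.d y) := by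
  exact h.d_bracket_extend hR hS hgen hx (fun k s hs => h.d_bracket_swap hR.d_mem (hS k s hs) hx
    (h.d_bracket_extend hR hS hgen (hS k s hs) (fun j => hd k j _ hs) _)) y

/-! ### Twisting the differential -/

/-- A Maurer–Cartan element `Q` twists the differential of a dg Poisson algebra. -/
theorem PrePoisson.IsDGPoisson.twist (h : R.IsDGPoisson) {Q : R.carrier} (hQ : Q ∈ R.deg 1)
    (hdQ : R.d Q = 0) (hQQ : R.bracket Q Q = 0) :
    PrePoisson.IsDGPoisson { R with d := R.d + R.bracket Q } where
  mul_comm := h.mul_comm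
  d_mem i a ha := add_mem (h.d_mem i a ha) (by
    have := h.bracket_mem _ _ _ hQ _ ha
    rwa [add_comm] at this)
  d_d a := by
    change R.d (R.d a + R.bracket Q a) + R.bracket Q (R.d a + R.bracket Q a) = 0
    have e1 := h.d_bracket 1 Q hQ a
    have e2 := h.bracket_bracket hQ hQ a
    rw [hdQ] at e1
    rw [hQQ] at e2
    simp only [map_zero, LinearMap.zero_apply, zero_add, Int.negOnePow_one, mul_one,
      Units.neg_smul, one_smul] at e1 e2
    -- For odd `Q` with `{Q, Q} = 0` the Jacobi identity says that `{Q, {Q, a}}` is its own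
    -- negative.
    have e3 : R.bracket Q (R.bracket Q a) = 0 := by
      have : (2 : ℂ) • R.bracket Q (R.bracket Q a) = 0 := by
        rw [two_smul]
        exact add_eq_zero_iff_eq_neg.2 e2
      exact (smul_eq_zero.1 this).resolve_left two_ne_zero
    rw [map_add, map_add, h.d_d, e1, e3]
    abel
  d_mul i a ha b := by
    change R.d (a * b) + R.bracket Q (a * b) = (R.d a + R.bracket Q a) * b +
      i.negOnePow • (a * (R.d b + R.bracket Q b))
    rw [h.d_mul i a ha, h.isSkewBiderivation.bracket_mul _ _ _ hQ _ ha, one_mul]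
    simp only [add_mul, mul_add, smul_add]
    abel
  bracket_mem := h.bracket_mem
  skew := h.skew
  jacobi := h.jacobi
  d_bracket i a ha b := by
    change R.d (R.bracket a b) + R.bracket Q (R.bracket a b) =
      R.bracket (R.d a + R.bracket Q a) b + i.negOnePow • (R.bracket a (R.d b + R.bracket Q b))
    rw [h.d_bracket i a ha, h.bracket_bracket hQ ha, one_mul]
    simp only [map_add, LinearMap.add_apply, smul_add]
    abel
  leibniz := h.leibniz

/-! ### Opposites and transport of structure -/

/-- Each term of the Jacobi identity contains two brackets, so the signs cancel there; the other
axioms are linear in the bracket. -/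
theorem PrePoisson.IsDGPoisson.op (h : R.IsDGPoisson) : R.op.IsDGPoisson where
  mul_comm := h.mul_comm
  d_mem := h.d_mem
  d_d := h.d_d
  d_mul := h.d_mul
  bracket_mem i j a ha b hb := neg_mem (h.bracket_mem i j a ha b hb)
  skew i j := fun (a : R.carrier) ha (b : R.carrier) hb => by
    have e : -R.bracket a b = (1 + i * j).negOnePow • -R.bracket b a := by
      rw [h.skew i j a ha b hb, smul_neg]
    exact e
  jacobi i j k := fun (x : R.carrier) hx (y : R.carrier) hy (z : R.carrier) hz => by
    have e : (k * i).negOnePow • -R.bracket x (-R.bracket y z)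
        + (i * j).negOnePow • -R.bracket y (-R.bracket z x)
        + (j * k).negOnePow • -R.bracket z (-R.bracket x y) = 0 := by
      simpa using h.jacobi i j k x hx y hy z hz
    exact e
  d_bracket i := fun (a : R.carrier) ha (b : R.carrier) => by
    have e : R.d (-R.bracket a b) = -R.bracket (R.d a) b + i.negOnePow • -R.bracket a (R.d b) := by
      rw [map_neg, h.d_bracket i a ha, smul_neg]
      abel
    exact e
  leibniz i j k := fun (a : R.carrier) ha (b : R.carrier) hb (c : R.carrier) hc => by
    have e : -R.bracket a (b * c) =
        -R.bracket a b * c + (j * k).negOnePow • (-R.bracket a c * b) := by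
      rw [h.leibniz i j k a ha b hb c hc, neg_mul, neg_mul, smul_neg]
      abel
    exact e

end

/-- No axiom is assumed on `R`: each one is pulled back from `S` through injectivity, or through
`map_deg` for the conditions on degrees. -/
theorem PrePoisson.Iso.isDGPoisson {R : PrePoisson.{u}} {S : PrePoisson.{v}} (e : R.Iso S)
    (h : S.IsDGPoisson) : R.IsDGPoisson := by
  have inj := e.toAlgEquiv.injective
  have md : ∀ i, ∀ a ∈ R.deg i, e.toAlgEquiv a ∈ S.deg i := fun i a ha => (e.map_deg i a).2 ha
  have sm : ∀ (c : ℤˣ) a, e.toAlgEquiv (c • a) = c • e.toAlgEquiv a := fun c a => by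
    rw [Units.smul_def, map_zsmul, Units.smul_def]
  exact {
    mul_comm := fun i j a ha b hb => inj (by
      rw [sm, map_mul, map_mul, h.mul_comm i j _ (md _ _ ha) _ (md _ _ hb)])
    d_mem := fun i a ha => by
      rw [← e.map_deg, e.map_d]
      exact h.d_mem i _ (md _ _ ha)
    d_d := fun a => inj (by rw [e.map_d, e.map_d, h.d_d, map_zero])
    d_mul := fun i a ha b => inj (by
      rw [e.map_d, map_mul, h.d_mul i _ (md _ _ ha), map_add, map_mul, sm, map_mul, e.map_d,
        e.map_d])
    bracket_mem := fun i j a ha b hb => by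
      rw [← e.map_deg, e.map_bracket]
      exact h.bracket_mem i j _ (md _ _ ha) _ (md _ _ hb)
    skew := fun i j a ha b hb => inj (by
      rw [sm, e.map_bracket, e.map_bracket, h.skew i j _ (md _ _ ha) _ (md _ _ hb)])
    jacobi := fun i j k x hx y hy z hz => inj (by
      simp only [map_add, sm, e.map_bracket, map_zero]
      exact h.jacobi i j k _ (md _ _ hx) _ (md _ _ hy) _ (md _ _ hz))
    d_bracket := fun i a ha b => inj (by
      simp only [map_add, sm, e.map_bracket, e.map_d]
      exact h.d_bracket i _ (md _ _ ha) _)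
    leibniz := fun i j k a ha b hb c hc => inj (by
      simp only [map_add, map_mul, sm, e.map_bracket]
      exact h.leibniz i j k _ (md _ _ ha) _ (md _ _ hb) _ (md _ _ hc)) }

/-! ### Tensor products of dg algebras -/

section

variable {A : PreDGAlg.{u}} {B : PreDGAlg.{v}}

variable (A B) in
/-- The element `a ⊗ b` of the tensor product of dg algebras. -/
def PreDGAlg.tmul : A.carrier →ₗ[ℂ] B.carrier →ₗ[ℂ] (A.tensor B).carrier :=
  (TensorProduct.mk ℂ A.carrier B.carrier).compr₂
    (GradedTensorProduct.of ℂ A.deg B.deg).toLinearMap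

theorem PreDGAlg.tmul_mem {i j n : ℤ} (h : i + j = n) {a : A.carrier} {b : B.carrier}
    (ha : a ∈ A.deg i) (hb : b ∈ B.deg j) : A.tmul B a b ∈ (A.tensor B).deg n :=
  tmul_mem_tensorDeg A.deg B.deg h ha hb

theorem PreDGAlg.tmul_mul_tmul {i j : ℤ} (a : A.carrier) {b : B.carrier} (hb : b ∈ B.deg i)
    {a' : A.carrier} (ha' : a' ∈ A.deg j) (b' : B.carrier) :
    A.tmul B a b * A.tmul B a' b' = (i * j).negOnePow • A.tmul B (a * a') (b * b') :=
  GradedTensorProduct.tmul_coe_mul_coe_tmul (R := ℂ) A.deg B.deg a ⟨b, hb⟩ ⟨a', ha'⟩ b'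

/-- The unit has degree `0`, so no Koszul sign appears and no homogeneity is required. -/
theorem PreDGAlg.tmul_one_mul (a a' : A.carrier) (b : B.carrier) :
    A.tmul B a 1 * A.tmul B a' b = A.tmul B (a * a') b := by
  induction a' using A.homogeneous_induction with
  | hadd x y hx hy => simp only [map_add, LinearMap.add_apply, mul_add, hx, hy]
  | h i x hx => rw [PreDGAlg.tmul_mul_tmul a SetLike.GradedOne.one_mem hx]; simp

theorem PreDGAlg.mul_one_tmul (a : A.carrier) (b b' : B.carrier) :
    A.tmul B a b * A.tmul B 1 b' = A.tmul B a (b * b') := by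
  induction b using B.homogeneous_induction with
  | hadd x y hx hy => simp only [map_add, add_mul, hx, hy]
  | h i x hx => rw [PreDGAlg.tmul_mul_tmul a hx SetLike.GradedOne.one_mem]; simp

theorem PreDGAlg.tensor_d_tmul {i : ℤ} {a : A.carrier} (ha : a ∈ A.deg i) (b : B.carrier) :
    (A.tensor B).d (A.tmul B a b) = A.tmul B (A.d a) b + i.negOnePow • A.tmul B a (B.d b) := by
  have h : (A.tensor B).d (A.tmul B a b) =
      A.tmul B (A.d a) b + A.tmul B (parity A.deg a) (B.d b) := rfl
  rw [h, parity, degScale_of_mem A.deg _ ha, map_smul, LinearMap.smul_apply,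
    Int.cast_smul_eq_zsmul, Units.smul_def]

theorem PreDGAlg.tensor_induction {p : (A.tensor B).carrier → Prop}
    (hadd : ∀ x y, p x → p y → p (x + y)) (h : ∀ a b, p (A.tmul B a b)) (x) : p x := by
  have key : ∀ y : A.carrier ⊗[ℂ] B.carrier, p (GradedTensorProduct.of ℂ A.deg B.deg y) := by
    intro y
    induction y with
    | zero =>
      have := h 0 0
      rw [map_zero] at this
      rw [map_zero]
      exact this
    | add x y hx hy =>
      rw [map_add]
      exact hadd _ _ hx hy
    | tmul a b => exact h a b
  exact key x

theorem PreDGAlg.tensor_deg_induction {n : ℤ} {p : ∀ x, x ∈ (A.tensor B).deg n → Prop}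
    (hadd : ∀ x y hx hy, p x hx → p y hy → p (x + y) (add_mem hx hy))
    (h : ∀ i j, ∀ hij : i + j = n, ∀ a, ∀ ha : a ∈ A.deg i, ∀ b, ∀ hb : b ∈ B.deg j,
      p (A.tmul B a b) (PreDGAlg.tmul_mem hij ha hb))
    {x} (hx : x ∈ (A.tensor B).deg n) : p x hx := by
  -- Carrying a scalar `c` through the induction lets it be absorbed in the first tensor factor, so
  -- the motive need not be closed under scalar multiplication.
  have key : ∀ x ∈ tensorDeg A.deg B.deg n, ∀ c : ℂ,
      ∃ hx : (c • x : A.deg ᵍ⊗[ℂ] B.deg) ∈ tensorDeg A.deg B.deg n, p (c • x) hx := by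
    intro x hx
    induction hx using Submodule.span_induction with
    | mem x hx =>
      obtain ⟨i, j, hij, a, ha, b, hb, rfl⟩ := hx
      intro c
      have := h i j hij (c • a) (Submodule.smul_mem _ _ ha) b hb
      simp only [map_smul, LinearMap.smul_apply] at this
      exact ⟨_, this⟩
    | zero =>
      intro c
      have := h n 0 (add_zero n) 0 (zero_mem _) 0 (zero_mem _)
      simp only [map_zero] at this
      rw [smul_zero]
      exact ⟨_, this⟩
    | add x y _ _ hx hy =>
      intro c
      obtain ⟨hx, hx'⟩ := hx c
      obtain ⟨hy, hy'⟩ := hy c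
      rw [smul_add]
      exact ⟨_, hadd _ _ _ _ hx' hy'⟩
    | smul c' x _ hx =>
      intro c
      rw [smul_smul]
      exact hx _
  have key' : ∀ (z : A.deg ᵍ⊗[ℂ] B.deg) (c : ℂ), ∀ x ∈ tensorDeg A.deg B.deg n, z = c • x →
      ∃ hz : z ∈ tensorDeg A.deg B.deg n, p z hz := by
    rintro z c x hx rfl
    exact key x hx c
  exact (key' x 1 x hx (one_smul ℂ _).symm).2

variable (A B) in
/-- The elements `a ⊗ 1` and `1 ⊗ b` of degree `n`, which generate the tensor product. -/
def PreDGAlg.tensorGenerators (n : ℤ) : Set (A.tensor B).carrier :=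
  (fun a => A.tmul B a 1) '' A.deg n ∪ A.tmul B 1 '' B.deg n

theorem PreDGAlg.tensorGenerators_subset (n : ℤ) (x) (hx : x ∈ A.tensorGenerators B n) :
    x ∈ (A.tensor B).deg n := by
  obtain ⟨a, ha, rfl⟩ | ⟨b, hb, rfl⟩ := hx
  · exact PreDGAlg.tmul_mem (add_zero n) ha SetLike.GradedOne.one_mem
  · exact PreDGAlg.tmul_mem (zero_add n) SetLike.GradedOne.one_mem hb

/-- Homogeneous pure tensors span, and `a ⊗ b = (a ⊗ 1) (1 ⊗ b)` without sign. -/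
theorem PreDGAlg.tensorGenerators_span (N : Submodule ℂ (A.tensor B).carrier) (h1 : 1 ∈ N)
    (h : ∀ i, ∀ s ∈ A.tensorGenerators B i, ∀ n ∈ N, s * n ∈ N) : N = ⊤ := by
  rw [eq_top_iff]
  rintro x -
  induction x using PreDGAlg.tensor_induction with
  | hadd x y hx hy => exact add_mem hx hy
  | h a b =>
    induction a using A.homogeneous_induction with
    | hadd x y hx hy => rw [map_add, LinearMap.add_apply]; exact add_mem hx hy
    | h i a ha =>
      induction b using B.homogeneous_induction with
      | hadd x y hx hy => rw [map_add]; exact add_mem hx hy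
      | h j b hb =>
        have e : A.tmul B a b = A.tmul B a 1 * (A.tmul B 1 b * 1) := by
          rw [_root_.mul_one, PreDGAlg.tmul_one_mul, _root_.mul_one]
        rw [e]
        exact h _ _ (Or.inl ⟨a, ha, rfl⟩) _ (h _ _ (Or.inr ⟨b, hb, rfl⟩) _ h1)

theorem PreDGAlg.IsCDGA.tensor (hA : A.IsCDGA) (hB : B.IsCDGA) : (A.tensor B).IsCDGA where
  mul_comm m n x hx y hy := by
    induction hx using PreDGAlg.tensor_deg_induction with
    | hadd x x' _ _ hx hx' => rw [add_mul, mul_add, hx, hx', smul_add]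
    | h i j hij a ha b hb =>
      induction hy using PreDGAlg.tensor_deg_induction with
      | hadd x x' _ _ hx hx' => rw [add_mul, mul_add, hx, hx', smul_add]
      | h k l hkl a' ha' b' hb' =>
        rw [PreDGAlg.tmul_mul_tmul a hb ha', PreDGAlg.tmul_mul_tmul a' hb' ha,
          hA.mul_comm _ _ _ ha _ ha', hB.mul_comm _ _ _ hb _ hb', ← hij, ← hkl]
        simp only [mul_add, add_mul, Int.negOnePow_add, LinearMap.map_smul_of_tower,
          LinearMap.smul_apply, smul_smul, _root_.mul_comm l i]
        rcases negOnePow_cases (i * k) with e1 | e1 <;>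
          rcases negOnePow_cases (j * k) with e2 | e2 <;>
          rcases negOnePow_cases (i * l) with e3 | e3 <;>
          rcases negOnePow_cases (j * l) with e4 | e4 <;> simp [e1, e2, e3, e4, Units.smul_def]
  d_mem n x hx := by
    induction hx using PreDGAlg.tensor_deg_induction with
    | hadd x x' _ _ hx hx' => rw [map_add]; exact add_mem hx hx'
    | h i j hij a ha b hb =>
      rw [PreDGAlg.tensor_d_tmul ha, Units.smul_def]
      exact add_mem (PreDGAlg.tmul_mem (by omega) (hA.d_mem _ _ ha) hb)
        (zsmul_mem (PreDGAlg.tmul_mem (by omega) ha (hB.d_mem _ _ hb)) _)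
  d_d x := by
    induction x using PreDGAlg.tensor_induction with
    | hadd x y hx hy => simp only [map_add, hx, hy, add_zero]
    | h a b =>
      induction a using A.homogeneous_induction with
      | hadd x y hx hy => simp only [map_add, LinearMap.add_apply, hx, hy, add_zero]
      | h i a ha =>
        rw [PreDGAlg.tensor_d_tmul ha, map_add, PreDGAlg.tensor_d_tmul (hA.d_mem _ _ ha),
          LinearMap.map_smul_of_tower, PreDGAlg.tensor_d_tmul ha, hA.d_d, hB.d_d,
          Int.negOnePow_succ]
        simp
  d_mul n x hx y := by
    induction hx using PreDGAlg.tensor_deg_induction with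
    | hadd x x' _ _ hx hx' => simp only [add_mul, map_add, hx, hx', smul_add]; abel
    | h i j hij a ha b hb =>
      induction y using PreDGAlg.tensor_induction with
      | hadd x x' hx hx' => simp only [mul_add, map_add, hx, hx', smul_add]; abel
      | h a' b' =>
        induction a' using A.homogeneous_induction with
        | hadd x y hx hy =>
          simp only [map_add, LinearMap.add_apply, mul_add, hx, hy, smul_add]; abel
        | h k a' ha' =>
          rw [PreDGAlg.tmul_mul_tmul a hb ha', LinearMap.map_smul_of_tower,
            PreDGAlg.tensor_d_tmul (SetLike.GradedMul.mul_mem ha ha'),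
            PreDGAlg.tensor_d_tmul ha, PreDGAlg.tensor_d_tmul ha', hA.d_mul _ _ ha,
            hB.d_mul _ _ hb, add_mul, mul_add, smul_mul_assoc, mul_smul_comm,
            PreDGAlg.tmul_mul_tmul _ hb ha', PreDGAlg.tmul_mul_tmul _ hb (hA.d_mem _ _ ha'),
            PreDGAlg.tmul_mul_tmul _ (hB.d_mem _ _ hb) ha', PreDGAlg.tmul_mul_tmul _ hb ha', ← hij]
          simp only [mul_add, add_mul, Int.negOnePow_add, map_add, LinearMap.add_apply,
            LinearMap.map_smul_of_tower, LinearMap.smul_apply, mul_one, one_mul]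
          rcases negOnePow_cases i with e1 | e1 <;> rcases negOnePow_cases j with e2 | e2 <;>
            rcases negOnePow_cases k with e3 | e3 <;>
            rcases negOnePow_cases (j * k) with e4 | e4 <;>
            simp [e1, e2, e3, e4] <;> abel

end

/-! ### Tensor products of dg Poisson algebras -/

section

variable {R : PrePoisson.{u}} {S : PrePoisson.{v}}

variable (R S) in
/-- The element `a ⊗ b` of the tensor product of dg Poisson algebras. -/
def PrePoisson.tmul : R.carrier →ₗ[ℂ] S.carrier →ₗ[ℂ] (R.tensor S).carrier :=
  R.toPreDGAlg.tmul S.toPreDGAlg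

theorem PrePoisson.tmul_mem {i j n : ℤ} (h : i + j = n) {a : R.carrier} {b : S.carrier}
    (ha : a ∈ R.deg i) (hb : b ∈ S.deg j) : R.tmul S a b ∈ (R.tensor S).deg n :=
  PreDGAlg.tmul_mem h ha hb

theorem PrePoisson.tmul_mul_tmul {i j : ℤ} (a : R.carrier) {b : S.carrier} (hb : b ∈ S.deg i)
    {a' : R.carrier} (ha' : a' ∈ R.deg j) (b' : S.carrier) :
    R.tmul S a b * R.tmul S a' b' = (i * j).negOnePow • R.tmul S (a * a') (b * b') :=
  PreDGAlg.tmul_mul_tmul a hb ha' b'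

theorem PrePoisson.tensor_d_tmul {i : ℤ} {a : R.carrier} (ha : a ∈ R.deg i) (b : S.carrier) :
    (R.tensor S).d (R.tmul S a b) = R.tmul S (R.d a) b + i.negOnePow • R.tmul S a (S.d b) :=
  PreDGAlg.tensor_d_tmul ha b

theorem PrePoisson.tensor_induction {p : (R.tensor S).carrier → Prop}
    (hadd : ∀ x y, p x → p y → p (x + y)) (h : ∀ a b, p (R.tmul S a b)) (x) : p x :=
  PreDGAlg.tensor_induction hadd h x

theorem PrePoisson.tensor_deg_induction {n : ℤ} {p : ∀ x, x ∈ (R.tensor S).deg n → Prop}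
    (hadd : ∀ x y hx hy, p x hx → p y hy → p (x + y) (add_mem hx hy))
    (h : ∀ i j, ∀ hij : i + j = n, ∀ a, ∀ ha : a ∈ R.deg i, ∀ b, ∀ hb : b ∈ S.deg j,
      p (R.tmul S a b) (PrePoisson.tmul_mem hij ha hb))
    {x} (hx : x ∈ (R.tensor S).deg n) : p x hx :=
  PreDGAlg.tensor_deg_induction hadd h hx

theorem PrePoisson.tensor_bracket_tmul {i j : ℤ} (a : R.carrier) {b : S.carrier}
    (hb : b ∈ S.deg i) {a' : R.carrier} (ha' : a' ∈ R.deg j) (b' : S.carrier) :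
    (R.tensor S).bracket (R.tmul S a b) (R.tmul S a' b') =
      (i * j).negOnePow • (R.tmul S (R.bracket a a') (b * b') +
        R.tmul S (a * a') (S.bracket b b')) := by
  have h : (R.tensor S).bracket (R.tmul S a b) (R.tmul S a' b') =
      (GradedTensorProduct.of ℂ R.deg S.deg).toLinearMap
        ((TensorProduct.map (TensorProduct.lift R.bracket) (LinearMap.mul' ℂ S.carrier) +
          TensorProduct.map (LinearMap.mul' ℂ R.carrier) (TensorProduct.lift S.bracket))
          (shuffle R.deg S.deg (GradedTensorProduct.tmul ℂ a b ⊗ₜ[ℂ]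
            GradedTensorProduct.tmul ℂ a' b'))) := rfl
  rw [h, shuffle_tmul R.deg S.deg a hb ha' b', LinearMap.map_smul_of_tower,
    LinearMap.map_smul_of_tower]
  rfl

/-- These identities are checked on all pure tensors, since they are what permits the reduction of
the remaining axioms to generators. -/
theorem PrePoisson.IsSkewBiderivation.tensor (hR : R.IsSkewBiderivation)
    (hS : S.IsSkewBiderivation) (hX : (R.tensor S).IsCDGA) :
    (R.tensor S).IsSkewBiderivation where
  mul_comm := hX.mul_comm
  bracket_mem m n x hx y hy := by
    induction hx using PrePoisson.tensor_deg_induction with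
    | hadd x x' _ _ hx hx' => rw [map_add, LinearMap.add_apply]; exact add_mem hx hx'
    | h i j hij a ha b hb =>
      induction hy using PrePoisson.tensor_deg_induction with
      | hadd x x' _ _ hx hx' => rw [map_add]; exact add_mem hx hx'
      | h k l hkl a' ha' b' hb' =>
        rw [PrePoisson.tensor_bracket_tmul a hb ha', Units.smul_def]
        exact zsmul_mem (add_mem
          (PrePoisson.tmul_mem (by omega) (hR.bracket_mem _ _ _ ha _ ha')
            (SetLike.GradedMul.mul_mem hb hb'))
          (PrePoisson.tmul_mem (by omega) (SetLike.GradedMul.mul_mem ha ha')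
            (hS.bracket_mem _ _ _ hb _ hb'))) _
  skew m n x hx y hy := by
    induction hx using PrePoisson.tensor_deg_induction with
    | hadd x x' _ _ hx hx' => simp only [map_add, LinearMap.add_apply, hx, hx', smul_add]
    | h i j hij a ha b hb =>
      induction hy using PrePoisson.tensor_deg_induction with
      | hadd x x' _ _ hx hx' => simp only [map_add, LinearMap.add_apply, hx, hx', smul_add]
      | h k l hkl a' ha' b' hb' =>
        rw [PrePoisson.tensor_bracket_tmul a hb ha', PrePoisson.tensor_bracket_tmul a' hb' ha,
          hR.mul_comm _ _ _ ha _ ha', hS.mul_comm _ _ _ hb _ hb', hR.skew _ _ _ ha _ ha',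
          hS.skew _ _ _ hb _ hb', ← hij, ← hkl]
        simp only [mul_add, add_mul, Int.negOnePow_add, LinearMap.map_smul_of_tower,
          LinearMap.smul_apply, _root_.mul_comm l i]
        rcases negOnePow_cases (i * k) with e1 | e1 <;>
          rcases negOnePow_cases (j * k) with e2 | e2 <;>
          rcases negOnePow_cases (i * l) with e3 | e3 <;>
          rcases negOnePow_cases (j * l) with e4 | e4 <;> simp [e1, e2, e3, e4]
  bracket_mul m n x hx y hy z := by
    induction hx using PrePoisson.tensor_deg_induction with
    | hadd x x' _ _ hx hx' =>
      simp only [map_add, LinearMap.add_apply, mul_add, add_mul, hx, hx', smul_add]; abel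
    | h i j hij a ha b hb =>
      induction hy using PrePoisson.tensor_deg_induction with
      | hadd x x' _ _ hx hx' =>
        simp only [map_add, add_mul, hx, hx', smul_add]; abel
      | h k l hkl a' ha' b' hb' =>
        induction z using PrePoisson.tensor_induction with
        | hadd x x' hx hx' =>
          simp only [map_add, mul_add, hx, hx', smul_add]; abel
        | h a₂ b₂ =>
          induction a₂ using R.homogeneous_induction with
          | hadd x x' hx hx' =>
            simp only [map_add, LinearMap.add_apply, mul_add, hx, hx', smul_add]; abel
          | h o a₂ ha₂ =>
            -- Both sides are brought to a common form in which `b'`, respectively `a'`, stands on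
            -- the left.
            have e5 : b * (b' * b₂) = (j * l).negOnePow • (b' * (b * b₂)) := by
              rw [← mul_assoc, hS.mul_comm _ _ _ hb _ hb', smul_mul_assoc, mul_assoc]
            have e6 : a * (a' * a₂) = (i * k).negOnePow • (a' * (a * a₂)) := by
              rw [← mul_assoc, hR.mul_comm _ _ _ ha _ ha', smul_mul_assoc, mul_assoc]
            have e7 := hR.bracket_mul _ _ _ ha _ ha' a₂
            have e8 := hS.bracket_mul _ _ _ hb _ hb' b₂
            rw [PrePoisson.tmul_mul_tmul _ hb' ha₂, LinearMap.map_smul_of_tower,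
              PrePoisson.tensor_bracket_tmul a hb (SetLike.GradedMul.mul_mem ha' ha₂),
              PrePoisson.tensor_bracket_tmul a hb ha', PrePoisson.tensor_bracket_tmul a hb ha₂,
              smul_mul_assoc, mul_smul_comm, add_mul, mul_add (R.tmul S a' b'),
              PrePoisson.tmul_mul_tmul _ (SetLike.GradedMul.mul_mem hb hb') ha₂,
              PrePoisson.tmul_mul_tmul _ (hS.bracket_mem _ _ _ hb _ hb') ha₂,
              PrePoisson.tmul_mul_tmul _ hb' (hR.bracket_mem _ _ _ ha _ ha₂),
              PrePoisson.tmul_mul_tmul _ hb' (SetLike.GradedMul.mul_mem ha ha₂), ← hij, ← hkl,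
              e7, e8, map_add, map_add, LinearMap.add_apply, e5,
              mul_assoc a, e6, mul_assoc b, e5]
            simp only [mul_add, add_mul, Int.negOnePow_add, LinearMap.map_smul_of_tower,
              LinearMap.smul_apply, _root_.mul_comm l i, smul_add, smul_smul]
            rcases negOnePow_cases (i * k) with e1 | e1 <;>
              rcases negOnePow_cases (j * k) with e2 | e2 <;>
              rcases negOnePow_cases (i * l) with e3 | e3 <;>
              rcases negOnePow_cases (j * l) with e4 | e4 <;>
              rcases negOnePow_cases (l * o) with e5 | e5 <;>
              rcases negOnePow_cases (j * o) with e6 | e6 <;>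
              simp only [e1, e2, e3, e4, e5, e6, mul_one, mul_neg, one_smul, neg_neg,
                Units.neg_smul] <;> abel

/-- The elements `a ⊗ 1` and `1 ⊗ b` generate. Their brackets stay within one factor or vanish, so
on generators the axioms reduce to those of `R` and of `S`. -/
theorem PrePoisson.IsDGPoisson.tensor (hR : R.IsDGPoisson) (hS : S.IsDGPoisson) :
    (R.tensor S).IsDGPoisson := by
  have hX : (R.tensor S).IsCDGA := hR.toIsCDGA.tensor hS.toIsCDGA
  have h := hR.isSkewBiderivation.tensor hS.isSkewBiderivation hX
  have hLL : ∀ a a' : R.carrier, (R.tensor S).bracket (R.tmul S a 1) (R.tmul S a' 1) =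
      R.tmul S (R.bracket a a') 1 := by
    intro a a'
    induction a' using R.homogeneous_induction with
    | hadd x y hx hy => simp only [map_add, LinearMap.add_apply, hx, hy]
    | h i a' ha' =>
      rw [PrePoisson.tensor_bracket_tmul a SetLike.GradedOne.one_mem ha', zero_mul,
        hS.isSkewBiderivation.bracket_one]
      simp
  have hRR : ∀ b b' : S.carrier, (R.tensor S).bracket (R.tmul S 1 b) (R.tmul S 1 b') =
      R.tmul S 1 (S.bracket b b') := by
    intro b b'
    induction b using S.homogeneous_induction with
    | hadd x y hx hy => simp only [map_add, LinearMap.add_apply, hx, hy]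
    | h i b hb =>
      rw [PrePoisson.tensor_bracket_tmul 1 hb SetLike.GradedOne.one_mem, mul_zero,
        hR.isSkewBiderivation.bracket_one]
      simp
  have hLR : ∀ (a : R.carrier) (b : S.carrier),
      (R.tensor S).bracket (R.tmul S a 1) (R.tmul S 1 b) = 0 := by
    intro a b
    rw [PrePoisson.tensor_bracket_tmul a SetLike.GradedOne.one_mem SetLike.GradedOne.one_mem,
      hR.isSkewBiderivation.bracket_one, hS.isSkewBiderivation.one_bracket]
    simp
  have hRL : ∀ (a : R.carrier) (b : S.carrier),
      (R.tensor S).bracket (R.tmul S 1 b) (R.tmul S a 1) = 0 := by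
    intro a b
    induction a using R.homogeneous_induction with
    | hadd x y hx hy => simp only [map_add, LinearMap.add_apply, hx, hy, add_zero]
    | h i a ha =>
      induction b using S.homogeneous_induction with
      | hadd x y hx hy => simp only [map_add, LinearMap.add_apply, hx, hy, add_zero]
      | h j b hb =>
        rw [PrePoisson.tensor_bracket_tmul 1 hb ha, hR.isSkewBiderivation.one_bracket,
          hS.isSkewBiderivation.bracket_one]
        simp
  have dL : ∀ a : R.carrier, (R.tensor S).d (R.tmul S a 1) = R.tmul S (R.d a) 1 := by
    intro a
    induction a using R.homogeneous_induction with
    | hadd x y hx hy => simp only [map_add, LinearMap.add_apply, hx, hy]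
    | h i a ha => rw [PrePoisson.tensor_d_tmul ha, hS.d_one]; simp
  have dR : ∀ b : S.carrier, (R.tensor S).d (R.tmul S 1 b) = R.tmul S 1 (S.d b) := by
    intro b
    rw [PrePoisson.tensor_d_tmul SetLike.GradedOne.one_mem, hR.d_one]
    simp
  have hgen : ∀ {i x}, x ∈ R.tensorGenerators S.toPreDGAlg i →
      (∃ a ∈ R.deg i, x = R.tmul S a 1) ∨ ∃ b ∈ S.deg i, x = R.tmul S 1 b := by
    rintro i _ (⟨a, ha, rfl⟩ | ⟨b, hb, rfl⟩)
    · exact Or.inl ⟨a, ha, rfl⟩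
    · exact Or.inr ⟨b, hb, rfl⟩
  have hjac : ∀ i j k, ∀ x ∈ R.tensorGenerators S.toPreDGAlg i,
      ∀ y ∈ R.tensorGenerators S.toPreDGAlg j, ∀ z ∈ R.tensorGenerators S.toPreDGAlg k,
      (R.tensor S).bracket x ((R.tensor S).bracket y z) =
        (R.tensor S).bracket ((R.tensor S).bracket x y) z +
        (i * j).negOnePow • (R.tensor S).bracket y ((R.tensor S).bracket x z) := by
    intro i j k x hx y hy z hz
    obtain ⟨a, ha, rfl⟩ | ⟨a, ha, rfl⟩ := hgen hx <;> obtain ⟨b, hb, rfl⟩ | ⟨b, hb, rfl⟩ := hgen hy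
      <;> obtain ⟨c, hc, rfl⟩ | ⟨c, hc, rfl⟩ := hgen hz
    · simp only [hLL, hR.bracket_bracket ha hb c, map_add, LinearMap.add_apply,
        LinearMap.map_smul_of_tower, LinearMap.smul_apply]
    -- In the mixed cases every iterated bracket contains a bracket between the two factors, hence
    -- is zero.
    all_goals try simp only [hLL, hLR, hRL, hRR, map_zero, LinearMap.zero_apply, smul_zero,
      add_zero]
    · simp only [hS.bracket_bracket ha hb c, map_add, LinearMap.map_smul_of_tower]
  have hd : ∀ i j, ∀ x ∈ R.tensorGenerators S.toPreDGAlg i,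
      ∀ y ∈ R.tensorGenerators S.toPreDGAlg j,
      (R.tensor S).d ((R.tensor S).bracket x y) = (R.tensor S).bracket ((R.tensor S).d x) y +
        i.negOnePow • (R.tensor S).bracket x ((R.tensor S).d y) := by
    intro i j x hx y hy
    obtain ⟨a, ha, rfl⟩ | ⟨a, ha, rfl⟩ := hgen hx <;> obtain ⟨b, hb, rfl⟩ | ⟨b, hb, rfl⟩ := hgen hy
    · simp only [hLL, dL, hR.d_bracket _ _ ha b, map_add, LinearMap.add_apply,
        LinearMap.map_smul_of_tower, LinearMap.smul_apply]
    · simp only [hLR, dL, dR, map_zero, smul_zero, add_zero]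
    · simp only [hRL, dL, dR, map_zero, smul_zero, add_zero]
    · simp only [hRR, dR, hS.d_bracket _ _ ha b, map_add, LinearMap.map_smul_of_tower]
  exact {
    hX with
    bracket_mem := h.bracket_mem
    skew := h.skew
    jacobi := fun i j k x hx y hy z hz => h.jacobi_of_generators
      (S := R.tensorGenerators S.toPreDGAlg) PreDGAlg.tensorGenerators_subset
      PreDGAlg.tensorGenerators_span hjac hx hy hz
    d_bracket := fun i a ha b => h.d_bracket_of_generators hX
      (S := R.tensorGenerators S.toPreDGAlg) PreDGAlg.tensorGenerators_subset
      PreDGAlg.tensorGenerators_span hd ha b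
    leibniz := fun i j k a ha b hb c hc => h.leibniz ha hb hc }

end

/-! ### Homogeneous elements and contractions in exterior algebras -/

section

variable {M : Type u} {N : Type v} [AddCommGroup M] [AddCommGroup N]

/-- The vector `v` belongs to `M` and `k = -1`, or it belongs to `N` and `k = 1`. -/
def IsExtGenerator (v : M × N) (k : ℤ) : Prop := (k = -1 ∧ v.2 = 0) ∨ (k = 1 ∧ v.1 = 0)

theorem IsExtGenerator.negOnePow {v : M × N} {k : ℤ} (h : IsExtGenerator v k) :
    k.negOnePow = -1 := by
  obtain ⟨rfl, -⟩ | ⟨rfl, -⟩ := h <;> simp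

end

section

variable {M : Type u} {N : Type v} [AddCommGroup M] [Module ℂ M] [AddCommGroup N] [Module ℂ N]

theorem ι_inl_mem_extDeg (m : M) :
    ExteriorAlgebra.ι ℂ ((m, 0) : M × N) ∈ extDeg M N (-1) := by
  have h := extDeg_le M N 1 0
  simp only [pow_zero, mul_one, pow_one] at h
  exact h ⟨m, rfl⟩

theorem ι_inr_mem_extDeg (n : N) :
    ExteriorAlgebra.ι ℂ ((0, n) : M × N) ∈ extDeg M N 1 := by
  have h := extDeg_le M N 0 1
  simp only [pow_zero, one_mul, pow_one] at h
  exact h ⟨n, rfl⟩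

theorem IsExtGenerator.mem {v : M × N} {k : ℤ} (h : IsExtGenerator v k) :
    ExteriorAlgebra.ι ℂ v ∈ extDeg M N k := by
  obtain ⟨m, n⟩ := v
  obtain ⟨rfl, h⟩ | ⟨rfl, h⟩ := h
  · obtain rfl : n = 0 := h
    exact ι_inl_mem_extDeg m
  · obtain rfl : m = 0 := h
    exact ι_inr_mem_extDeg n

/-- Homogeneous elements of the exterior algebra of `M × N` are sums of products of generators. -/
theorem extDeg_induction {p : ∀ n, ∀ x : ExteriorAlgebra ℂ (M × N), x ∈ extDeg M N n → Prop}
    (h0 : ∀ n, p n 0 (zero_mem _)) (h1 : p 0 1 SetLike.GradedOne.one_mem)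
    (hadd : ∀ n x y hx hy, p n x hx → p n y hy → p n (x + y) (add_mem hx hy))
    (hsmul : ∀ n (c : ℂ) x hx, p n x hx → p n (c • x) (Submodule.smul_mem _ c hx))
    (hι : ∀ n k x v hx, ∀ hv : IsExtGenerator v k, p n x hx →
      p (k + n) (ExteriorAlgebra.ι ℂ v * x) (SetLike.GradedMul.mul_mem hv.mem hx))
    {n : ℤ} {x : ExteriorAlgebra ℂ (M × N)} (hx : x ∈ extDeg M N n) : p n x hx := by
  -- The elements of degree `n` that satisfy the motive. Left multiplication by `M` and `N` shifts
  -- `K` by `-1` and `1`, which reaches all `L ^ p * R ^ q` by induction on `q` and then on `p`.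
  let K : ℤ → Submodule ℂ (ExteriorAlgebra ℂ (M × N)) := fun n =>
    { carrier := {x | ∃ hx, p n x hx}
      zero_mem' := ⟨zero_mem _, h0 n⟩
      add_mem' := fun hx hy => ⟨add_mem hx.1 hy.1, hadd _ _ _ _ _ hx.2 hy.2⟩
      smul_mem' := fun c _ hx => ⟨Submodule.smul_mem _ _ hx.1, hsmul _ _ _ _ hx.2⟩ }
  have hL : ∀ n, extLeft M N * K n ≤ K (-1 + n) := fun n => by
    rw [Submodule.mul_le]
    rintro _ ⟨m, rfl⟩ x hx
    exact ⟨_, hι n _ x (m, 0) hx.1 (Or.inl ⟨rfl, rfl⟩) hx.2⟩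
  have hR : ∀ n, extRight M N * K n ≤ K (1 + n) := fun n => by
    rw [Submodule.mul_le]
    rintro _ ⟨m, rfl⟩ x hx
    exact ⟨_, hι n _ x (0, m) hx.1 (Or.inr ⟨rfl, rfl⟩) hx.2⟩
  have hq : ∀ q : ℕ, extRight M N ^ q ≤ K q := fun q => by
    induction q with
    | zero =>
      rw [pow_zero, Submodule.one_le]
      exact ⟨_, h1⟩
    | succ q ih =>
      rw [pow_succ']
      refine (mul_le_mul_right ih _).trans ((hR _).trans (le_of_eq ?_))
      congr 1
      push_cast
      ring
  have hpq : ∀ p q : ℕ, extLeft M N ^ p * extRight M N ^ q ≤ K (q - p) := fun p q => by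
    induction p with
    | zero => simpa using hq q
    | succ p ih =>
      rw [pow_succ', mul_assoc]
      refine (mul_le_mul_right ih _).trans ((hL _).trans (le_of_eq ?_))
      congr 1
      push_cast
      ring
  have hle : extDeg M N n ≤ K n := by
    simp only [extDeg, iSup_le_iff]
    rintro p q rfl
    exact hpq p q
  exact (hle hx).2

theorem ι_mul_ι_swap {V : Type u} [AddCommGroup V] [Module ℂ V] (v w : V) :
    ExteriorAlgebra.ι ℂ v * ExteriorAlgebra.ι ℂ w =
      -(ExteriorAlgebra.ι ℂ w * ExteriorAlgebra.ι ℂ v) :=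
  eq_neg_of_add_eq_zero_left (ExteriorAlgebra.ι_add_mul_swap _ _)

/-- Generators have degree `±1`, so the number of factors of a monomial of degree `n` has the parity
of `n`. This is why `v` may mix `M` and `N`. -/
theorem ι_mul_of_mem_extDeg (v : M × N) {n : ℤ} {x : ExteriorAlgebra ℂ (M × N)}
    (hx : x ∈ extDeg M N n) :
    ExteriorAlgebra.ι ℂ v * x = n.negOnePow • (x * ExteriorAlgebra.ι ℂ v) := by
  induction hx using extDeg_induction with
  | h0 => simp
  | h1 => simp
  | hadd n x y _ _ hx hy => rw [mul_add, add_mul, hx, hy, smul_add]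
  | hsmul n c x _ hx => rw [mul_smul_comm, hx, smul_mul_assoc, smul_comm]
  | hι n k x w _ hw hx =>
    rw [← mul_assoc, ι_mul_ι_swap, neg_mul, mul_assoc, hx, Int.negOnePow_add, hw.negOnePow]
    simp only [neg_mul, one_mul, Units.neg_smul, mul_smul_comm, mul_assoc]

theorem extDeg_mul_comm {i j : ℤ} {a b : ExteriorAlgebra ℂ (M × N)} (ha : a ∈ extDeg M N i)
    (hb : b ∈ extDeg M N j) : a * b = (i * j).negOnePow • (b * a) := by
  induction ha using extDeg_induction with
  | h0 => simp
  | h1 => simp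
  | hadd n x y _ _ hx hy => rw [mul_add, add_mul, hx, hy, smul_add]
  | hsmul n c x _ hx => rw [mul_smul_comm, smul_mul_assoc, hx, smul_comm]
  | hι n k x w _ hw hx =>
    have e : (k * j).negOnePow = j.negOnePow := by
      have := (Int.negOnePow_eq_neg_one_iff k).1 hw.negOnePow
      rcases Int.even_or_odd j with h | h
      · rw [Int.negOnePow_even _ (h.mul_left k), Int.negOnePow_even _ h]
      · rw [Int.negOnePow_odd _ (this.mul h), Int.negOnePow_odd _ h]
    rw [mul_assoc, hx, mul_smul_comm, ← mul_assoc, ι_mul_of_mem_extDeg w hb, add_mul,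
      Int.negOnePow_add, e, smul_mul_assoc, smul_smul, mul_assoc, mul_comm (j.negOnePow)]

open CliffordAlgebra in
-- A contraction changes sign past each generator, and the parity of their number is again that of
-- `n`; `φ` need not be homogeneous.
theorem contractLeft_mul_of_mem_extDeg (φ : Module.Dual ℂ (M × N)) {n : ℤ}
    {x : ExteriorAlgebra ℂ (M × N)} (hx : x ∈ extDeg M N n) (y : ExteriorAlgebra ℂ (M × N)) :
    contractLeft φ (x * y) = contractLeft φ x * y + n.negOnePow • (x * contractLeft φ y) := by
  induction hx using extDeg_induction with
  | h0 => simp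
  | h1 => simp
  | hadd n x z _ _ hx hz => rw [add_mul, map_add, hx, hz, map_add, add_mul, add_mul, smul_add]; abel
  | hsmul n c x _ hx =>
    rw [smul_mul_assoc, map_smul, map_smul, hx, smul_add, smul_mul_assoc, smul_mul_assoc, smul_comm]
  | hι n k x w _ hw hx =>
    rw [mul_assoc, ExteriorAlgebra.ι, contractLeft_ι_mul, contractLeft_ι_mul, hx,
      Int.negOnePow_add, hw.negOnePow, mul_add, sub_mul, smul_mul_assoc, mul_smul_comm,
      mul_assoc, mul_assoc]
    simp only [neg_mul, one_mul, Units.neg_smul]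
    abel

open CliffordAlgebra in
-- In a product of `m` generators, contracting the `r`-th one costs `(-1)^(r-1)` from the left and
-- `(-1)^(m-r)` from the right. The ratio `(-1)^(m-1)` depends only on the parity of `m`, which is
-- that of `n`.
theorem contractRight_of_mem_extDeg (φ : Module.Dual ℂ (M × N)) {n : ℤ}
    {x : ExteriorAlgebra ℂ (M × N)} (hx : x ∈ extDeg M N n) :
    contractRight x φ = (n + 1).negOnePow • contractLeft φ x := by
  induction hx using extDeg_induction with
  | h0 => simp
  | h1 => simp
  | hadd n x z _ _ hx hz => rw [map_add, LinearMap.add_apply, map_add, hx, hz, smul_add]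
  | hsmul n c x _ hx => rw [map_smul, LinearMap.smul_apply, map_smul, hx, smul_comm]
  | hι n k x w hxn hw hx =>
    rw [ι_mul_of_mem_extDeg w hxn, LinearMap.map_smul_of_tower, LinearMap.smul_apply,
      LinearMap.map_smul_of_tower, contractLeft_mul_of_mem_extDeg φ hxn, ExteriorAlgebra.ι,
      contractRight_mul_ι, contractLeft_ι, hx]
    simp only [Int.negOnePow_add, hw.negOnePow, Int.negOnePow_one, Algebra.algebraMap_eq_smul_one]
    rcases negOnePow_cases n with e | e <;> simp [e] <;> abel

open CliffordAlgebra in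
-- The hypothesis `hφ` expresses that `φ` is homogeneous of degree `ε`: it vanishes on generators of
-- degree other than `-ε`.
theorem contractLeft_mem_extDeg {φ : Module.Dual ℂ (M × N)} {ε : ℤ}
    (hφ : ∀ v k, IsExtGenerator v k → φ v = 0 ∨ k + ε = 0) {n : ℤ}
    {x : ExteriorAlgebra ℂ (M × N)} (hx : x ∈ extDeg M N n) :
    contractLeft φ x ∈ extDeg M N (n + ε) := by
  induction hx using extDeg_induction with
  | h0 => simp
  | h1 => simp
  | hadd n x z _ _ hx hz => rw [map_add]; exact add_mem hx hz
  | hsmul n c x _ hx => rw [map_smul]; exact Submodule.smul_mem _ _ hx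
  | hι n k x w hxn hw hx =>
    rw [ExteriorAlgebra.ι, contractLeft_ι_mul]
    refine sub_mem ?_ ?_
    · obtain h | h := hφ w k hw
      · simp [h]
      · rw [add_right_comm, h, zero_add]
        exact Submodule.smul_mem _ _ hxn
    · rw [add_assoc]
      exact SetLike.GradedMul.mul_mem hw.mem hx

end

/-! ### The classical Clifford algebra is a Poisson algebra -/

section

variable {M : Type u} {N : Type v} [AddCommGroup M] [Module ℂ M] [AddCommGroup N] [Module ℂ N]

open CliffordAlgebra in
/-- The bilinear map `(a, b) ↦ (a ⌊ φ) (χ ⌋ b)` on the exterior algebra. -/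
def contractMul {V : Type u} [AddCommGroup V] [Module ℂ V] (φ χ : Module.Dual ℂ V) :
    ExteriorAlgebra ℂ V →ₗ[ℂ] ExteriorAlgebra ℂ V →ₗ[ℂ] ExteriorAlgebra ℂ V :=
  (LinearMap.mul ℂ (ExteriorAlgebra ℂ V)).compl₁₂ (contractRight.flip φ) (contractLeft χ)

open CliffordAlgebra in
theorem contractMul_apply {V : Type u} [AddCommGroup V] [Module ℂ V] (φ χ : Module.Dual ℂ V)
    (a b : ExteriorAlgebra ℂ V) :
    contractMul φ χ a b = contractRight a φ * contractLeft χ b := rfl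

theorem contractMul_ι_ι {V : Type u} [AddCommGroup V] [Module ℂ V] (φ χ : Module.Dual ℂ V)
    (v w : V) : contractMul φ χ (ExteriorAlgebra.ι ℂ v) (ExteriorAlgebra.ι ℂ w) =
      algebraMap ℂ _ (φ v * χ w) := by
  rw [contractMul_apply, ExteriorAlgebra.ι, CliffordAlgebra.contractRight_ι,
    CliffordAlgebra.contractLeft_ι, map_mul]

variable {φ χ : Module.Dual ℂ (M × N)} {ε : ℤ}

theorem contractRight_mem_extDeg
    (hφ : ∀ v k, IsExtGenerator v k → φ v = 0 ∨ k + ε = 0) {n : ℤ}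
    {x : ExteriorAlgebra ℂ (M × N)} (hx : x ∈ extDeg M N n) :
    CliffordAlgebra.contractRight x φ ∈ extDeg M N (n + ε) := by
  rw [contractRight_of_mem_extDeg φ hx, Units.smul_def]
  exact zsmul_mem (contractLeft_mem_extDeg hφ hx) _

theorem contractMul_mem
    (hφ : ∀ v k, IsExtGenerator v k → φ v = 0 ∨ k + ε = 0)
    (hχ : ∀ v k, IsExtGenerator v k → χ v = 0 ∨ k + -ε = 0) {i j : ℤ}
    {a b : ExteriorAlgebra ℂ (M × N)} (ha : a ∈ extDeg M N i) (hb : b ∈ extDeg M N j) :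
    contractMul φ χ a b ∈ extDeg M N (i + j) := by
  have h := SetLike.GradedMul.mul_mem (contractRight_mem_extDeg hφ ha)
    (contractLeft_mem_extDeg hχ hb)
  rwa [add_add_add_comm, add_neg_cancel, add_zero] at h

/-- Skew-symmetry exchanges the roles of `φ` and `χ`, which is why the Clifford bracket is a sum
over both orders of each dual pair. -/
theorem contractMul_skew (hε : Odd ε)
    (hφ : ∀ v k, IsExtGenerator v k → φ v = 0 ∨ k + ε = 0)
    (hχ : ∀ v k, IsExtGenerator v k → χ v = 0 ∨ k + -ε = 0) {i j : ℤ}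
    {a b : ExteriorAlgebra ℂ (M × N)} (ha : a ∈ extDeg M N i) (hb : b ∈ extDeg M N j) :
    contractMul φ χ a b = (1 + i * j).negOnePow • contractMul χ φ b a := by
  rw [contractMul_apply, contractMul_apply, contractRight_of_mem_extDeg φ ha,
    contractRight_of_mem_extDeg χ hb, smul_mul_assoc, smul_mul_assoc,
    extDeg_mul_comm (contractLeft_mem_extDeg hφ ha) (contractLeft_mem_extDeg hχ hb), smul_smul,
    smul_smul, ← Int.negOnePow_add, ← Int.negOnePow_add]
  congr 1
  rw [Int.negOnePow_eq_iff]
  obtain ⟨e, rfl⟩ := hε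
  -- Half the difference of the two exponents, with `ε = 2 e + 1`.
  exact ⟨-(e * i) + e * j - 2 * e * e - 2 * e - 1, by ring⟩

theorem contractMul_mul (hε : Odd ε)
    (hφ : ∀ v k, IsExtGenerator v k → φ v = 0 ∨ k + ε = 0) {i j : ℤ}
    {a b : ExteriorAlgebra ℂ (M × N)} (ha : a ∈ extDeg M N i) (hb : b ∈ extDeg M N j)
    (c : ExteriorAlgebra ℂ (M × N)) :
    contractMul φ χ a (b * c) =
      contractMul φ χ a b * c + (i * j).negOnePow • (b * contractMul φ χ a c) := by
  rw [contractMul_apply, contractMul_apply, contractMul_apply,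
    contractLeft_mul_of_mem_extDeg χ hb, mul_add, mul_assoc, mul_smul_comm, ← mul_assoc _ b,
    extDeg_mul_comm (contractRight_mem_extDeg hφ ha) hb, smul_mul_assoc, smul_smul, mul_assoc b,
    ← Int.negOnePow_add]
  congr 2
  rw [Int.negOnePow_eq_iff]
  obtain ⟨e, rfl⟩ := hε
  -- Half of `j (1 + ε)`, the difference of the exponents.
  exact ⟨j * (e + 1), by ring⟩

end

/-! ### The Poisson bracket of `cCl g`. -/

section

variable {g : Type u} [AddCommGroup g] [Module ℂ g] [FiniteDimensional ℂ g]

theorem fst_comp_eq_zero {M : Type u} {N : Type v} [AddCommGroup M] [Module ℂ M] [AddCommGroup N]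
    [Module ℂ N] (α : Module.Dual ℂ M) (v : M × N) (k : ℤ) (h : IsExtGenerator v k) :
    (α ∘ₗ LinearMap.fst ℂ M N) v = 0 ∨ k + 1 = 0 := by
  obtain ⟨rfl, -⟩ | ⟨-, h⟩ := h
  · exact Or.inr (by norm_num)
  · exact Or.inl (by simp [h])

theorem snd_comp_eq_zero {M : Type u} {N : Type v} [AddCommGroup M] [Module ℂ M] [AddCommGroup N]
    [Module ℂ N] (α : Module.Dual ℂ N) (v : M × N) (k : ℤ) (h : IsExtGenerator v k) :
    (α ∘ₗ LinearMap.snd ℂ M N) v = 0 ∨ k + -1 = 0 := by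
  obtain ⟨-, h⟩ | ⟨rfl, -⟩ := h
  · exact Or.inl (by simp [h])
  · exact Or.inr (by norm_num)

variable (g) in
/-- The bracket of `cCl g`, as a bilinear map on the exterior algebra. -/
def cliffordBracket : ExteriorAlgebra ℂ (g × Module.Dual ℂ g) →ₗ[ℂ]
    ExteriorAlgebra ℂ (g × Module.Dual ℂ g) →ₗ[ℂ] ExteriorAlgebra ℂ (g × Module.Dual ℂ g) :=
  ∑ i, (contractMul ((Module.finBasis ℂ g).coord i ∘ₗ LinearMap.fst ℂ g (Module.Dual ℂ g))
      (Module.Dual.eval ℂ g (Module.finBasis ℂ g i) ∘ₗ LinearMap.snd ℂ g (Module.Dual ℂ g)) +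
    contractMul (Module.Dual.eval ℂ g (Module.finBasis ℂ g i) ∘ₗ LinearMap.snd ℂ g (Module.Dual ℂ g))
      ((Module.finBasis ℂ g).coord i ∘ₗ LinearMap.fst ℂ g (Module.Dual ℂ g)))

theorem cCl_bracket : (cCl g).bracket = cliffordBracket g := rfl

theorem cliffordBracket_apply (a b : ExteriorAlgebra ℂ (g × Module.Dual ℂ g)) :
    cliffordBracket g a b =
    ∑ i, (contractMul ((Module.finBasis ℂ g).coord i ∘ₗ LinearMap.fst ℂ g (Module.Dual ℂ g))
        (Module.Dual.eval ℂ g (Module.finBasis ℂ g i) ∘ₗ LinearMap.snd ℂ g (Module.Dual ℂ g)) a b +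
      contractMul (Module.Dual.eval ℂ g (Module.finBasis ℂ g i) ∘ₗ
          LinearMap.snd ℂ g (Module.Dual ℂ g))
        ((Module.finBasis ℂ g).coord i ∘ₗ LinearMap.fst ℂ g (Module.Dual ℂ g)) a b) := by
  rw [cliffordBracket, LinearMap.sum_apply, LinearMap.sum_apply]
  rfl

/-- The sum over the dual bases collapses to the evaluation pairing, so the bracket does not depend
on the basis. -/
theorem cliffordBracket_ι_ι (v w : g × Module.Dual ℂ g) :
    cliffordBracket g (ExteriorAlgebra.ι ℂ v) (ExteriorAlgebra.ι ℂ w) =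
      algebraMap ℂ _ (w.2 v.1 + v.2 w.1) := by
  rw [cliffordBracket_apply]
  simp only [contractMul_ι_ι, ← map_add, ← map_sum]
  congr 1
  have h : ∀ (x : g) (f : Module.Dual ℂ g),
      ∑ i, (Module.finBasis ℂ g).coord i x * f (Module.finBasis ℂ g i) = f x := by
    intro x f
    conv_rhs => rw [← (Module.finBasis ℂ g).sum_repr x, map_sum]
    simp only [map_smul, smul_eq_mul, Module.Basis.coord_apply]
  rw [Finset.sum_add_distrib, ← h v.1 w.2, ← h w.1 v.2]
  simp [mul_comm]

theorem cliffordBracket_algebraMap (a : ExteriorAlgebra ℂ (g × Module.Dual ℂ g)) (c : ℂ) :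
    cliffordBracket g a (algebraMap ℂ _ c) = 0 := by
  rw [cliffordBracket_apply]
  refine Finset.sum_eq_zero fun i _ => ?_
  rw [contractMul_apply, contractMul_apply, CliffordAlgebra.contractLeft_algebraMap,
    CliffordAlgebra.contractLeft_algebraMap, mul_zero, mul_zero, add_zero]

theorem algebraMap_cliffordBracket (a : ExteriorAlgebra ℂ (g × Module.Dual ℂ g)) (c : ℂ) :
    cliffordBracket g (algebraMap ℂ _ c) a = 0 := by
  rw [cliffordBracket_apply]
  refine Finset.sum_eq_zero fun i _ => ?_
  rw [contractMul_apply, contractMul_apply, CliffordAlgebra.contractRight_algebraMap,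
    CliffordAlgebra.contractRight_algebraMap, zero_mul, zero_mul, add_zero]

theorem cliffordBracket_mem {i j : ℤ} {a b : ExteriorAlgebra ℂ (g × Module.Dual ℂ g)}
    (ha : a ∈ extDeg g (Module.Dual ℂ g) i) (hb : b ∈ extDeg g (Module.Dual ℂ g) j) :
    cliffordBracket g a b ∈ extDeg g (Module.Dual ℂ g) (i + j) := by
  rw [cliffordBracket_apply]
  refine Submodule.sum_mem _ fun k _ => add_mem ?_ ?_
  · exact contractMul_mem (fst_comp_eq_zero _) (snd_comp_eq_zero _) ha hb
  · exact contractMul_mem (ε := -1) (snd_comp_eq_zero _)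
      (fun v k h => by rw [neg_neg]; exact fst_comp_eq_zero _ v k h) ha hb

theorem cliffordBracket_skew {i j : ℤ} {a b : ExteriorAlgebra ℂ (g × Module.Dual ℂ g)}
    (ha : a ∈ extDeg g (Module.Dual ℂ g) i) (hb : b ∈ extDeg g (Module.Dual ℂ g) j) :
    cliffordBracket g a b = (1 + i * j).negOnePow • cliffordBracket g b a := by
  rw [cliffordBracket_apply, cliffordBracket_apply, Finset.smul_sum]
  refine Finset.sum_congr rfl fun k _ => ?_
  rw [contractMul_skew odd_one (fst_comp_eq_zero _) (snd_comp_eq_zero _) ha hb,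
    contractMul_skew (ε := -1) odd_one.neg (snd_comp_eq_zero _)
      (fun v k h => by rw [neg_neg]; exact fst_comp_eq_zero _ v k h) ha hb, smul_add, add_comm]

theorem cliffordBracket_mul {i j : ℤ} {a b : ExteriorAlgebra ℂ (g × Module.Dual ℂ g)}
    (ha : a ∈ extDeg g (Module.Dual ℂ g) i) (hb : b ∈ extDeg g (Module.Dual ℂ g) j)
    (c : ExteriorAlgebra ℂ (g × Module.Dual ℂ g)) :
    cliffordBracket g a (b * c) =
      cliffordBracket g a b * c + (i * j).negOnePow • (b * cliffordBracket g a c) := by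
  simp only [cliffordBracket_apply, Finset.mul_sum, Finset.sum_mul, Finset.smul_sum,
    ← Finset.sum_add_distrib]
  refine Finset.sum_congr rfl fun k _ => ?_
  rw [contractMul_mul odd_one (fst_comp_eq_zero _) ha hb,
    contractMul_mul (ε := -1) odd_one.neg (snd_comp_eq_zero _) ha hb, add_mul, mul_add, smul_add]
  abel

theorem cCl_isSkewBiderivation : (cCl g).IsSkewBiderivation where
  mul_comm _ _ _ ha _ hb := extDeg_mul_comm ha hb
  bracket_mem _ _ _ ha _ hb := cliffordBracket_mem ha hb
  skew _ _ _ ha _ hb := cliffordBracket_skew ha hb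
  bracket_mul _ _ _ ha _ hb c := cliffordBracket_mul ha hb c

theorem ext_generators_span {M : Type u} {N : Type v} [AddCommGroup M] [Module ℂ M]
    [AddCommGroup N] [Module ℂ N] (K : Submodule ℂ (ExteriorAlgebra ℂ (M × N))) (h1 : 1 ∈ K)
    (h : ∀ i, ∀ s ∈ {x | ∃ v : M × N, IsExtGenerator v i ∧ x = ExteriorAlgebra.ι ℂ v},
      ∀ n ∈ K, s * n ∈ K) : K = ⊤ := by
  rw [eq_top_iff, ← extDeg_iSup, iSup_le_iff]
  intro n x hx
  induction hx using extDeg_induction with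
  | h0 => exact zero_mem _
  | h1 => exact h1
  | hadd n x y _ _ hx hy => exact add_mem hx hy
  | hsmul n c x _ hx => exact Submodule.smul_mem _ _ hx
  | hι n k x v _ hv hx => exact h k _ ⟨v, hv, rfl⟩ _ hx

theorem cCl_isDGPoisson : (cCl g).IsDGPoisson where
  mul_comm _ _ _ ha _ hb := extDeg_mul_comm ha hb
  d_mem _ _ _ := zero_mem _
  d_d _ := rfl
  d_mul _ a _ b := by
    have h : ∀ x, (cCl g).d x = 0 := fun _ => rfl
    rw [h, h, h, zero_mul, mul_zero, smul_zero, add_zero]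
  bracket_mem _ _ _ ha _ hb := cliffordBracket_mem ha hb
  skew _ _ _ ha _ hb := cliffordBracket_skew ha hb
  d_bracket _ a _ b := by
    have h : ∀ x, (cCl g).d x = 0 := fun _ => rfl
    rw [h, h, h, map_zero, LinearMap.zero_apply, map_zero, smul_zero, add_zero]
  leibniz _ _ _ _ ha _ hb _ hc := cCl_isSkewBiderivation.leibniz ha hb hc
  jacobi _ _ _ _ hx _ hy _ hz := by
    refine cCl_isSkewBiderivation.jacobi_of_generators
      (S := fun i => {x | ∃ v : g × Module.Dual ℂ g, IsExtGenerator v i ∧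
        x = ExteriorAlgebra.ι ℂ v}) ?_ ext_generators_span ?_ hx hy hz
    · rintro i _ ⟨v, hv, rfl⟩
      exact hv.mem
    · rintro i j k _ ⟨v, -, rfl⟩ _ ⟨w, -, rfl⟩ _ ⟨z, -, rfl⟩
      rw [cCl_bracket]
      -- Brackets of generators are scalars and scalars bracket to zero, so on generators every term
      -- of the Jacobi identity vanishes.
      have h : ∀ v w z : g × Module.Dual ℂ g, cliffordBracket g (ExteriorAlgebra.ι ℂ v)
          (cliffordBracket g (ExteriorAlgebra.ι ℂ w) (ExteriorAlgebra.ι ℂ z)) = 0 :=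
        fun v w z => by rw [cliffordBracket_ι_ι, cliffordBracket_algebraMap]
      have h' : cliffordBracket g (cliffordBracket g (ExteriorAlgebra.ι ℂ v)
          (ExteriorAlgebra.ι ℂ w)) (ExteriorAlgebra.ι ℂ z) = 0 := by
        rw [cliffordBracket_ι_ι, algebraMap_cliffordBracket]
      have e : cliffordBracket g (ExteriorAlgebra.ι ℂ v) (cliffordBracket g (ExteriorAlgebra.ι ℂ w)
          (ExteriorAlgebra.ι ℂ z)) = cliffordBracket g (cliffordBracket g (ExteriorAlgebra.ι ℂ v)
          (ExteriorAlgebra.ι ℂ w)) (ExteriorAlgebra.ι ℂ z) +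
          (i * j).negOnePow • cliffordBracket g (ExteriorAlgebra.ι ℂ w)
            (cliffordBracket g (ExteriorAlgebra.ι ℂ v) (ExteriorAlgebra.ι ℂ z)) := by
        rw [h, h', h, smul_zero, add_zero]
      exact e

end

/-! ### The BRST charge -/

section

variable {g : Type u} [LieRing g] [LieAlgebra ℂ g]

/-- Linear maps `ψ : g → R` and `ψs : g* → R` satisfying the relations of the generators of the
Clifford algebra of `g`. -/
structure IsGhostSystem (R : PrePoisson.{v}) (ψ : g →ₗ[ℂ] R.carrier)
    (ψs : Module.Dual ℂ g →ₗ[ℂ] R.carrier) : Prop where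
  mem : ∀ x, ψ x ∈ R.deg (-1)
  mem_dual : ∀ f, ψs f ∈ R.deg 1
  bracket_self : ∀ x y, R.bracket (ψ x) (ψ y) = 0
  bracket_dual : ∀ x f, R.bracket (ψ x) (ψs f) = f x • 1
  bracket_dual_dual : ∀ f h, R.bracket (ψs f) (ψs h) = 0

variable {R : PrePoisson.{v}} {ψ : g →ₗ[ℂ] R.carrier} {ψs : Module.Dual ℂ g →ₗ[ℂ] R.carrier}
variable {ι : Type*} [Fintype ι] (b : Module.Basis ι ℂ g)

/-- The cubic term `∑ i j, ψ*ᵢ ψ([xᵢ, xⱼ]) ψ*ⱼ` of the BRST charge. -/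
def cubicCharge (ψ : g →ₗ[ℂ] R.carrier) (ψs : Module.Dual ℂ g →ₗ[ℂ] R.carrier) : R.carrier :=
  ∑ i, ∑ j, ψs (b.coord i) * (ψ ⁅b i, b j⁆ * ψs (b.coord j))

theorem sum_coord_smul {W : Type*} [AddCommGroup W] [Module ℂ W] (f : g →ₗ[ℂ] W) (x : g) :
    ∑ i, b.coord i x • f (b i) = f x := by
  conv_rhs => rw [← b.sum_repr x, map_sum]
  simp only [map_smul, Module.Basis.coord_apply]

theorem cubicCharge_mem (hψ : IsGhostSystem R ψ ψs) : cubicCharge b ψ ψs ∈ R.deg 1 := by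
  refine Submodule.sum_mem _ fun i _ => Submodule.sum_mem _ fun j _ => ?_
  have h := SetLike.GradedMul.mul_mem (hψ.mem_dual (b.coord i))
    (SetLike.GradedMul.mul_mem (hψ.mem ⁅b i, b j⁆) (hψ.mem_dual (b.coord j)))
  simpa using h

theorem PrePoisson.IsSkewBiderivation.bracket_mul_odd (hR : R.IsSkewBiderivation)
    {x y z : R.carrier} {i j : ℤ}
    (hx : x ∈ R.deg i) (hy : y ∈ R.deg j) (hi : Odd i) (hj : Odd j) :
    R.bracket x (y * z) = R.bracket x y * z - y * R.bracket x z := by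
  rw [hR.bracket_mul _ _ _ hx _ hy, Int.negOnePow_odd _ (hi.mul hj), Units.neg_smul, one_smul,
    sub_eq_add_neg]

theorem PrePoisson.IsSkewBiderivation.bracket_comm_odd (hR : R.IsSkewBiderivation)
    {x y : R.carrier} {i j : ℤ}
    (hx : x ∈ R.deg i) (hy : y ∈ R.deg j) (hi : Odd i) (hj : Odd j) :
    R.bracket x y = R.bracket y x := by
  rw [hR.skew _ _ _ hx _ hy, add_comm, Int.negOnePow_even _ ((hi.mul hj).add_one), one_smul]

theorem IsGhostSystem.dual_mul_dual (hψ : IsGhostSystem R ψ ψs) (hR : R.IsSkewBiderivation)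
    (f h : Module.Dual ℂ g) : ψs f * ψs h = -(ψs h * ψs f) := by
  rw [hR.mul_comm _ _ _ (hψ.mem_dual f) _ (hψ.mem_dual h)]
  simp

theorem IsGhostSystem.mul_dual (hψ : IsGhostSystem R ψ ψs) (hR : R.IsSkewBiderivation)
    (x : g) (h : Module.Dual ℂ g) : ψ x * ψs h = -(ψs h * ψ x) := by
  rw [hR.mul_comm _ _ _ (hψ.mem x) _ (hψ.mem_dual h)]
  simp

/-- In each monomial only the factor `ψ([xᵢ, xⱼ])` pairs with `ψ*(f)`; the sign comes from passing
the odd `ψ*ᵢ`. -/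
theorem bracket_cubicCharge_dual (hψ : IsGhostSystem R ψ ψs) (hR : R.IsSkewBiderivation)
    (f : Module.Dual ℂ g) :
    R.bracket (cubicCharge b ψ ψs) (ψs f) =
      -∑ i, ∑ j, f ⁅b i, b j⁆ • (ψs (b.coord i) * ψs (b.coord j)) := by
  rw [hR.bracket_comm_odd (cubicCharge_mem b hψ) (hψ.mem_dual f) odd_one odd_one, cubicCharge,
    map_sum, ← Finset.sum_neg_distrib]
  refine Finset.sum_congr rfl fun i _ => ?_
  rw [map_sum, ← Finset.sum_neg_distrib]
  refine Finset.sum_congr rfl fun j _ => ?_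
  rw [hR.bracket_mul_odd (hψ.mem_dual f) (hψ.mem_dual _) odd_one odd_one,
    hR.bracket_mul_odd (hψ.mem_dual f) (hψ.mem _) odd_one odd_one.neg, hψ.bracket_dual_dual,
    hψ.bracket_dual_dual,
    hR.bracket_comm_odd (hψ.mem_dual f) (hψ.mem _) odd_one odd_one.neg, hψ.bracket_dual]
  simp

/-- Each of the two factors `ψ*ᵢ`, `ψ*ⱼ` pairs with `ψ(x)`. By antisymmetry of the Lie bracket and
of the product the two contributions agree, whence the factor `2`. -/
theorem bracket_cubicCharge_ghost (hψ : IsGhostSystem R ψ ψs) (hR : R.IsSkewBiderivation)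
    (x : g) :
    R.bracket (cubicCharge b ψ ψs) (ψ x) = (2 : ℂ) • ∑ j, ψ ⁅x, b j⁆ * ψs (b.coord j) := by
  have h1 : ∑ i, ∑ j, b.coord i x • (ψ ⁅b i, b j⁆ * ψs (b.coord j)) =
      ∑ j, ψ ⁅x, b j⁆ * ψs (b.coord j) := by
    rw [Finset.sum_comm]
    refine Finset.sum_congr rfl fun j _ => ?_
    have e := sum_coord_smul b (LinearMap.mulRight ℂ (ψs (b.coord j)) ∘ₗ ψ ∘ₗ
      (-LieAlgebra.ad ℂ g (b j))) x
    simpa only [LinearMap.comp_apply, LinearMap.mulRight_apply, LinearMap.neg_apply,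
      LieAlgebra.ad_apply, lie_skew] using e
  have h2 : ∑ i, ∑ j, b.coord j x • (ψs (b.coord i) * ψ ⁅b i, b j⁆) =
      ∑ j, ψ ⁅x, b j⁆ * ψs (b.coord j) := by
    refine Finset.sum_congr rfl fun i _ => ?_
    rw [hψ.mul_dual hR, ← lie_skew, map_neg, mul_neg, neg_neg]
    have e := sum_coord_smul b (LinearMap.mulLeft ℂ (ψs (b.coord i)) ∘ₗ ψ ∘ₗ
      LieAlgebra.ad ℂ g (b i)) x
    simpa using e
  rw [hR.bracket_comm_odd (cubicCharge_mem b hψ) (hψ.mem x) odd_one odd_one.neg, two_smul]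
  nth_rewrite 1 [← h1]
  rw [← h2, cubicCharge, map_sum, ← Finset.sum_add_distrib]
  refine Finset.sum_congr rfl fun i _ => ?_
  rw [map_sum, ← Finset.sum_add_distrib]
  refine Finset.sum_congr rfl fun j _ => ?_
  rw [hR.bracket_mul_odd (hψ.mem x) (hψ.mem_dual _) odd_one.neg odd_one,
    hR.bracket_mul_odd (hψ.mem x) (hψ.mem _) odd_one.neg odd_one.neg, hψ.bracket_dual,
    hψ.bracket_dual, hψ.bracket_self]
  simp

/-- Summing the structure constants against the basis restores the Lie bracket. `B` is left free
because the identity serves twice for the bracket of the cubic term with itself and once for its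
bracket with the linear term. -/
theorem sum_bracket_cubicCharge_dual (hψ : IsGhostSystem R ψ ψs) (hR : R.IsSkewBiderivation)
    {W : Type*} [AddCommGroup W] [Module ℂ W] (B : R.carrier →ₗ[ℂ] g →ₗ[ℂ] W) :
    ∑ i, B (R.bracket (cubicCharge b ψ ψs) (ψs (b.coord i))) (b i) =
      -∑ k, ∑ l, B (ψs (b.coord k) * ψs (b.coord l)) ⁅b k, b l⁆ := by
  simp only [bracket_cubicCharge_dual b hψ hR, map_neg, map_sum, LinearMap.neg_apply,
    LinearMap.sum_apply, Finset.sum_neg_distrib, map_smul, LinearMap.smul_apply]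
  rw [Finset.sum_comm]
  refine congrArg _ (Finset.sum_congr rfl fun k _ => ?_)
  rw [Finset.sum_comm]
  exact Finset.sum_congr rfl fun l _ => sum_coord_smul b (B _) _

/-- By the Leibniz rule all contributions are multiples of one element `W`, the sum of `ψ*ₖ ψ*ₗ ψ*ⱼ
ψ([[xₖ, xₗ], xⱼ])`. It vanishes by the Jacobi identity of `g`. -/
theorem bracket_cubicCharge_self (hψ : IsGhostSystem R ψ ψs) (hR : R.IsSkewBiderivation) :
    R.bracket (cubicCharge b ψ ψs) (cubicCharge b ψ ψs) = 0 := by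
  set e : ι → R.carrier := fun i => ψs (b.coord i) with he
  have anti : ∀ i j, e i * e j = -(e j * e i) := fun i j => hψ.dual_mul_dual hR _ _
  have antiψ : ∀ x j, ψ x * e j = -(e j * ψ x) := fun x j => hψ.mul_dual hR _ _
  set W : R.carrier := ∑ k, ∑ l, ∑ j, e k * (e l * (e j * ψ ⁅⁅b k, b l⁆, b j⁆)) with hW
  have rot : ∀ F : ι → ι → ι → R.carrier, ∑ k, ∑ l, ∑ j, F k l j = ∑ k, ∑ l, ∑ j, F l j k := by
    intro F
    symm
    rw [Finset.sum_comm]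
    exact Finset.sum_congr rfl fun l _ => Finset.sum_comm
  have hW0 : W = 0 := by
    -- A cyclic permutation of three odd factors is even, so no sign appears. `W` can thus be
    -- written with any of the three cyclic rotations of the double bracket, and `3 W` is a sum of
    -- Jacobi expressions.
    have r : ∀ k l j x, e l * (e j * (e k * x)) = e k * (e l * (e j * x)) := fun k l j x => by
      rw [← mul_assoc (e j), anti j k, neg_mul, mul_neg, mul_assoc, ← mul_assoc (e l), anti l k,
        neg_mul, neg_neg, mul_assoc]
    have e1 : W = ∑ k, ∑ l, ∑ j, e k * (e l * (e j * ψ ⁅⁅b l, b j⁆, b k⁆)) := by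
      rw [hW, rot]
      simp only [r]
    have e2 : W = ∑ k, ∑ l, ∑ j, e k * (e l * (e j * ψ ⁅⁅b j, b k⁆, b l⁆)) := by
      rw [e1, rot]
      simp only [r]
    have h3 : W + W + W = 0 := by
      have e3 : W + W + W = W + ∑ k, ∑ l, ∑ j, e k * (e l * (e j * ψ ⁅⁅b l, b j⁆, b k⁆)) +
          ∑ k, ∑ l, ∑ j, e k * (e l * (e j * ψ ⁅⁅b j, b k⁆, b l⁆)) := by rw [← e1, ← e2]
      rw [e3]
      simp only [hW, ← Finset.sum_add_distrib, ← mul_add, ← map_add]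
      refine Finset.sum_eq_zero fun k _ => Finset.sum_eq_zero fun l _ =>
        Finset.sum_eq_zero fun j _ => ?_
      have : ⁅⁅b k, b l⁆, b j⁆ + ⁅⁅b l, b j⁆, b k⁆ + ⁅⁅b j, b k⁆, b l⁆ = 0 := by
        rw [← lie_skew ⁅b k, b l⁆, ← lie_skew ⁅b l, b j⁆, ← lie_skew ⁅b j, b k⁆, ← neg_add, ← neg_add,
          lie_jacobi, neg_zero]
      rw [this, map_zero, mul_zero, mul_zero, mul_zero]
    have : (3 : ℂ) • W = 0 := by
      rw [← h3]
      module
    exact (smul_eq_zero.1 this).resolve_left three_ne_zero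
  have t1 : ∑ i, ∑ j, R.bracket (cubicCharge b ψ ψs) (e i) * (ψ ⁅b i, b j⁆ * e j) = W := by
    rw [Finset.sum_comm, hW, rot]
    refine Finset.sum_congr rfl fun j _ => ?_
    have h := sum_bracket_cubicCharge_dual b hψ hR ((LinearMap.mul ℂ R.carrier).compl₂
      (LinearMap.mulRight ℂ (e j) ∘ₗ ψ ∘ₗ (-LieAlgebra.ad ℂ g (b j))))
    simp only [LinearMap.compl₂_apply, LinearMap.comp_apply, LinearMap.mul_apply',
      LinearMap.mulRight_apply, LinearMap.neg_apply, LieAlgebra.ad_apply,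
      lie_skew] at h
    rw [h, ← Finset.sum_neg_distrib]
    refine Finset.sum_congr rfl fun k _ => ?_
    rw [← Finset.sum_neg_distrib]
    refine Finset.sum_congr rfl fun l _ => ?_
    rw [antiψ, mul_neg, neg_neg, mul_assoc]
  have t2 : ∑ i, ∑ j, e i * (R.bracket (cubicCharge b ψ ψs) (ψ ⁅b i, b j⁆) * e j) =
      -((2 : ℂ) • W) := by
    simp only [hW, Finset.smul_sum, ← Finset.sum_neg_distrib]
    refine Finset.sum_congr rfl fun i _ => Finset.sum_congr rfl fun j _ => ?_
    rw [bracket_cubicCharge_ghost b hψ hR, smul_mul_assoc, mul_smul_comm, Finset.sum_mul,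
      Finset.mul_sum, Finset.smul_sum]
    refine Finset.sum_congr rfl fun m _ => ?_
    rw [← smul_neg]
    congr 1
    change e i * (ψ _ * e m * e j) = _
    rw [antiψ, neg_mul, mul_assoc, antiψ]
    simp only [mul_neg, neg_neg]
    rw [← mul_assoc (e m), anti m j, neg_mul, mul_neg, mul_assoc]
  have t3 : ∑ i, ∑ j, e i * (ψ ⁅b i, b j⁆ * R.bracket (cubicCharge b ψ ψs) (e j)) = W := by
    rw [hW, rot]
    refine Finset.sum_congr rfl fun i _ => ?_
    have h := sum_bracket_cubicCharge_dual b hψ hR ((LinearMap.mul ℂ R.carrier) ∘ₗ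
      ψ ∘ₗ LieAlgebra.ad ℂ g (b i)).flip
    simp only [LinearMap.flip_apply, LinearMap.comp_apply, LinearMap.mul_apply',
      LieAlgebra.ad_apply] at h
    rw [← Finset.mul_sum, h, ← Finset.sum_neg_distrib, Finset.mul_sum]
    refine Finset.sum_congr rfl fun k _ => ?_
    rw [← Finset.sum_neg_distrib, Finset.mul_sum]
    refine Finset.sum_congr rfl fun l _ => ?_
    change e i * -(ψ _ * (e k * e l)) = _
    rw [← mul_assoc (ψ _), antiψ, neg_mul, neg_neg, mul_assoc, antiψ, mul_neg, mul_neg,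
      ← lie_skew, map_neg, mul_neg, mul_neg, mul_neg, neg_neg, ← mul_assoc (e i), anti i k,
      neg_mul, mul_assoc, ← mul_assoc (e i), anti i l, neg_mul, mul_neg, neg_neg, mul_assoc]
  -- An arbitrary `q` stands in the first argument so that only the second copy of the cubic term is
  -- expanded. With the cubic term as `q`, the three sums give `W + 2 W + W`.
  have key : ∀ q ∈ R.deg 1, R.bracket q (cubicCharge b ψ ψs) =
      ∑ i, ∑ j, R.bracket q (e i) * (ψ ⁅b i, b j⁆ * e j) -
      ∑ i, ∑ j, e i * (R.bracket q (ψ ⁅b i, b j⁆) * e j) +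
      ∑ i, ∑ j, e i * (ψ ⁅b i, b j⁆ * R.bracket q (e j)) := by
    intro q hq
    simp only [cubicCharge, map_sum, ← Finset.sum_add_distrib, ← Finset.sum_sub_distrib]
    refine Finset.sum_congr rfl fun i _ => Finset.sum_congr rfl fun j _ => ?_
    rw [hR.bracket_mul_odd hq (hψ.mem_dual _) odd_one odd_one,
      hR.bracket_mul_odd hq (hψ.mem _) odd_one odd_one.neg, mul_sub]
    abel
  rw [key _ (cubicCharge_mem b hψ), t1, t2, t3, hW0]
  simp

end

/-! ### The master equation. -/

section

variable {g : Type u} [LieRing g] [LieAlgebra ℂ g] {C : PrePoisson.{v}} {R : PrePoisson.{w}}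
  {ψ : g →ₗ[ℂ] C.carrier} {ψs : Module.Dual ℂ g →ₗ[ℂ] C.carrier}
  {ι : Type*} [Fintype ι] (b : Module.Basis ι ℂ g) (μ : g →ₗ[ℂ] R.carrier)

/-- The linear term `∑ i, ψ*ᵢ ⊗ μ(xᵢ)` of the BRST charge. -/
def linearCharge (ψs : Module.Dual ℂ g →ₗ[ℂ] C.carrier) : (C.tensor R).carrier :=
  ∑ i, C.tmul R (ψs (b.coord i)) (μ (b i))

/-- The BRST charge. -/
def brstCharge (ψ : g →ₗ[ℂ] C.carrier) (ψs : Module.Dual ℂ g →ₗ[ℂ] C.carrier) :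
    (C.tensor R).carrier :=
  linearCharge b μ ψs + (2⁻¹ : ℂ) • C.tmul R (cubicCharge b ψ ψs) 1

variable {μ}

theorem linearCharge_mem (hψ : IsGhostSystem C ψ ψs) (hμ : ∀ x, μ x ∈ R.deg 0) :
    linearCharge b μ ψs ∈ (C.tensor R).deg 1 :=
  Submodule.sum_mem _ fun _ _ => PrePoisson.tmul_mem (add_zero 1) (hψ.mem_dual _) (hμ _)

theorem tmul_cubicCharge_mem (hψ : IsGhostSystem C ψ ψs) :
    C.tmul R (cubicCharge b ψ ψs) 1 ∈ (C.tensor R).deg 1 :=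
  PrePoisson.tmul_mem (add_zero 1) (cubicCharge_mem b hψ) SetLike.GradedOne.one_mem

theorem brstCharge_mem (hψ : IsGhostSystem C ψ ψs) (hμ : ∀ x, μ x ∈ R.deg 0) :
    brstCharge b μ ψ ψs ∈ (C.tensor R).deg 1 :=
  add_mem (linearCharge_mem b hψ hμ) (Submodule.smul_mem _ _ (tmul_cubicCharge_mem b hψ))

theorem d_brstCharge (hψ : IsGhostSystem C ψ ψs) (hR : R.IsDGPoisson) (hC : ∀ c, C.d c = 0)
    (hμd : ∀ x, R.d (μ x) = 0) : (C.tensor R).d (brstCharge b μ ψ ψs) = 0 := by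
  have h : ∀ i, ∀ c ∈ C.deg i, ∀ r, R.d r = 0 → (C.tensor R).d (C.tmul R c r) = 0 := by
    intro i c hc r hr
    rw [PrePoisson.tensor_d_tmul hc, hC, hr]
    simp
  rw [brstCharge, linearCharge, map_add, map_sum, map_smul, h _ _ (cubicCharge_mem b hψ) _ hR.d_one,
    smul_zero, add_zero]
  exact Finset.sum_eq_zero fun i _ => h _ _ (hψ.mem_dual _) _ (hμd _)

/-- The `ψ*` brackets vanish, so only the brackets of the `μ(xᵢ)` remain; as these have degree `0`,
no Koszul sign enters. -/
theorem bracket_linearCharge_self (hψ : IsGhostSystem C ψ ψs)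
    (hμ : ∀ x, μ x ∈ R.deg 0) (hμb : ∀ x y, R.bracket (μ x) (μ y) = μ ⁅x, y⁆) :
    (C.tensor R).bracket (linearCharge b μ ψs) (linearCharge b μ ψs) =
      ∑ i, ∑ j, C.tmul R (ψs (b.coord i) * ψs (b.coord j)) (μ ⁅b i, b j⁆) := by
  simp only [linearCharge, map_sum, LinearMap.sum_apply]
  rw [Finset.sum_comm]
  refine Finset.sum_congr rfl fun i _ => Finset.sum_congr rfl fun j _ => ?_
  rw [PrePoisson.tensor_bracket_tmul _ (hμ _) (hψ.mem_dual _), hψ.bracket_dual_dual, hμb]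
  simp

/-- This is the negative of the bracket of the linear term with itself, which is what the
coefficient `1/2` in the charge is made for. -/
theorem bracket_cubicCharge_linearCharge (hψ : IsGhostSystem C ψ ψs) (hC : C.IsSkewBiderivation)
    (hR : R.IsSkewBiderivation) :
    (C.tensor R).bracket (C.tmul R (cubicCharge b ψ ψs) 1) (linearCharge b μ ψs) =
      -∑ i, ∑ j, C.tmul R (ψs (b.coord i) * ψs (b.coord j)) (μ ⁅b i, b j⁆) := by
  refine Eq.trans ?_ (sum_bracket_cubicCharge_dual b hψ hC ((C.tmul R).compl₂ μ))
  rw [linearCharge, map_sum]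
  refine Finset.sum_congr rfl fun i _ => ?_
  rw [PrePoisson.tensor_bracket_tmul _ SetLike.GradedOne.one_mem (hψ.mem_dual _), hR.one_bracket]
  simp

/-- The classical master equation. -/
theorem bracket_brstCharge_self (hψ : IsGhostSystem C ψ ψs) (hC : C.IsDGPoisson)
    (hR : R.IsDGPoisson) (hμ : ∀ x, μ x ∈ R.deg 0)
    (hμb : ∀ x y, R.bracket (μ x) (μ y) = μ ⁅x, y⁆) :
    (C.tensor R).bracket (brstCharge b μ ψ ψs) (brstCharge b μ ψ ψs) = 0 := by
  have hX := (hC.tensor hR).isSkewBiderivation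
  have hC' := hC.isSkewBiderivation
  have hR' := hR.isSkewBiderivation
  have e1 := bracket_linearCharge_self b hψ hμ hμb
  have e2 := bracket_cubicCharge_linearCharge (μ := μ) b hψ hC' hR'
  have e3 := hX.bracket_comm_odd (linearCharge_mem b hψ hμ) (tmul_cubicCharge_mem b hψ)
    odd_one odd_one
  have e4 : (C.tensor R).bracket (C.tmul R (cubicCharge b ψ ψs) 1)
      (C.tmul R (cubicCharge b ψ ψs) 1) = 0 := by
    rw [PrePoisson.tensor_bracket_tmul _ SetLike.GradedOne.one_mem (cubicCharge_mem b hψ),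
      hR'.one_bracket, bracket_cubicCharge_self b hψ hC']
    simp
  -- With `L` the linear and `C` the cubic term, `{Q, Q} = {L, L} + {C, L} + (1/4) {C, C}`. The
  -- first two terms cancel and the last is zero.
  simp only [brstCharge, map_add, map_smul, LinearMap.add_apply, LinearMap.smul_apply, e1, e3, e2,
    e4]
  module

end

/-! ### The classical BRST complex. -/

section

variable (g : Type u) [LieRing g] [LieAlgebra ℂ g] [FiniteDimensional ℂ g]

/-- The generators `ψ(x)` of `cCl g`. -/
def ghost : g →ₗ[ℂ] (cCl g).carrier :=
  ExteriorAlgebra.ι ℂ ∘ₗ LinearMap.inl ℂ g (Module.Dual ℂ g)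

/-- The generators `ψ*(f)` of `cCl g`. -/
def ghostDual : Module.Dual ℂ g →ₗ[ℂ] (cCl g).carrier :=
  ExteriorAlgebra.ι ℂ ∘ₗ LinearMap.inr ℂ g (Module.Dual ℂ g)

theorem cCl_isGhostSystem : IsGhostSystem (cCl g) (ghost g) (ghostDual g) where
  mem x := ι_inl_mem_extDeg x
  mem_dual f := ι_inr_mem_extDeg f
  bracket_self x y := by
    refine (cliffordBracket_ι_ι (x, 0) (y, 0)).trans ?_
    simp
    rfl
  bracket_dual x f := by
    refine (cliffordBracket_ι_ι (x, 0) (0, f)).trans ?_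
    simp [Algebra.algebraMap_eq_smul_one]
    rfl
  bracket_dual_dual f h := by
    refine (cliffordBracket_ι_ι (0, f) (0, h)).trans ?_
    simp
    rfl

/-- Exhibits the complex as a twist of the tensor product; beyond moving the double sum inside the
tensor, the two sides agree by definition. -/
theorem cBRST_eq (R : PrePoisson.{v}) (μ : g →ₗ[ℂ] R.carrier) :
    cBRST g R μ = { (cCl g).tensor R with
      d := ((cCl g).tensor R).d + ((cCl g).tensor R).bracket
        (brstCharge (Module.finBasis ℂ g) μ (ghost g) (ghostDual g)) } := by
  have e : (brstCharge (Module.finBasis ℂ g) μ (ghost g) (ghostDual g)) =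
    linearCharge (Module.finBasis ℂ g) μ (ghostDual g) + (2⁻¹ : ℂ) • ∑ i, ∑ j,
      (cCl g).tmul R (ghostDual g ((Module.finBasis ℂ g).coord i) *
        (ghost g ⁅Module.finBasis ℂ g i, Module.finBasis ℂ g j⁆ *
          ghostDual g ((Module.finBasis ℂ g).coord j))) 1 := by
    simp only [brstCharge, cubicCharge, map_sum, LinearMap.sum_apply]
  rw [e]
  rfl

variable {g}

theorem cBRST_isDGPoisson {R : PrePoisson.{v}} (hR : R.IsDGPoisson) {μ : g →ₗ[ℂ] R.carrier}
    (hμ : ∀ x, μ x ∈ R.deg 0) (hμd : ∀ x, R.d (μ x) = 0)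
    (hμb : ∀ x y, R.bracket (μ x) (μ y) = μ ⁅x, y⁆) : (cBRST g R μ).IsDGPoisson := by
  rw [cBRST_eq]
  exact (cCl_isDGPoisson.tensor hR).twist (brstCharge_mem _ (cCl_isGhostSystem g) hμ)
    (d_brstCharge _ (cCl_isGhostSystem g) hR (fun _ => rfl) hμd)
    (bracket_brstCharge_self _ (cCl_isGhostSystem g) cCl_isDGPoisson hR hμ hμb)

end

/-! ### The associated dg Poisson algebra of a dg vertex Poisson algebra -/

section

variable {P : PreVertexPoisson.{u}}

theorem assocMk_T (a : P.carrier) : assocMk P (P.T a) = 0 :=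
  (assocMk_eq_zero P).2 ((assocIdeal_spec P).T_mem a)

/-- In the skew-symmetry formula for `a₍₀₎ b` all terms with `k ≥ 1` lie in the image of `T`. -/
theorem assocMk_skew (hP : P.IsDGVertexPoisson) {i j : ℤ} {a b : P.carrier} (ha : a ∈ P.deg i)
    (hb : b ∈ P.deg j) :
    assocMk P (P.Y a b 0) = (1 + i * j).negOnePow • assocMk P (P.Y b a 0) := by
  have e : P.Y a b 0 = ∑ᶠ k : ℕ, (i * j + (0 : ℕ) + k + 1).negOnePow •
    ((k.factorial : ℂ)⁻¹ • (P.T ^ k) (P.Y b a (0 + k))) := hP.vertexLie.skew i j a ha b hb 0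
  -- The finsum is cut to a finite sum so that `assocMk` passes through it; `0` is inserted because
  -- `b₍₀₎ a` may vanish.
  rw [e, finsum_eq_sum_of_support_subset (s := insert 0 (P.Y b a).support), map_sum,
    Finset.sum_eq_single 0]
  · simp [Units.smul_def, add_comm]
  · intro k _ hk
    obtain ⟨k, rfl⟩ := Nat.exists_eq_succ_of_ne_zero hk
    rw [Units.smul_def, map_zsmul, map_smul, pow_succ', Module.End.mul_apply, assocMk_T, smul_zero,
      smul_zero]
  · simp
  · intro k hk
    simp only [Finset.coe_insert, Set.mem_insert_iff, Finset.mem_coe, Finsupp.mem_support_iff]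
    refine Or.inr fun h => hk ?_
    simp [h]

/-- Each bracket axiom is the image of a vertex axiom at `n = 0`. In particular the commutator
formula at `m = n = 0` is the Jacobi identity in derivation form. -/
theorem assocPoisson_isDGPoisson (hP : P.IsDGVertexPoisson) : (assocPoisson P).IsDGPoisson := by
  have sm : ∀ (c : ℤˣ) a, assocMk P (c • a) = c • assocMk P a := fun c a => by
    rw [Units.smul_def, map_zsmul, Units.smul_def]
  have hb : (assocPoisson P).IsSkewBiderivation := {
    mul_comm := by
      rintro i j _ ⟨a, ha, rfl⟩ _ ⟨b, hb, rfl⟩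
      have := congrArg (assocMk P) (hP.mul_comm i j a ha b hb)
      rwa [sm, map_mul (assocMk P), map_mul (assocMk P)] at this
    bracket_mem := by
      rintro i j _ ⟨a, ha, rfl⟩ _ ⟨b, hb, rfl⟩
      exact ⟨_, hP.vertexLie.Y_mem i j a ha b hb 0, rfl⟩
    skew := by
      rintro i j _ ⟨a, ha, rfl⟩ _ ⟨b, hb, rfl⟩
      exact assocMk_skew hP ha hb
    bracket_mul := by
      rintro i j _ ⟨a, ha, rfl⟩ _ ⟨b, hb, rfl⟩ c
      obtain ⟨c, rfl⟩ := assocMk_surjective P c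
      have := congrArg (assocMk P) (hP.Y_mul i j a ha b hb c 0)
      rwa [map_add, sm, map_mul (assocMk P), map_mul (assocMk P)] at this }
  exact {
    mul_comm := hb.mul_comm
    d_mem := by
      rintro i _ ⟨a, ha, rfl⟩
      exact ⟨_, hP.d_mem i a ha, rfl⟩
    d_d := fun a => by
      obtain ⟨a, rfl⟩ := assocMk_surjective P a
      exact (congrArg (assocMk P) (hP.d_d a)).trans (map_zero _)
    d_mul := by
      rintro i _ ⟨a, ha, rfl⟩ b
      obtain ⟨b, rfl⟩ := assocMk_surjective P b
      have := congrArg (assocMk P) (hP.d_mul i a ha b)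
      rwa [map_add, sm, map_mul (assocMk P), map_mul (assocMk P)] at this
    bracket_mem := hb.bracket_mem
    skew := hb.skew
    jacobi := by
      intro i j k x hx y hy z hz
      rw [hb.cyclic_eq_zero_iff hx hy hz]
      obtain ⟨a, ha, rfl⟩ := hx
      obtain ⟨b, hb, rfl⟩ := hy
      obtain ⟨c, hc, rfl⟩ := hz
      have e : P.Y a (P.Y b c 0) 0 - (i * j).negOnePow • P.Y b (P.Y a c 0) 0 =
        ∑ k ∈ Finset.range (0 + 1), (Nat.choose 0 k : ℂ) • P.Y (P.Y a b k) c (0 + 0 - k) :=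
        hP.vertexLie.commutator i j a ha b hb c 0 0
      have := congrArg (assocMk P) (sub_eq_iff_eq_add.1 e)
      simp only [map_add, sm, zero_add, Finset.sum_range_one, Nat.choose_self, Nat.cast_one,
        one_smul, Nat.sub_zero] at this
      exact this
    d_bracket := by
      rintro i _ ⟨a, ha, rfl⟩ b
      obtain ⟨b, rfl⟩ := assocMk_surjective P b
      have e : P.d (P.Y a b 0) = P.Y (P.d a) b 0 + i.negOnePow • P.Y a (P.d b) 0 :=
        hP.vertexLie.d_Y i a ha b 0
      have := congrArg (assocMk P) e
      rwa [map_add, sm] at this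
    leibniz := fun i j k a ha b hb' c hc => hb.leibniz ha hb' hc }

end

/-! ### Maps of graded algebras -/

section

variable {A : PreDGAlg.{u}} {B : PreDGAlg.{v}}

theorem PreDGAlg.map_decompose {f : A.carrier →ₗ[ℂ] B.carrier}
    (hf : ∀ i, ∀ a ∈ A.deg i, f a ∈ B.deg i) (i : ℤ) (a : A.carrier) :
    f (DirectSum.decompose A.deg a i) = DirectSum.decompose B.deg (f a) i := by
  induction a using A.homogeneous_induction with
  | hadd x y hx hy => simp [DirectSum.decompose_add, hx, hy]
  | h j a ha =>
    by_cases h : j = i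
    · subst h
      rw [DirectSum.decompose_of_mem_same _ ha, DirectSum.decompose_of_mem_same _ (hf _ _ ha)]
    · rw [DirectSum.decompose_of_mem_ne _ ha h, DirectSum.decompose_of_mem_ne _ (hf _ _ ha) h,
        map_zero]

/-- The element and its component of degree `i` have the same image, hence coincide. -/
theorem PreDGAlg.mem_deg_of_map_mem {f : A.carrier →ₗ[ℂ] B.carrier}
    (hf : ∀ i, ∀ a ∈ A.deg i, f a ∈ B.deg i) (hinj : Function.Injective f) {i : ℤ} {a : A.carrier}
    (ha : f a ∈ B.deg i) : a ∈ A.deg i := by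
  have h := PreDGAlg.map_decompose hf i a
  rw [DirectSum.decompose_of_mem_same _ ha] at h
  rw [← hinj h]
  exact SetLike.coe_mem _

variable {A' : PreDGAlg.{u₁}} {B' : PreDGAlg.{u₂}}

/-- The tensor product of two maps of graded algebras. -/
def PreDGAlg.tensorHom (f : A.carrier →ₐ[ℂ] A'.carrier) (g : B.carrier →ₐ[ℂ] B'.carrier)
    (hf : ∀ i, ∀ a ∈ A.deg i, f a ∈ A'.deg i) (hg : ∀ i, ∀ b ∈ B.deg i, g b ∈ B'.deg i) :
    (A.tensor B).carrier →ₐ[ℂ] (A'.tensor B').carrier :=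
  GradedTensorProduct.lift A.deg B.deg
    ((GradedTensorProduct.includeLeft A'.deg B'.deg).comp f)
    ((GradedTensorProduct.includeRight A'.deg B'.deg).comp g) (by
      rintro i j ⟨a, ha⟩ ⟨b, hb⟩
      have h1 : A'.tmul B' (f a) 1 * A'.tmul B' 1 (g b) = A'.tmul B' (f a) (g b) := by
        rw [PreDGAlg.tmul_one_mul, mul_one]
      have h2 : A'.tmul B' 1 (g b) * A'.tmul B' (f a) 1 =
          (j * i).negOnePow • A'.tmul B' (f a) (g b) := by
        rw [PreDGAlg.tmul_mul_tmul _ (hg _ _ hb) (hf _ _ ha), one_mul, mul_one]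
      have h3 : A'.tmul B' (f a) 1 * A'.tmul B' 1 (g b) =
          (j * i).negOnePow • (A'.tmul B' 1 (g b) * A'.tmul B' (f a) 1) := by
        rw [h1, h2, smul_smul, Int.units_mul_self, one_smul]
      exact h3)

section

variable {f : A.carrier →ₐ[ℂ] A'.carrier} {g : B.carrier →ₐ[ℂ] B'.carrier}
  {hf : ∀ i, ∀ a ∈ A.deg i, f a ∈ A'.deg i} {hg : ∀ i, ∀ b ∈ B.deg i, g b ∈ B'.deg i}

theorem PreDGAlg.tensorHom_tmul (a : A.carrier) (b : B.carrier) :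
    PreDGAlg.tensorHom f g hf hg (A.tmul B a b) = A'.tmul B' (f a) (g b) := by
  have h1 : A'.tmul B' (f a) 1 * A'.tmul B' 1 (g b) = A'.tmul B' (f a) (g b) := by
    rw [PreDGAlg.tmul_one_mul, mul_one]
  exact h1

theorem PreDGAlg.tensorHom_surjective (hfs : Function.Surjective f)
    (hgs : Function.Surjective g) : Function.Surjective (PreDGAlg.tensorHom f g hf hg) := by
  intro y
  induction y using PreDGAlg.tensor_induction with
  | hadd x y hx hy =>
    obtain ⟨x, rfl⟩ := hx
    obtain ⟨y, rfl⟩ := hy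
    exact ⟨x + y, map_add _ _ _⟩
  | h a b =>
    obtain ⟨a, rfl⟩ := hfs a
    obtain ⟨b, rfl⟩ := hgs b
    exact ⟨A.tmul B a b, PreDGAlg.tensorHom_tmul a b⟩

/-- The kernel of a tensor product of surjections is spanned by the `k ⊗ b` and `a ⊗ k` with `k`
in the kernels of the factors. -/
theorem PreDGAlg.tensorHom_ker_induction (hfs : Function.Surjective f)
    (hgs : Function.Surjective g) {p : (A.tensor B).carrier → Prop}
    (hadd : ∀ x y, p x → p y → p (x + y)) (hl : ∀ a b, f a = 0 → p (A.tmul B a b))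
    (hr : ∀ a b, g b = 0 → p (A.tmul B a b)) {x : (A.tensor B).carrier}
    (hx : PreDGAlg.tensorHom f g hf hg x = 0) : p x := by
  have e : (PreDGAlg.tensorHom f g hf hg).toLinearMap ∘ₗ
      (GradedTensorProduct.of ℂ A.deg B.deg).toLinearMap =
      (GradedTensorProduct.of ℂ A'.deg B'.deg).toLinearMap ∘ₗ
        TensorProduct.map f.toLinearMap g.toLinearMap :=
    TensorProduct.ext' fun a b => PreDGAlg.tensorHom_tmul (hf := hf) (hg := hg) a b
  obtain ⟨x, rfl⟩ := (GradedTensorProduct.of ℂ A.deg B.deg).surjective x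
  have hx' : x ∈ LinearMap.ker (TensorProduct.map f.toLinearMap g.toLinearMap) :=
    (LinearMap.congr_fun e x).symm.trans hx
  clear hx e
  -- Right exactness: the kernel is the sum of the images of `A ⊗ ker g` and `ker f ⊗ B`.
  rw [TensorProduct.map_ker (LinearMap.exact_subtype_ker_map f.toLinearMap) hfs
    (LinearMap.exact_subtype_ker_map g.toLinearMap) hgs] at hx'
  obtain ⟨_, ⟨y, rfl⟩, _, ⟨z, rfl⟩, rfl⟩ := Submodule.mem_sup.1 hx'
  clear hx'
  rw [map_add]
  refine hadd _ _ ?_ ?_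
  · induction y with
    | zero =>
      have := hr 0 0 (map_zero g)
      rw [map_zero] at this
      rwa [map_zero, map_zero]
    | add x y hx hy =>
      rw [map_add, map_add]
      exact hadd _ _ hx hy
    | tmul a b => exact hr a b b.2
  · induction z with
    | zero =>
      have := hr 0 0 (map_zero g)
      rw [map_zero] at this
      rwa [map_zero, map_zero]
    | add x y hx hy =>
      rw [map_add, map_add]
      exact hadd _ _ hx hy
    | tmul a b => exact hl a b a.2

end

end

/-! ### Quotients of vertex Poisson algebras by the ideal generated by the image of `T` -/

/-- `π` identifies `R` with the quotient of `P` by the ideal generated by the image of `T`, with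
the bracket induced by the zeroth product. -/
structure IsAssocQuotient (P : PreVertexPoisson.{u}) (R : PrePoisson.{v})
    (π : P.carrier →ₐ[ℂ] R.carrier) : Prop where
  surjective : Function.Surjective π
  map_deg : ∀ i, ∀ a ∈ P.deg i, π a ∈ R.deg i
  map_T : ∀ a, π (P.T a) = 0
  map_d : ∀ a, π (P.d a) = R.d (π a)
  map_Y : ∀ a b, π (P.Y a b 0) = R.bracket (π a) (π b)
  T_one : P.T 1 = 0
  ker_le : ∀ a, π a = 0 → a ∈ Ideal.span (Set.range P.T)

section

variable {P : PreVertexPoisson.{u}} {R : PrePoisson.{v}} {π : P.carrier →ₐ[ℂ] R.carrier}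

theorem assocMk_isAssocQuotient (hP : P.IsDGVertexPoisson) :
    IsAssocQuotient P (assocPoisson P) (assocMk P) where
  surjective := assocMk_surjective P
  map_deg _ a ha := ⟨a, ha, rfl⟩
  map_T := assocMk_T
  map_d _ := rfl
  map_Y _ _ := rfl
  T_one := by simpa using hP.T_mul 1 1
  ker_le a ha := by
    rw [← assocIdeal_eq_span P hP]
    exact (assocMk_eq_zero P).1 ha

/-- The kernel of `π` is an `IsAssocIdeal`, so it contains `assocIdeal P`. It lies in the ideal
generated by the image of `T`, which is contained in `assocIdeal P`. No vertex Poisson axiom of `P`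
enters. -/
theorem IsAssocQuotient.mem_assocIdeal_iff (h : IsAssocQuotient P R π) (a : P.carrier) :
    a ∈ assocIdeal P ↔ π a = 0 := by
  refine ⟨fun ha => ?_, fun ha => ?_⟩
  · have hI : IsAssocIdeal P (RingHom.ker π) := {
      T_mem := h.map_T
      mul_mem_right := fun a ha b => by
        rw [RingHom.mem_ker] at ha ⊢
        rw [map_mul, ha, zero_mul]
      d_mem := fun a ha => by
        rw [RingHom.mem_ker] at ha ⊢
        rw [h.map_d, ha, map_zero]
      proj_mem := fun a ha i => by
        rw [RingHom.mem_ker] at ha ⊢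
        have e := PreDGAlg.map_decompose (f := π.toLinearMap) h.map_deg i a
        rw [AlgHom.toLinearMap_apply, AlgHom.toLinearMap_apply, ha] at e
        simpa using e
      Y_left_mem := fun a ha b => by
        rw [RingHom.mem_ker] at ha ⊢
        rw [h.map_Y, ha, map_zero, LinearMap.zero_apply]
      Y_right_mem := fun a ha b => by
        rw [RingHom.mem_ker] at ha ⊢
        rw [h.map_Y, ha, map_zero] }
    exact (sInf_le hI : assocIdeal P ≤ RingHom.ker π) ha
  · refine (Ideal.span_le.2 ?_ : Ideal.span (Set.range P.T) ≤ assocIdeal P) (h.ker_le a ha)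
    rintro _ ⟨x, rfl⟩
    exact (assocIdeal_spec P).T_mem x

theorem IsAssocQuotient.nonempty_iso (h : IsAssocQuotient P R π) :
    Nonempty ((assocPoisson P).Iso R) := by
  let f : P.carrier ⧸ assocIdeal P →ₐ[ℂ] R.carrier :=
    Ideal.Quotient.liftₐ (assocIdeal P) π fun a ha => (h.mem_assocIdeal_iff a).1 ha
  have hf : ∀ a, f (assocMk P a) = π a := fun a => rfl
  have hinj : Function.Injective f := by
    rw [injective_iff_map_eq_zero]
    intro x hx
    obtain ⟨a, rfl⟩ := assocMk_surjective P x
    exact (assocMk_eq_zero P).2 ((h.mem_assocIdeal_iff a).2 hx)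
  have hsurj : Function.Surjective f := fun y => by
    obtain ⟨a, rfl⟩ := h.surjective y
    exact ⟨assocMk P a, hf a⟩
  have hdeg : ∀ i, ∀ a ∈ (assocPoisson P).deg i, f a ∈ R.deg i := by
    rintro i _ ⟨a, ha, rfl⟩
    exact h.map_deg i a ha
  exact ⟨{
    AlgEquiv.ofBijective f ⟨hinj, hsurj⟩ with
    map_deg := fun i a => ⟨fun ha => PreDGAlg.mem_deg_of_map_mem (A := (assocPoisson P).toPreDGAlg)
      (f := f.toLinearMap) hdeg hinj ha, hdeg i a⟩
    map_d := fun a => by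
      obtain ⟨a, rfl⟩ := assocMk_surjective P a
      exact h.map_d a
    map_bracket := fun a b => by
      obtain ⟨a, rfl⟩ := assocMk_surjective P a
      obtain ⟨b, rfl⟩ := assocMk_surjective P b
      exact h.map_Y a b }⟩

/-- The sign `(-1)^(n+1)` of the opposite vertex algebra is `-1` at `n = 0`, which matches the sign
of the opposite bracket. -/
theorem lsum_sign_apply_zero {W : Type*} [AddCommGroup W] [Module ℂ W] (f : ℕ →₀ W) :
    (Finsupp.lsum ℂ fun n : ℕ => (-1 : ℂ) ^ (n + 1) •
      (Finsupp.lsingle n : W →ₗ[ℂ] ℕ →₀ W) : (ℕ →₀ W) →ₗ[ℂ] ℕ →₀ W) f 0 = -f 0 := by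
  induction f using Finsupp.induction_linear with
  | zero => simp
  | add f g hf hg => rw [map_add, Finsupp.add_apply, hf, hg, Finsupp.add_apply, neg_add]
  | single n x =>
    rcases eq_or_ne n 0 with rfl | hn
    · simp
    · simp [Finsupp.single_eq_of_ne hn.symm]

theorem IsAssocQuotient.op (h : IsAssocQuotient P R π) : IsAssocQuotient P.op R.op π where
  surjective := h.surjective
  map_deg := h.map_deg
  map_T := fun (a : P.carrier) => by
    have e : π (-P.T a) = 0 := by rw [map_neg, h.map_T, neg_zero]
    exact e
  map_d := h.map_d
  map_Y := fun (a b : P.carrier) => by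
    refine (congrArg π (lsum_sign_apply_zero _)).trans ?_
    have e : π (-P.Y a b 0) = -R.bracket (π a) (π b) := by rw [map_neg, h.map_Y]
    exact e
  T_one := by
    have e : -P.T 1 = 0 := by rw [h.T_one, neg_zero]
    exact e
  ker_le a ha := by
    have e : Ideal.span (Set.range P.T) ≤ Ideal.span (Set.range (-P.T)) := by
      rw [Ideal.span_le]
      rintro _ ⟨x, rfl⟩
      have : P.T x = (-P.T) (-x) := by simp
      rw [this]
      exact Ideal.subset_span ⟨_, rfl⟩
    exact e (h.ker_le a ha)

/-- `T`, the products and the kernel are untouched, and `map_Y` sends the operator `Q₍₀₎` to `{Q',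
-}`. -/
theorem IsAssocQuotient.twist (h : IsAssocQuotient P R π) {Q : P.carrier} {Q' : R.carrier}
    (hQ : π Q = Q') :
    IsAssocQuotient { P with d := P.d + Finsupp.lapply 0 ∘ₗ P.Y Q }
      { R with d := R.d + R.bracket Q' } π where
  surjective := h.surjective
  map_deg := h.map_deg
  map_T := h.map_T
  map_d a := by
    have e : π (P.d a + P.Y Q a 0) = R.d (π a) + R.bracket Q' (π a) := by
      rw [map_add, h.map_d, h.map_Y, hQ]
    exact e
  map_Y := h.map_Y
  T_one := h.T_one
  ker_le := h.ker_le

end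

/-! ### Associated quotients of tensor products. -/

section

variable {P : PreVertexPoisson.{u}} {Q : PreVertexPoisson.{v}}

variable (P Q) in
/-- The bilinear map `(a, b) ↦ a ⊗ b`. -/
def PreVertexPoisson.tmul : P.carrier →ₗ[ℂ] Q.carrier →ₗ[ℂ] (P.tensor Q).carrier :=
  P.toPreDGAlg.tmul Q.toPreDGAlg

theorem PreVertexPoisson.tmul_one_mul (a a' : P.carrier) (b : Q.carrier) :
    P.tmul Q a 1 * P.tmul Q a' b = P.tmul Q (a * a') b := PreDGAlg.tmul_one_mul a a' b

theorem PreVertexPoisson.mul_one_tmul (a : P.carrier) (b b' : Q.carrier) :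
    P.tmul Q a b * P.tmul Q 1 b' = P.tmul Q a (b * b') := PreDGAlg.mul_one_tmul a b b'

theorem PreVertexPoisson.tensor_d_tmul {i : ℤ} {a : P.carrier} (ha : a ∈ P.deg i)
    (b : Q.carrier) :
    (P.tensor Q).d (P.tmul Q a b) = P.tmul Q (P.d a) b + i.negOnePow • P.tmul Q a (Q.d b) :=
  PreDGAlg.tensor_d_tmul ha b

theorem PreVertexPoisson.tensor_T_tmul (a : P.carrier) (b : Q.carrier) :
    (P.tensor Q).T (P.tmul Q a b) = P.tmul Q (P.T a) b + P.tmul Q a (Q.T b) := rfl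

theorem PreVertexPoisson.tensor_induction {p : (P.tensor Q).carrier → Prop}
    (hadd : ∀ x y, p x → p y → p (x + y)) (h : ∀ a b, p (P.tmul Q a b)) (x) : p x :=
  PreDGAlg.tensor_induction hadd h x

/-- The coefficient at `0` collects the terms with `m = j`, and `F` annihilates those with `j ≠ 0`.
-/
theorem map_lsum_apply_zero {X Z W : Type*} [AddCommGroup X] [Module ℂ X] [AddCommGroup Z]
    [Module ℂ Z] [AddCommGroup W] [Module ℂ W] (G : ℕ → X →ₗ[ℂ] Z) (F : Z →ₗ[ℂ] W)
    (hF : ∀ j, j ≠ 0 → F ∘ₗ G j = 0) (f : ℕ →₀ X) :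
    F ((Finsupp.lsum ℂ fun m : ℕ => ∑ j ∈ Finset.range (m + 1),
      Finsupp.lsingle (m - j) ∘ₗ G j) f 0) = F (G 0 (f 0)) := by
  induction f using Finsupp.induction_linear with
  | zero => simp
  | add f g hf hg => simp only [map_add, Finsupp.add_apply, hf, hg]
  | single n x =>
    have hF' : ∀ j, j ≠ 0 → F (G j x) = 0 := fun j hj => LinearMap.congr_fun (hF j hj) x
    rw [Finsupp.lsum_single, LinearMap.sum_apply, Finsupp.finsetSum_apply, map_sum,
      Finset.sum_eq_single 0]
    · simp only [LinearMap.comp_apply, Nat.sub_zero, Finsupp.lsingle_apply]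
      rcases eq_or_ne n 0 with rfl | hn
      · simp
      · simp [Finsupp.single_eq_of_ne hn.symm]
    · intro j _ hj
      simp only [LinearMap.comp_apply, Finsupp.lsingle_apply, Finsupp.single_apply]
      split_ifs
      · exact hF' j hj
      · exact map_zero F
    · simp

/-- In the formula for the zeroth product the terms with `j ≥ 1` contain `T ^ j` of a factor, so a
map killing such tensors sees only `j = 0`. What remains has the shape of the tensor product
bracket. -/
theorem map_tensor_Y {W : Type*} [AddCommGroup W] [Module ℂ W]
    (F : (P.tensor Q).carrier →ₗ[ℂ] W)
    (hl : ∀ a a' b, F (P.tmul Q (P.T a * a') b) = 0)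
    (hr : ∀ a b b', F (P.tmul Q a (Q.T b * b')) = 0) {i j : ℤ}
    (a : P.carrier) {b : Q.carrier} (hb : b ∈ Q.deg i) {a' : P.carrier} (ha' : a' ∈ P.deg j)
    (b' : Q.carrier) :
    F ((P.tensor Q).Y (P.tmul Q a b) (P.tmul Q a' b') 0) =
      (i * j).negOnePow • (F (P.tmul Q (a * a') (Q.Y b b' 0)) +
        F (P.tmul Q (P.Y a a' 0) (b * b'))) := by
  let G₁ : ℕ → (P.carrier ⊗[ℂ] P.carrier) ⊗[ℂ] Q.carrier →ₗ[ℂ]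
      (P.tensor Q).carrier := fun j => (j.factorial : ℂ)⁻¹ •
    ((GradedTensorProduct.of ℂ P.deg Q.deg).toLinearMap ∘ₗ
      (LinearMap.mul' ℂ P.carrier ∘ₗ (P.T ^ j).rTensor P.carrier).rTensor Q.carrier)
  let G₂ : ℕ → P.carrier ⊗[ℂ] (Q.carrier ⊗[ℂ] Q.carrier) →ₗ[ℂ]
      (P.tensor Q).carrier := fun j => (j.factorial : ℂ)⁻¹ •
    ((GradedTensorProduct.of ℂ P.deg Q.deg).toLinearMap ∘ₗ
      (LinearMap.mul' ℂ Q.carrier ∘ₗ (Q.T ^ j).rTensor Q.carrier).lTensor P.carrier)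
  let L : (P.carrier ⊗[ℂ] P.carrier) ⊗[ℂ] (Q.carrier ⊗[ℂ] Q.carrier) →ₗ[ℂ]
      (P.tensor Q).carrier :=
    Finsupp.lapply 0 ∘ₗ
      ((Finsupp.lsum ℂ fun m : ℕ => ∑ j ∈ Finset.range (m + 1), Finsupp.lsingle (m - j) ∘ₗ G₁ j) ∘ₗ
        (TensorProduct.finsuppRight ℂ ℂ (P.carrier ⊗[ℂ] P.carrier) Q.carrier ℕ).toLinearMap ∘ₗ
        (TensorProduct.lift Q.Y).lTensor (P.carrier ⊗[ℂ] P.carrier) +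
      (Finsupp.lsum ℂ fun m : ℕ => ∑ j ∈ Finset.range (m + 1), Finsupp.lsingle (m - j) ∘ₗ G₂ j) ∘ₗ
        (TensorProduct.finsuppLeft ℂ ℂ P.carrier (Q.carrier ⊗[ℂ] Q.carrier) ℕ).toLinearMap ∘ₗ
        (TensorProduct.lift P.Y).rTensor (Q.carrier ⊗[ℂ] Q.carrier))
  have h : (P.tensor Q).Y (P.tmul Q a b) (P.tmul Q a' b') 0 =
      L (shuffle P.deg Q.deg (GradedTensorProduct.tmul ℂ a b ⊗ₜ[ℂ]
        GradedTensorProduct.tmul ℂ a' b')) := rfl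
  rw [h, shuffle_tmul P.deg Q.deg a hb ha' b', LinearMap.map_smul_of_tower,
    LinearMap.map_smul_of_tower]
  congr 1
  have h1 : ∀ j, j ≠ 0 → F ∘ₗ G₁ j = 0 := by
    intro j hj
    obtain ⟨j, rfl⟩ := Nat.exists_eq_succ_of_ne_zero hj
    refine TensorProduct.ext_threefold fun x y z => ?_
    have e : F (G₁ (j + 1) ((x ⊗ₜ y) ⊗ₜ z)) = ((j + 1).factorial : ℂ)⁻¹ •
        F (P.tmul Q ((P.T ^ (j + 1)) x * y) z) := by
      rw [← map_smul]
      rfl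
    refine e.trans ?_
    rw [pow_succ', Module.End.mul_apply, hl, smul_zero]
    rfl
  have h2 : ∀ j, j ≠ 0 → F ∘ₗ G₂ j = 0 := by
    intro j hj
    obtain ⟨j, rfl⟩ := Nat.exists_eq_succ_of_ne_zero hj
    refine TensorProduct.ext' fun x t => ?_
    induction t with
    | zero => rw [TensorProduct.tmul_zero, map_zero, map_zero]
    | add t t' ht ht' => rw [TensorProduct.tmul_add, map_add, map_add, ht, ht']
    | tmul y z =>
      have e : F (G₂ (j + 1) (x ⊗ₜ (y ⊗ₜ z))) = ((j + 1).factorial : ℂ)⁻¹ •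
          F (P.tmul Q x ((Q.T ^ (j + 1)) y * z)) := by
        rw [← map_smul]
        rfl
      refine e.trans ?_
      rw [pow_succ', Module.End.mul_apply, hr, smul_zero]
      rfl
  have e1 := map_lsum_apply_zero G₁ F h1
    (TensorProduct.finsuppRight ℂ ℂ (P.carrier ⊗[ℂ] P.carrier) Q.carrier ℕ
      ((a ⊗ₜ a') ⊗ₜ Q.Y b b'))
  have e2 := map_lsum_apply_zero G₂ F h2
    (TensorProduct.finsuppLeft ℂ ℂ P.carrier (Q.carrier ⊗[ℂ] Q.carrier) ℕ
      (P.Y a a' ⊗ₜ (b ⊗ₜ b')))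
  rw [TensorProduct.finsuppRight_apply_tmul_apply] at e1
  rw [TensorProduct.finsuppLeft_apply_tmul_apply] at e2
  have e3 : F (G₁ 0 ((a ⊗ₜ a') ⊗ₜ Q.Y b b' 0)) =
      F (P.tmul Q (a * a') (Q.Y b b' 0)) := by
    have : F (G₁ 0 ((a ⊗ₜ a') ⊗ₜ Q.Y b b' 0)) = (Nat.factorial 0 : ℂ)⁻¹ •
      F (P.tmul Q (a * a') (Q.Y b b' 0)) := by
      rw [← map_smul]
      rfl
    simpa using this
  have e4 : F (G₂ 0 (P.Y a a' 0 ⊗ₜ (b ⊗ₜ b'))) =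
      F (P.tmul Q (P.Y a a' 0) (b * b')) := by
    have : F (G₂ 0 (P.Y a a' 0 ⊗ₜ (b ⊗ₜ b'))) = (Nat.factorial 0 : ℂ)⁻¹ •
      F (P.tmul Q (P.Y a a' 0) (b * b')) := by
      rw [← map_smul]
      rfl
    simpa using this
  rw [← e3, ← e4, ← e1, ← e2, ← map_add]
  rfl

variable {R : PrePoisson.{u₁}} {S : PrePoisson.{u₂}} {π : P.carrier →ₐ[ℂ] R.carrier}
  {ρ : Q.carrier →ₐ[ℂ] S.carrier}

/-- The tensor product of two degree preserving algebra homomorphisms. -/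
def PreVertexPoisson.tensorHom (hπ : ∀ i, ∀ a ∈ P.deg i, π a ∈ R.deg i)
    (hρ : ∀ i, ∀ b ∈ Q.deg i, ρ b ∈ S.deg i) :
    (P.tensor Q).carrier →ₐ[ℂ] (R.tensor S).carrier :=
  PreDGAlg.tensorHom (A' := R.toPreDGAlg) (B' := S.toPreDGAlg) π ρ hπ hρ

theorem PreVertexPoisson.tensorHom_tmul (hπ : ∀ i, ∀ a ∈ P.deg i, π a ∈ R.deg i)
    (hρ : ∀ i, ∀ b ∈ Q.deg i, ρ b ∈ S.deg i) (a : P.carrier) (b : Q.carrier) :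
    PreVertexPoisson.tensorHom hπ hρ (P.tmul Q a b) = R.tmul S (π a) (ρ b) :=
  PreDGAlg.tensorHom_tmul a b

/-- As `T 1 = 0`, one has `T (1 ⊗ b) = 1 ⊗ T b`, and left multiplication by `a ⊗ 1` gives `a ⊗ T b`.
Subtracting this from `T (a ⊗ b)` gives `T a ⊗ b`. This is the purpose of the field `T_one`. -/
theorem tmul_mem_span_range_tensor_T (hP : P.T 1 = 0) (a : P.carrier)
    (b : Q.carrier) (h : a ∈ Ideal.span (Set.range P.T) ∨ b ∈ Ideal.span (Set.range Q.T)) :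
    P.tmul Q a b ∈ (Ideal.span (Set.range (P.tensor Q).T) :
      Ideal (P.tensor Q).carrier) := by
  set I : Ideal (P.tensor Q).carrier :=
    Ideal.span (Set.range (P.tensor Q).T) with hI
  have hT : ∀ a b, P.tmul Q (P.T a) b + P.tmul Q a (Q.T b) ∈ I :=
    fun a b => Ideal.subset_span ⟨P.tmul Q a b, PreVertexPoisson.tensor_T_tmul a b⟩
  have hr : ∀ b ∈ Ideal.span (Set.range Q.T), ∀ a, P.tmul Q a b ∈ I := by
    intro b hb
    induction hb using Submodule.span_induction with
    | mem b hb =>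
      obtain ⟨b, rfl⟩ := hb
      intro a
      have h1 := hT 1 b
      rw [hP, map_zero, LinearMap.zero_apply, zero_add] at h1
      have h2 := Ideal.mul_mem_left I (P.tmul Q a 1) h1
      rwa [PreVertexPoisson.mul_one_tmul, one_mul] at h2
    | zero => intro a; rw [map_zero]; exact zero_mem _
    | add x y _ _ hx hy => intro a; rw [map_add]; exact add_mem (hx a) (hy a)
    | smul c x _ hx =>
      intro a
      rw [smul_eq_mul, ← PreVertexPoisson.mul_one_tmul]
      exact Ideal.mul_mem_left _ _ (hx 1)
  have hl : ∀ a ∈ Ideal.span (Set.range P.T), ∀ b, P.tmul Q a b ∈ I := by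
    intro a ha
    induction ha using Submodule.span_induction with
    | mem a ha =>
      obtain ⟨a, rfl⟩ := ha
      intro b
      exact (add_mem_cancel_right (hr _ (Ideal.subset_span ⟨b, rfl⟩) a)).1 (hT a b)
    | zero => intro a; rw [map_zero, LinearMap.zero_apply]; exact zero_mem _
    | add x y _ _ hx hy =>
      intro b
      rw [map_add, LinearMap.add_apply]
      exact add_mem (hx b) (hy b)
    | smul c x _ hx =>
      intro b
      rw [smul_eq_mul, ← PreVertexPoisson.tmul_one_mul]
      exact Ideal.mul_mem_left _ _ (hx b)
  exact h.elim (fun h => hl a h b) (fun h => hr b h a)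

theorem IsAssocQuotient.tensor (hP : IsAssocQuotient P R π) (hQ : IsAssocQuotient Q S ρ) :
    IsAssocQuotient (P.tensor Q) (R.tensor S)
      (PreVertexPoisson.tensorHom hP.map_deg hQ.map_deg) := by
  set F := PreVertexPoisson.tensorHom hP.map_deg hQ.map_deg with hF
  have hFt : ∀ a b, F (P.tmul Q a b) = R.tmul S (π a) (ρ b) :=
    PreVertexPoisson.tensorHom_tmul _ _
  have hFs : ∀ (c : ℤˣ) (x : (P.tensor Q).carrier),
      F (c • x) = c • F x := fun c x => by
    rw [Units.smul_def, map_zsmul, Units.smul_def]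
  refine
    { surjective := PreDGAlg.tensorHom_surjective hP.surjective hQ.surjective
      map_deg := fun n x hx => ?_
      map_T := fun x => ?_
      map_d := fun x => ?_
      map_Y := fun x y => ?_
      T_one := ?_
      ker_le := fun x hx => ?_ }
  · refine PreDGAlg.tensor_deg_induction (p := fun x _ => F x ∈ (R.tensor S).deg n)
      (fun x y _ _ hx hy => ?_) (fun i j hij a ha b hb => ?_) hx
    · exact (map_add F x y).symm ▸ add_mem hx hy
    · exact (hFt a b).symm ▸ PrePoisson.tmul_mem hij (hP.map_deg _ _ ha) (hQ.map_deg _ _ hb)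
  · induction x using PreVertexPoisson.tensor_induction with
    | hadd x y hx hy => rw [map_add, map_add, hx, hy, add_zero]
    | h a b =>
      refine (congrArg F (PreVertexPoisson.tensor_T_tmul a b)).trans ?_
      rw [map_add, hFt, hFt, hP.map_T, hQ.map_T, map_zero, map_zero, LinearMap.zero_apply, add_zero]
  · induction x using PreVertexPoisson.tensor_induction with
    | hadd x y hx hy => rw [map_add, map_add, hx, hy, map_add, map_add]
    | h a b =>
      induction a using P.homogeneous_induction with
      | hadd x y hx hy =>
        rw [map_add, LinearMap.add_apply, map_add, map_add, hx, hy, map_add, map_add]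
      | h i a ha =>
        refine (congrArg F (PreVertexPoisson.tensor_d_tmul ha b)).trans ?_
        rw [map_add, hFs, hFt, hFt, hFt, hP.map_d, hQ.map_d,
          PrePoisson.tensor_d_tmul (hP.map_deg _ _ ha)]
  · induction x using PreVertexPoisson.tensor_induction with
    | hadd x x' hx hx' =>
      rw [map_add, LinearMap.add_apply, Finsupp.add_apply, map_add, map_add, hx, hx', map_add,
        LinearMap.add_apply]
    | h a b =>
      induction y using PreVertexPoisson.tensor_induction with
      | hadd y y' hy hy' => rw [map_add, Finsupp.add_apply, map_add, map_add, hy, hy', map_add]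
      | h a' b' =>
        induction b using Q.homogeneous_induction with
        | hadd x x' hx hx' =>
          rw [map_add, map_add, LinearMap.add_apply, Finsupp.add_apply, map_add, map_add, hx, hx',
            map_add, LinearMap.add_apply]
        | h i b hb =>
          induction a' using P.homogeneous_induction with
          | hadd y y' hy hy' =>
            rw [map_add, LinearMap.add_apply, map_add, Finsupp.add_apply, map_add, map_add, hy,
              hy', map_add]
          | h j a' ha' =>
            have e := map_tensor_Y F.toLinearMap
              (fun a a' b => by
                rw [AlgHom.toLinearMap_apply, hFt, map_mul, hP.map_T, zero_mul, map_zero,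
                  LinearMap.zero_apply])
              (fun a b b' => by
                rw [AlgHom.toLinearMap_apply, hFt, map_mul, hQ.map_T, zero_mul, map_zero])
              a hb ha' b'
            simp only [AlgHom.toLinearMap_apply, hFt, map_mul, hP.map_Y, hQ.map_Y] at e
            refine e.trans ?_
            rw [hFt, hFt, PrePoisson.tensor_bracket_tmul _ (hQ.map_deg _ _ hb)
              (hP.map_deg _ _ ha'), add_comm]
  · refine (PreVertexPoisson.tensor_T_tmul 1 1).trans ?_
    rw [hP.T_one, hQ.T_one, map_zero, map_zero, LinearMap.zero_apply, add_zero]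
  · refine PreDGAlg.tensorHom_ker_induction hP.surjective hQ.surjective
      (p := fun x => x ∈ (Ideal.span (Set.range (P.tensor Q).T) :
        Ideal (P.tensor Q).carrier))
      (fun x y => add_mem) (fun a b ha => ?_) (fun a b hb => ?_) hx
    · exact tmul_mem_span_range_tensor_T hP.T_one a b (Or.inl (hP.ker_le a ha))
    · exact tmul_mem_span_range_tensor_T hP.T_one a b (Or.inr (hQ.ker_le b hb))

end

/-! ### Derivations and contractions of exterior algebras -/

section

variable {V : Type u} {W : Type v} [AddCommGroup V] [Module ℂ V] [AddCommGroup W] [Module ℂ W]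

theorem extDerivation_one (f : V →ₗ[ℂ] V) : extDerivation f 1 = 0 := by
  simp [extDerivation]

theorem extDerivation_ι (f : V →ₗ[ℂ] V) (v : V) :
    extDerivation f (ExteriorAlgebra.ι ℂ v) = ExteriorAlgebra.ι ℂ (f v) := by
  simp [extDerivation]

/-- The algebra homomorphism `x ↦ x + ε D(x)`, where `D` is the derivation extending `f`. -/
def extDerivationHom (f : V →ₗ[ℂ] V) :
    ExteriorAlgebra ℂ V →ₐ[ℂ] TrivSqZeroExt (ExteriorAlgebra ℂ V) (ExteriorAlgebra ℂ V) :=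
  ExteriorAlgebra.lift ℂ
    ⟨((TrivSqZeroExt.inlAlgHom ℂ (ExteriorAlgebra ℂ V) (ExteriorAlgebra ℂ V)).toLinearMap ∘ₗ
        ExteriorAlgebra.ι ℂ) +
      ((TrivSqZeroExt.inrHom (ExteriorAlgebra ℂ V) (ExteriorAlgebra ℂ V)).restrictScalars ℂ ∘ₗ
        ExteriorAlgebra.ι ℂ ∘ₗ f), fun v => by
      ext
      · simp
      · simp⟩

theorem snd_extDerivationHom (f : V →ₗ[ℂ] V) (x : ExteriorAlgebra ℂ V) :
    (extDerivationHom f x).snd = extDerivation f x := rfl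

theorem fst_extDerivationHom (f : V →ₗ[ℂ] V) (x : ExteriorAlgebra ℂ V) :
    (extDerivationHom f x).fst = x := by
  induction x using ExteriorAlgebra.induction with
  | algebraMap r => rw [AlgHom.commutes]; rfl
  | ι v => simp [extDerivationHom]
  | mul a b ha hb => rw [map_mul, TrivSqZeroExt.fst_mul, ha, hb]
  | add a b ha hb => rw [map_add, TrivSqZeroExt.fst_add, ha, hb]

/-- The second component of the multiplicativity of `x ↦ x + ε D(x)`. -/
theorem extDerivation_mul (f : V →ₗ[ℂ] V) (x y : ExteriorAlgebra ℂ V) :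
    extDerivation f (x * y) = extDerivation f x * y + x * extDerivation f y := by
  rw [← snd_extDerivationHom, map_mul, TrivSqZeroExt.snd_mul, fst_extDerivationHom,
    fst_extDerivationHom, snd_extDerivationHom, snd_extDerivationHom, smul_eq_mul,
    op_smul_eq_mul, add_comm]

theorem map_extDerivation {e : V →ₗ[ℂ] W} {f : V →ₗ[ℂ] V} (h : e ∘ₗ f = 0)
    (x : ExteriorAlgebra ℂ V) : ExteriorAlgebra.map e (extDerivation f x) = 0 := by
  induction x using ExteriorAlgebra.induction with
  | algebraMap r =>
    rw [Algebra.algebraMap_eq_smul_one, map_smul, extDerivation_one, smul_zero, map_zero]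
  | ι v =>
    rw [extDerivation_ι, ExteriorAlgebra.map_apply_ι]
    have := LinearMap.congr_fun h v
    rw [LinearMap.comp_apply, LinearMap.zero_apply] at this
    rw [this, map_zero]
  | mul a b ha hb => rw [extDerivation_mul, map_add, map_mul, map_mul, ha, hb, zero_mul, mul_zero,
      add_zero]
  | add a b ha hb => rw [map_add, map_add, ha, hb, add_zero]

theorem map_contractLeft (e : V →ₗ[ℂ] W) (χ : Module.Dual ℂ W) (x : ExteriorAlgebra ℂ V) :
    ExteriorAlgebra.map e (CliffordAlgebra.contractLeft (Q := (0 : QuadraticForm ℂ V))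
      (χ ∘ₗ e) x) =
    CliffordAlgebra.contractLeft (Q := (0 : QuadraticForm ℂ W)) χ (ExteriorAlgebra.map e x) := by
  have hι : ∀ v, ExteriorAlgebra.map e (CliffordAlgebra.ι (0 : QuadraticForm ℂ V) v) =
      CliffordAlgebra.ι (0 : QuadraticForm ℂ W) (e v) := ExteriorAlgebra.map_apply_ι e
  induction x using CliffordAlgebra.left_induction with
  | algebraMap r =>
    rw [CliffordAlgebra.contractLeft_algebraMap, map_zero]
    have := AlgHom.commutes (ExteriorAlgebra.map e) r
    exact ((congrArg (CliffordAlgebra.contractLeft (Q := (0 : QuadraticForm ℂ W)) χ) this).trans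
      (CliffordAlgebra.contractLeft_algebraMap (0 : QuadraticForm ℂ W) χ r)).symm
  | add x y hx hy => rw [map_add, map_add, map_add, map_add, hx, hy]
  | ι_mul x v hx =>
    rw [CliffordAlgebra.contractLeft_ι_mul, map_sub, map_smul, map_mul, map_mul, hι, hx,
      CliffordAlgebra.contractLeft_ι_mul, LinearMap.comp_apply]

theorem map_reverse (e : V →ₗ[ℂ] W) (x : ExteriorAlgebra ℂ V) :
    ExteriorAlgebra.map e (CliffordAlgebra.reverse (Q := (0 : QuadraticForm ℂ V)) x) =
      CliffordAlgebra.reverse (Q := (0 : QuadraticForm ℂ W)) (ExteriorAlgebra.map e x) := by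
  have hι : ∀ v, ExteriorAlgebra.map e (CliffordAlgebra.ι (0 : QuadraticForm ℂ V) v) =
      CliffordAlgebra.ι (0 : QuadraticForm ℂ W) (e v) := ExteriorAlgebra.map_apply_ι e
  induction x using CliffordAlgebra.left_induction with
  | algebraMap r =>
    rw [CliffordAlgebra.reverse.commutes]
    have := AlgHom.commutes (ExteriorAlgebra.map e) r
    exact this.trans ((congrArg _ this).trans (CliffordAlgebra.reverse.commutes r)).symm
  | add x y hx hy => rw [map_add, map_add, map_add, map_add, hx, hy]
  | ι_mul x v hx =>
    rw [CliffordAlgebra.reverse.map_mul, map_mul, map_mul, CliffordAlgebra.reverse.map_mul,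
      hx, CliffordAlgebra.reverse_ι, hι, CliffordAlgebra.reverse_ι]

theorem contractRightSeq_apply (φ : V →ₗ[ℂ] (ℕ →₀ ℂ)) (x : ExteriorAlgebra ℂ V) (k : ℕ) :
    contractRightSeq φ x k = CliffordAlgebra.contractRight (Q := (0 : QuadraticForm ℂ V)) x
      (Finsupp.lapply k ∘ₗ φ) := by
  rw [CliffordAlgebra.contractRight_eq]
  rfl

theorem map_contractRight (e : V →ₗ[ℂ] W) (χ : Module.Dual ℂ W) (x : ExteriorAlgebra ℂ V) :
    ExteriorAlgebra.map e (CliffordAlgebra.contractRight (Q := (0 : QuadraticForm ℂ V)) x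
      (χ ∘ₗ e)) =
    CliffordAlgebra.contractRight (Q := (0 : QuadraticForm ℂ W)) (ExteriorAlgebra.map e x) χ := by
  rw [CliffordAlgebra.contractRight_eq, CliffordAlgebra.contractRight_eq, map_reverse,
    map_contractLeft, map_reverse]

/-- At `n = 0` the sequence has the term `∑ (-1)^k (T ^ (k + l) aₖ) bₗ`, and `π` kills every summand
but `k = l = 0`. -/
theorem map_masterSeq_apply_zero {Λ : Type u} {Γ : Type v} [Ring Λ] [Algebra ℂ Λ] [Ring Γ]
    [Algebra ℂ Γ] (π : Λ →ₐ[ℂ] Γ) {T : Λ →ₗ[ℂ] Λ} (hT : ∀ x, π (T x) = 0) (a b : ℕ →₀ Λ) :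
    π (masterSeq T a b 0) = π (a 0) * π (b 0) := by
  induction a using Finsupp.induction_linear with
  | zero => simp
  | add a a' ha ha' => simp only [map_add, LinearMap.add_apply, Finsupp.add_apply, ha, ha', add_mul]
  | single k x =>
    induction b using Finsupp.induction_linear with
    | zero => simp
    | add b b' hb hb' => simp only [map_add, Finsupp.add_apply, hb, hb', mul_add]
    | single l y =>
      have e : masterSeq T (Finsupp.single k x) (Finsupp.single l y) 0 =
          (-1 : ℂ) ^ k • ((T ^ (k + l)) x * y) := by
        simp only [masterSeq, Finsupp.lsum_single, LinearMap.flip_apply, LinearMap.sum_apply,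
          Finsupp.finsetSum_apply, LinearMap.smul_apply, Finsupp.smul_apply,
          LinearMap.compr₂_apply, Finsupp.lsingle_apply, LinearMap.comp_apply,
          LinearMap.mul_apply']
        rw [Finset.sum_eq_single 0]
        · simp
        · intro n _ hn
          rw [Finsupp.single_eq_of_ne hn.symm, smul_zero]
        · simp
      rw [e, map_smul, map_mul]
      rcases Nat.eq_zero_or_pos (k + l) with h | h
      · obtain ⟨rfl, rfl⟩ : k = 0 ∧ l = 0 := by omega
        simp
      · obtain ⟨m, hm⟩ := Nat.exists_eq_succ_of_ne_zero h.ne'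
        rw [hm, pow_succ', Module.End.mul_apply, hT, zero_mul, smul_zero]
        rcases Nat.eq_zero_or_pos k with rfl | hk
        · rw [Finsupp.single_eq_of_ne (a := l) (a' := 0) (by omega), map_zero π, mul_zero]
        · rw [Finsupp.single_eq_of_ne (a := k) (a' := 0) (by omega), map_zero π, zero_mul]

/-- The kernel of the map of exterior algebras induced by a split surjection `e : V → W` with
kernel contained in the range of `f` is contained in the ideal generated by the image of the
derivation extending `f`. -/
theorem mem_span_range_extDerivation {e : V →ₗ[ℂ] W} {s : W →ₗ[ℂ] V} {f : V →ₗ[ℂ] V}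
    (hs : ∀ v, ∃ w, v - s (e v) = f w) {x : ExteriorAlgebra ℂ V}
    (hx : ExteriorAlgebra.map e x = 0) : x ∈ Ideal.span (Set.range (extDerivation f)) := by
  set I := Ideal.span (Set.range (extDerivation f)) with hI
  have hι : ∀ v, ExteriorAlgebra.map (s ∘ₗ e) (CliffordAlgebra.ι (0 : QuadraticForm ℂ V) v) =
      ExteriorAlgebra.ι ℂ (s (e v)) := ExteriorAlgebra.map_apply_ι _
  -- `Ideal` means left ideal, while in the induction below the generator `f w` appears on the left
  -- of the product. It has to be moved to the right end.
  have swap : ∀ (v : V) (z : ExteriorAlgebra ℂ V), ∃ z',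
      ExteriorAlgebra.ι ℂ v * z = z' * ExteriorAlgebra.ι ℂ v := by
    intro v z
    induction z using CliffordAlgebra.left_induction with
    | algebraMap r => exact ⟨algebraMap ℂ _ r, (Algebra.commutes r _).symm⟩
    | add x y hx hy =>
      obtain ⟨x', hx⟩ := hx
      obtain ⟨y', hy⟩ := hy
      exact ⟨x' + y', by rw [mul_add, hx, hy, add_mul]⟩
    | ι_mul x w hx =>
      obtain ⟨x', hx⟩ := hx
      refine ⟨-(ExteriorAlgebra.ι ℂ w * x'), ?_⟩
      have := ι_mul_ι_swap v w
      rw [neg_mul, mul_assoc, ← hx, ← mul_assoc, ← mul_assoc, ← neg_mul, ← this]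
  -- On vectors `s ∘ e` is the identity modulo the range of `f`, and this extends multiplicatively.
  -- An element killed by `map e` is then its own difference.
  have key : ∀ x, x - ExteriorAlgebra.map (s ∘ₗ e) x ∈ I := by
    intro x
    induction x using CliffordAlgebra.left_induction with
    | algebraMap r =>
      have := AlgHom.commutes (ExteriorAlgebra.map (s ∘ₗ e)) r
      have h : algebraMap ℂ (ExteriorAlgebra ℂ V) r -
        ExteriorAlgebra.map (s ∘ₗ e) (algebraMap ℂ _ r) ∈ I := by
        rw [this, sub_self]
        exact zero_mem _
      exact h
    | add x y hx hy =>
      rw [map_add, add_sub_add_comm]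
      exact add_mem hx hy
    | ι_mul x v hx =>
      obtain ⟨w, hw⟩ := hs v
      obtain ⟨z, hz⟩ := swap (f w) x
      have h : ExteriorAlgebra.ι ℂ v * x -
          ExteriorAlgebra.ι ℂ (s (e v)) * ExteriorAlgebra.map (s ∘ₗ e) x =
          z * extDerivation f (ExteriorAlgebra.ι ℂ w) +
          ExteriorAlgebra.ι ℂ (s (e v)) * (x - ExteriorAlgebra.map (s ∘ₗ e) x) := by
        rw [extDerivation_ι, ← hz, ← hw, map_sub, sub_mul, mul_sub]
        abel
      rw [map_mul, hι]
      have h' : ExteriorAlgebra.ι ℂ v * x -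
          ExteriorAlgebra.ι ℂ (s (e v)) * ExteriorAlgebra.map (s ∘ₗ e) x ∈ I := by
        rw [h]
        exact add_mem (Ideal.mul_mem_left _ _ (Ideal.subset_span ⟨_, rfl⟩))
          (Ideal.mul_mem_left _ _ hx)
      exact h'
  have h := key x
  rwa [← ExteriorAlgebra.map_comp_map, AlgHom.comp_apply, hx, map_zero, sub_zero] at h

end

/-! ### The associated Poisson algebra of `coCl` -/

section

variable (g : Type u) [AddCommGroup g] [Module ℂ g]

theorem shift_apply_zero {W : Type v} [AddCommGroup W] [Module ℂ W] (f : ℕ →₀ W) :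
    shift W f 0 = 0 :=
  Finsupp.mapDomain_of_notMem_range _ _ (by simp)

theorem exists_shift_eq_sub {W : Type v} [AddCommGroup W] [Module ℂ W] (f : ℕ →₀ W) :
    ∃ h, f - Finsupp.single 0 (f 0) = shift W h := by
  induction f using Finsupp.induction_linear with
  | zero => exact ⟨0, by simp⟩
  | add f f' hf hf' =>
    obtain ⟨h, hh⟩ := hf
    obtain ⟨h', hh'⟩ := hf'
    refine ⟨h + h', ?_⟩
    rw [map_add, ← hh, ← hh', Finsupp.add_apply, Finsupp.single_add]
    abel
  | single k x =>
    cases k with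
    | zero => exact ⟨0, by simp⟩
    | succ k => exact ⟨Finsupp.single k x, by simp [shift, Finsupp.mapDomain_single]⟩

/-- The evaluation at `t = 0`. -/
def jetEval : (ℕ →₀ g) × (ℕ →₀ Module.Dual ℂ g) →ₗ[ℂ] g × Module.Dual ℂ g :=
  LinearMap.prodMap (Finsupp.lapply 0) (Finsupp.lapply 0)

/-- The inclusion of the constants. -/
def jetConst : g × Module.Dual ℂ g →ₗ[ℂ] (ℕ →₀ g) × (ℕ →₀ Module.Dual ℂ g) :=
  LinearMap.prodMap (Finsupp.lsingle 0) (Finsupp.lsingle 0)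

theorem jetEval_comp_shift :
    jetEval g ∘ₗ LinearMap.prodMap (shift g) (shift (Module.Dual ℂ g)) = 0 := by
  refine LinearMap.ext fun v => Prod.ext ?_ ?_
  · exact shift_apply_zero v.1
  · exact shift_apply_zero v.2

theorem map_jetEval_mem {n : ℤ}
    {x : ExteriorAlgebra ℂ ((ℕ →₀ g) × (ℕ →₀ Module.Dual ℂ g))}
    (hx : x ∈ extDeg (ℕ →₀ g) (ℕ →₀ Module.Dual ℂ g) n) :
    ExteriorAlgebra.map (jetEval g) x ∈ extDeg g (Module.Dual ℂ g) n := by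
  induction hx using extDeg_induction with
  | h0 => rw [map_zero]; exact zero_mem _
  | h1 => rw [map_one]; exact SetLike.GradedOne.one_mem
  | hadd n x y _ _ hx hy => rw [map_add]; exact add_mem hx hy
  | hsmul n c x _ hx => rw [map_smul]; exact Submodule.smul_mem _ _ hx
  | hι n k x v _ hv hx =>
    rw [map_mul, ExteriorAlgebra.map_apply_ι]
    have h : IsExtGenerator (jetEval g v) k := by
      obtain ⟨hk, h⟩ | ⟨hk, h⟩ := hv
      · exact Or.inl ⟨hk, by simp [jetEval, h]⟩
      · exact Or.inr ⟨hk, by simp [jetEval, h]⟩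
    exact SetLike.GradedMul.mul_mem h.mem hx

variable [FiniteDimensional ℂ g]

/-- The projection of `coCl(g[t])` onto `cCl(g)`. -/
def cliffordProj : (coCl g).carrier →ₐ[ℂ] (cCl g).carrier := ExteriorAlgebra.map (jetEval g)

theorem cliffordProj_ι (v : (ℕ →₀ g) × (ℕ →₀ Module.Dual ℂ g)) :
    cliffordProj g (ExteriorAlgebra.ι ℂ v) = ExteriorAlgebra.ι ℂ (jetEval g v) :=
  ExteriorAlgebra.map_apply_ι _ v

/-- Contractions commute with evaluation at `t = 0`: the zeroth forms of `coCl` are the forms of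
`cCl` composed with `jetEval`. The terms of `masterSeq` containing `T` die. -/
theorem map_coCl_Y (a b : ExteriorAlgebra ℂ ((ℕ →₀ g) × (ℕ →₀ Module.Dual ℂ g))) :
    ExteriorAlgebra.map (jetEval g) ((coCl g).Y a b 0) =
      cliffordBracket g (ExteriorAlgebra.map (jetEval g) a)
        (ExteriorAlgebra.map (jetEval g) b) := by
  let φ : Fin (Module.finrank ℂ g) → ((ℕ →₀ g) × (ℕ →₀ Module.Dual ℂ g)) →ₗ[ℂ] (ℕ →₀ ℂ) :=
    fun i => Finsupp.mapRange.linearMap ((Module.finBasis ℂ g).coord i) ∘ₗ LinearMap.fst ℂ _ _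
  let φs : Fin (Module.finrank ℂ g) → ((ℕ →₀ g) × (ℕ →₀ Module.Dual ℂ g)) →ₗ[ℂ] (ℕ →₀ ℂ) :=
    fun i => Finsupp.mapRange.linearMap (Module.Dual.eval ℂ g (Module.finBasis ℂ g i)) ∘ₗ
      LinearMap.snd ℂ _ _
  have e : (coCl g).Y a b 0 = (∑ i,
      ((masterSeq (extDerivation (LinearMap.prodMap (shift g) (shift (Module.Dual ℂ g))))).compl₁₂
          (contractRightSeq (φ i)) (contractLeftSeq (φs i)) +
        (masterSeq (extDerivation (LinearMap.prodMap (shift g) (shift (Module.Dual ℂ g))))).compl₁₂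
          (contractRightSeq (φs i)) (contractLeftSeq (φ i))) :
      ExteriorAlgebra ℂ ((ℕ →₀ g) × (ℕ →₀ Module.Dual ℂ g)) →ₗ[ℂ] _) a b 0 := rfl
  rw [e, cliffordBracket_apply]
  simp only [LinearMap.sum_apply, Finsupp.finsetSum_apply, LinearMap.add_apply, Finsupp.add_apply,
    LinearMap.compl₁₂_apply, map_sum, map_add]
  refine Finset.sum_congr rfl fun i _ => ?_
  rw [map_masterSeq_apply_zero _ (map_extDerivation (jetEval_comp_shift g)),
    map_masterSeq_apply_zero _ (map_extDerivation (jetEval_comp_shift g)),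
    contractRightSeq_apply, contractRightSeq_apply, contractMul_apply, contractMul_apply,
    ← map_contractLeft, ← map_contractLeft, ← map_contractRight, ← map_contractRight]
  rfl

/-- The constants split the evaluation at `t = 0`, and a vector minus its constant term is divisible
by `t`, hence in the range of the shift that `T` extends. -/
theorem cliffordProj_isAssocQuotient : IsAssocQuotient (coCl g) (cCl g) (cliffordProj g) where
  surjective x := by
    refine ⟨ExteriorAlgebra.map (jetConst g) x, ?_⟩
    have h : jetEval g ∘ₗ jetConst g = LinearMap.id := by
      refine LinearMap.ext fun v => Prod.ext ?_ ?_ <;> simp [jetEval, jetConst]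
    have e : ((ExteriorAlgebra.map (jetEval g)).comp (ExteriorAlgebra.map (jetConst g))) x = x := by
      rw [ExteriorAlgebra.map_comp_map, h, ExteriorAlgebra.map_id]
      rfl
    exact e
  map_deg _ _ ha := map_jetEval_mem g ha
  map_T := map_extDerivation (jetEval_comp_shift g)
  map_d _ := map_zero (cliffordProj g)
  map_Y a b := map_coCl_Y g a b
  T_one := extDerivation_one _
  ker_le _ ha := mem_span_range_extDerivation (s := jetConst g) (fun v => by
    obtain ⟨x, hx⟩ := exists_shift_eq_sub v.1
    obtain ⟨y, hy⟩ := exists_shift_eq_sub v.2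
    exact ⟨(x, y), Prod.ext hx hy⟩) ha

end

/-! ### The associated Poisson algebra of the coisson BRST complex -/

section

variable {g : Type u} [LieRing g] [LieAlgebra ℂ g] [FiniteDimensional ℂ g]
  {P : PreVertexPoisson.{v}} {R : PrePoisson.{w}} {π : P.carrier →ₐ[ℂ] R.carrier}

/-- The charge involves only constant generators and `μ` on constants, so it maps to the classical
charge; the tensor and twist statements then apply. -/
theorem IsAssocQuotient.coBRST (h : IsAssocQuotient P R π)
    {μ : (jets g).carrier →ₗ[ℂ] P.carrier} {ν : g →ₗ[ℂ] R.carrier}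
    (hμ : ∀ x, π (μ (Finsupp.single 0 x)) = ν x) :
    ∃ ρ, IsAssocQuotient (coBRST g P μ) (cBRST g R ν) ρ := by
  let F := PreVertexPoisson.tensorHom (cliffordProj_isAssocQuotient g).map_deg h.map_deg
  let ψ : g → (coCl g).carrier := fun x => ExteriorAlgebra.ι ℂ
    ((Finsupp.single 0 x, 0) : (ℕ →₀ g) × (ℕ →₀ Module.Dual ℂ g))
  let ψs : Module.Dual ℂ g → (coCl g).carrier := fun f => ExteriorAlgebra.ι ℂ
    ((0, Finsupp.single 0 f) : (ℕ →₀ g) × (ℕ →₀ Module.Dual ℂ g))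
  have hψ : ∀ x, cliffordProj g (ψ x) = ghost g x := fun x =>
    (cliffordProj_ι g _).trans (by simp [jetEval]; rfl)
  have hψs : ∀ f, cliffordProj g (ψs f) = ghostDual g f := fun f =>
    (cliffordProj_ι g _).trans (by simp [jetEval]; rfl)
  have hF : ∀ a b, F ((coCl g).tmul P a b) = (cCl g).tmul R (cliffordProj g a) (π b) :=
    PreVertexPoisson.tensorHom_tmul _ _
  have hQ : F (∑ i, (coCl g).tmul P (ψs ((Module.finBasis ℂ g).coord i))
        (μ (Finsupp.single 0 (Module.finBasis ℂ g i))) +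
      (2⁻¹ : ℂ) • ∑ i, ∑ j, (coCl g).tmul P (ψs ((Module.finBasis ℂ g).coord i) *
        (ψ ⁅Module.finBasis ℂ g i, Module.finBasis ℂ g j⁆ *
          ψs ((Module.finBasis ℂ g).coord j))) 1) =
      brstCharge (Module.finBasis ℂ g) ν (ghost g) (ghostDual g) := by
    simp only [map_add, map_smul, map_sum, hF, map_mul, map_one, hψ, hψs, hμ, brstCharge,
      linearCharge, cubicCharge, LinearMap.sum_apply]
  rw [cBRST_eq]
  exact ⟨F, ((cliffordProj_isAssocQuotient g).tensor h).twist hQ⟩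

end

/-! ### Gluing -/

theorem tensorHom_sub {P : PreVertexPoisson.{u}} {Q : PreVertexPoisson.{v}}
    {R : PrePoisson.{u₁}} {S : PrePoisson.{u₂}} {π : P.carrier →ₐ[ℂ] R.carrier}
    {ρ : Q.carrier →ₐ[ℂ] S.carrier} (hπ : ∀ i, ∀ a ∈ P.deg i, π a ∈ R.deg i)
    (hρ : ∀ i, ∀ b ∈ Q.deg i, ρ b ∈ S.deg i) (a : P.carrier) (b : Q.carrier) :
    PreVertexPoisson.tensorHom hπ hρ (P.tmul Q 1 b - P.tmul Q a 1) =
      R.tmul S 1 (ρ b) - R.tmul S (π a) 1 := by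
  rw [map_sub, PreVertexPoisson.tensorHom_tmul, PreVertexPoisson.tensorHom_tmul, map_one π,
    map_one ρ]

/-- The cross terms contain brackets with `1`, and the two minus signs in front of `a` and `a'`
cancel. -/
theorem tensor_bracket_sub {R : PrePoisson.{u}} {S : PrePoisson.{v}} (hR : R.IsSkewBiderivation)
    (hS : S.IsSkewBiderivation) {a a' : R.carrier} {b b' : S.carrier} (ha' : a' ∈ R.deg 0)
    (hb : b ∈ S.deg 0) :
    (R.tensor S).bracket (R.tmul S 1 b - R.tmul S a 1) (R.tmul S 1 b' - R.tmul S a' 1) =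
      R.tmul S 1 (S.bracket b b') + R.tmul S (R.bracket a a') 1 := by
  have hR1 : (1 : R.carrier) ∈ R.deg 0 := SetLike.GradedOne.one_mem
  have hS1 : (1 : S.carrier) ∈ S.deg 0 := SetLike.GradedOne.one_mem
  simp only [map_sub, LinearMap.sub_apply]
  rw [PrePoisson.tensor_bracket_tmul _ hb hR1, PrePoisson.tensor_bracket_tmul _ hb ha',
    PrePoisson.tensor_bracket_tmul _ hS1 hR1, PrePoisson.tensor_bracket_tmul _ hS1 ha']
  simp [hR.bracket_one, hR.one_bracket, hS.bracket_one, hS.one_bracket]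

section

variable {g₁ : Type u₁} {g₂ : Type u₂} {g₃ : Type u₃}
  [LieRing g₁] [LieAlgebra ℂ g₁] [LieRing g₂] [LieAlgebra ℂ g₂] [LieRing g₃] [LieAlgebra ℂ g₃]

theorem jets_Y_single_zero {g : Type u} [LieRing g] [LieAlgebra ℂ g] (x y : g) :
    (jets g).Y (Finsupp.single 0 x : ℕ →₀ g) (Finsupp.single 0 y : ℕ →₀ g) 0 =
      (Finsupp.single 0 ⁅x, y⁆ : ℕ →₀ g) := by
  change (Finsupp.lsum ℂ (fun i : ℕ => LinearMap.flip (Finsupp.lsum ℂ fun j : ℕ => LinearMap.flip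
    (∑ n ∈ Finset.range (i + j + 1),
      ((-1 : ℂ) ^ i * (n.descFactorial i : ℂ) * (j.descFactorial (n - i) : ℂ)) •
        ((LinearMap.mk₂ ℂ (fun x y : g => ⁅x, y⁆) add_lie smul_lie lie_add
          (fun c x y => lie_smul c x y)).compr₂
            (Finsupp.lsingle n ∘ₗ Finsupp.lsingle (i + j - n)))))) :
      (ℕ →₀ g) →ₗ[ℂ] (ℕ →₀ g) →ₗ[ℂ] (ℕ →₀ ℕ →₀ g))
    (Finsupp.single 0 x) (Finsupp.single 0 y) 0 = Finsupp.single 0 ⁅x, y⁆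
  simp

/-- `g[t]` is concentrated in degree `0` and a momentum map preserves degrees. -/
theorem CoissonObject.mem_deg_zero {g : Type u} [LieRing g] [LieAlgebra ℂ g]
    (P : CoissonObject.{u, v} g) (x : g) :
    P.μ.toLinearMap (Finsupp.single 0 x : ℕ →₀ g) ∈ P.alg.deg 0 :=
  P.μ.map_deg 0 _ (by
    have h : (Finsupp.single 0 x : ℕ →₀ g) ∈ degZero (ℕ →₀ g) 0 := by simp [degZero]
    exact h)

theorem CoissonObject.d_apply {g : Type u} [LieRing g] [LieAlgebra ℂ g]
    (P : CoissonObject.{u, v} g) (x : g) :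
    P.alg.d (P.μ.toLinearMap (Finsupp.single 0 x : ℕ →₀ g)) = 0 := by
  have h := P.μ.map_d (Finsupp.single 0 x : ℕ →₀ g)
  exact h.symm.trans (map_zero P.μ.toLinearMap)

/-- The momentum map of the associated Poisson algebra. -/
def CoissonObject.assocMomentum {g : Type u} [LieRing g] [LieAlgebra ℂ g]
    (P : CoissonObject.{u, v} g) : g →ₗ[ℂ] (assocPoisson P.alg).carrier :=
  (assocMk P.alg).toLinearMap ∘ₗ P.μ.toLinearMap ∘ₗ Finsupp.lsingle 0

section

variable {g : Type u} [LieRing g] [LieAlgebra ℂ g] (P : CoissonObject.{u, v} g)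

theorem CoissonObject.assocMomentum_mem (x : g) :
    P.assocMomentum x ∈ (assocPoisson P.alg).deg 0 :=
  ⟨_, P.mem_deg_zero x, rfl⟩

theorem CoissonObject.d_assocMomentum (x : g) :
    (assocPoisson P.alg).d (P.assocMomentum x) = 0 :=
  (congrArg (assocMk P.alg) (P.d_apply x)).trans (map_zero (assocMk P.alg))

theorem CoissonObject.bracket_assocMomentum (x y : g) :
    (assocPoisson P.alg).bracket (P.assocMomentum x) (P.assocMomentum y) =
      P.assocMomentum ⁅x, y⁆ := by
  have h := P.μ.map_Y (Finsupp.single 0 x : ℕ →₀ g) (Finsupp.single 0 y : ℕ →₀ g) 0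
  rw [jets_Y_single_zero] at h
  exact congrArg (assocMk P.alg) h.symm

end

variable (P : CoissonObject.{max u₁ u₂, v} (g₁ × g₂)) (P' : CoissonObject.{max u₂ u₃, w} (g₂ × g₃))

theorem assocMomentum_apply (x : g₂) :
    assocMomentum P P' x =
      (assocPoisson P.alg).op.tmul (assocPoisson P'.alg) 1 (P'.assocMomentum (x, 0)) -
        (assocPoisson P.alg).op.tmul (assocPoisson P'.alg) (P.assocMomentum (0, x)) 1 := rfl

theorem glueMomentum_single_zero (x : g₂) :
    glueMomentum P P' (Finsupp.single 0 x : ℕ →₀ g₂) =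
      P.alg.op.tmul P'.alg 1 (P'.μ.toLinearMap (Finsupp.single 0 (x, 0) : ℕ →₀ g₂ × g₃)) -
        P.alg.op.tmul P'.alg (P.μ.toLinearMap (Finsupp.single 0 (0, x) : ℕ →₀ g₁ × g₂)) 1 :=
  (Finsupp.lsum_single ℂ _ 0 x).trans rfl

/-- The associated Poisson algebras of the factors of the gluing. -/
theorem isAssocQuotient_op_tensor :
    IsAssocQuotient (P.alg.op.tensor P'.alg)
      ((assocPoisson P.alg).op.tensor (assocPoisson P'.alg))
      (PreVertexPoisson.tensorHom (assocMk_isAssocQuotient P.isDGVertexPoisson).op.map_deg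
        (assocMk_isAssocQuotient P'.isDGVertexPoisson).map_deg) :=
  (assocMk_isAssocQuotient P.isDGVertexPoisson).op.tensor
    (assocMk_isAssocQuotient P'.isDGVertexPoisson)

theorem nonempty_gluing_iso [FiniteDimensional ℂ g₂] :
    Nonempty ((assocPoisson (gluing P P')).Iso
      (cBRST g₂ ((assocPoisson P.alg).op.tensor (assocPoisson P'.alg))
        (assocMomentum P P'))) := by
  have h : ∀ x : g₂, PreVertexPoisson.tensorHom
      (assocMk_isAssocQuotient P.isDGVertexPoisson).op.map_deg
      (assocMk_isAssocQuotient P'.isDGVertexPoisson).map_deg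
      (glueMomentum P P' (Finsupp.single 0 x : ℕ →₀ g₂)) = assocMomentum P P' x := by
    intro x
    rw [glueMomentum_single_zero]
    exact tensorHom_sub _ _ _ _
  obtain ⟨ρ, hρ⟩ := (isAssocQuotient_op_tensor P P').coBRST h
  exact hρ.nonempty_iso

theorem cBRST_assoc_isDGPoisson [FiniteDimensional ℂ g₂] :
    (cBRST g₂ ((assocPoisson P.alg).op.tensor (assocPoisson P'.alg))
      (assocMomentum P P')).IsDGPoisson := by
  have hR : (assocPoisson P.alg).op.IsDGPoisson :=
    (assocPoisson_isDGPoisson P.isDGVertexPoisson).op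
  have hS := assocPoisson_isDGPoisson P'.isDGVertexPoisson
  have h0 : ∀ x, P.assocMomentum x ∈ (assocPoisson P.alg).op.deg 0 := P.assocMomentum_mem
  have h0d : ∀ x, (assocPoisson P.alg).op.d (P.assocMomentum x) = 0 := P.d_assocMomentum
  -- The sign of the opposite bracket is what makes `x ↦ -μ_P(0, x)` a Lie morphism into the
  -- opposite algebra.
  have h0b : ∀ x y, (assocPoisson P.alg).op.bracket (P.assocMomentum x) (P.assocMomentum y) =
      -P.assocMomentum ⁅x, y⁆ := fun x y => congrArg Neg.neg (P.bracket_assocMomentum x y)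
  have hR1 : (1 : (assocPoisson P.alg).op.carrier) ∈ (assocPoisson P.alg).op.deg 0 :=
    SetLike.GradedOne.one_mem
  have hS1 : (1 : (assocPoisson P'.alg).carrier) ∈ (assocPoisson P'.alg).deg 0 :=
    SetLike.GradedOne.one_mem
  refine cBRST_isDGPoisson (hR.tensor hS) (fun x => ?_) (fun x => ?_) (fun x y => ?_)
  · rw [assocMomentum_apply]
    exact sub_mem (PrePoisson.tmul_mem (add_zero 0) hR1 (P'.assocMomentum_mem _))
      (PrePoisson.tmul_mem (add_zero 0) (h0 _) hS1)
  · rw [assocMomentum_apply, map_sub, PrePoisson.tensor_d_tmul hR1,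
      PrePoisson.tensor_d_tmul (h0 _), hR.d_one, hS.d_one, h0d, P'.d_assocMomentum]
    simp
  · refine (tensor_bracket_sub (a := P.assocMomentum (0, x)) (b' := P'.assocMomentum (y, 0))
      hR.isSkewBiderivation hS.isSkewBiderivation (h0 (0, y))
      (P'.assocMomentum_mem (x, 0))).trans ?_
    rw [h0b, P'.bracket_assocMomentum, assocMomentum_apply]
    have h1 : ⁅((0, x) : g₁ × g₂), ((0, y) : g₁ × g₂)⁆ = (0, ⁅x, y⁆) :=
      Prod.ext (lie_self 0) rfl
    have h2 : ⁅((x, 0) : g₂ × g₃), ((y, 0) : g₂ × g₃)⁆ = (⁅x, y⁆, 0) :=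
      Prod.ext rfl (lie_self 0)
    rw [h1, h2, sub_eq_add_neg, add_right_inj]
    exact LinearMap.congr_fun (map_neg ((assocPoisson P.alg).op.tmul (assocPoisson P'.alg))
      (P.assocMomentum (0, ⁅x, y⁆))) 1

end

end CoissonGluing

end

theorem mainTheorem4 {g₁ : Type u₁} {g₂ : Type u₂} {g₃ : Type u₃}
    [LieRing g₁] [LieAlgebra ℂ g₁] [FiniteDimensional ℂ g₁] [LieAlgebra.IsSemisimple ℂ g₁]
    [LieRing g₂] [LieAlgebra ℂ g₂] [FiniteDimensional ℂ g₂] [LieAlgebra.IsSemisimple ℂ g₂]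
    [LieRing g₃] [LieAlgebra ℂ g₃] [FiniteDimensional ℂ g₃] [LieAlgebra.IsSemisimple ℂ g₃]
    (P : CoissonGluing.CoissonObject.{max u₁ u₂, v} (g₁ × g₂))
    (P' : CoissonGluing.CoissonObject.{max u₂ u₃, w} (g₂ × g₃)) :
    (CoissonGluing.assocPoisson (CoissonGluing.gluing P P')).IsDGPoisson ∧
    (CoissonGluing.cBRST g₂
      ((CoissonGluing.assocPoisson P.alg).op.tensor (CoissonGluing.assocPoisson P'.alg))
      (CoissonGluing.assocMomentum P P')).IsDGPoisson ∧
    Nonempty (CoissonGluing.PrePoisson.Iso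
      (CoissonGluing.assocPoisson (CoissonGluing.gluing P P'))
      (CoissonGluing.cBRST g₂
        ((CoissonGluing.assocPoisson P.alg).op.tensor (CoissonGluing.assocPoisson P'.alg))
        (CoissonGluing.assocMomentum P P'))) := by
  have h := CoissonGluing.cBRST_assoc_isDGPoisson P P'
  have e := CoissonGluing.nonempty_gluing_iso P P'
  -- The Poisson axioms for the algebra associated to the gluing come from the classical complex,
  -- through the isomorphism.
  exact ⟨e.elim fun e => e.isDGPoisson h, h, e⟩
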